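/- Let $(M,\sigma)$ be a symplectic manifold without boundary, not necessarily compact, whose topology is given by a metric (used below for the Hausdorff distance). **The invariants.** For $N\ge 3$, a *marked domain* $D=(\Delta,p_1,\dots,p_N)$ consists of a compact convex set $\Delta\subset\mathbb R^2$ of area $1$ whose boundary is smooth or polygonal, and of $N$ distinct points $p_1,\dots,p_N\in\partial\Delta$ in counterclockwise cyclic order; $\gamma_i\subset\partial\Delta$ is the closed arc that goes counterclockwise from $p_i$ to $p_{i+1}$ (indices mod $N$). For subsets $X_1,\dots,X_N\subset M$ let $$\mathrm{Pb}^{D}_N(X_1,\dots,X_N)=\inf_{\Phi}\ \sup_{M}\,\bigl|\{\Phi_1,\Phi_2\}\bigr|\in[0,\infty],$$ where $\{\cdot,\cdot\}$ is the Poisson bracket of $(M,\sigma)$ and the infimum is over all smooth maps $\Phi=(\Phi_1,\Phi_2)\colon M\to\mathbb R^2$ with $\Phi(M)\subseteq\Delta$ such that, for some $p\in\Delta$, both components of $\Phi-p$ have compact support, and such that each $X_i$ has an open neighbourhood $U_i$ with $\Phi(U_i)\subseteq\gamma_i$. Sets $X_1,\dots,X_N$ *intersect cyclically* if $X_i\cap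 X_j=\emptyset$ whenever $i\notin\{j-1,j,j+1\}$ mod $N$. **Theorem.** Let $N\ge 3$ and let $X_1,\dots,X_N\subset M$ be compact sets intersecting cyclically; if $N=3$, assume also that $X_1\cap X_2\cap X_3=\emptyset$. Let $K_1\supseteq K_2\supseteq\cdots$ be compact neighbourhoods of $X_1\cap X_N$ that converge to $X_1\cap X_N$ in the Hausdorff distance (if $X_1\cap X_N=\emptyset$, this means that $K_n=\emptyset$ for all large $n$), and assume that $K_1\cap\bigcup_{j=2}^{N-1}X_j=\emptyset$. Then for every marked domain $D$ with $N$ points and every marked domain $D'$ with $N+1$ points, $\mathrm{Pb}^{D}_N(X_1,\dots,X_N)$ is finite and $$\lim_{n\to\infty}\mathrm{Pb}^{D'}_{N+1}\bigl(\overline{X_1\setminus K_n},X_2,\dots,X_{N-1},\overline{X_N\setminus K_n},K_n\bigr)=\mathrm{Pb}^{D}_N(X_1,\dots,X_N).$$ -/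

import Mathlib

open scoped Manifold ContDiff Topology ENNReal

/-! ## Symplectic manifolds and the Poisson bracket -/

section Symplectic

/-- The expression, in the chart of `M` centred at `x₀`, of a (pointwise) alternating 2-form `σ` on
`M`: the pullback of `σ` by the inverse of the chart. -/
noncomputable def formInChart {E : Type*} [NormedAddCommGroup E] [NormedSpace ℝ E]
    {M : Type*} [TopologicalSpace M] [ChartedSpace E M]
    (σ : ∀ x : M, TangentSpace 𝓘(ℝ, E) x [⋀^Fin 2]→L[ℝ] ℝ) (x₀ : M) (y : E) :
    E [⋀^Fin 2]→L[ℝ] ℝ :=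
  (σ ((extChartAt 𝓘(ℝ, E) x₀).symm y)).compContinuousLinearMap
    (mfderiv 𝓘(ℝ, E) 𝓘(ℝ, E) (extChartAt 𝓘(ℝ, E) x₀).symm y :
      E →L[ℝ] TangentSpace 𝓘(ℝ, E) ((extChartAt 𝓘(ℝ, E) x₀).symm y))

/-- A symplectic form on a manifold `M` without boundary modelled on `E`: a smooth, closed,
nondegenerate 2-form. Smoothness and closedness are expressed in the charts of `M`. -/
structure SymplecticForm (E : Type*) [NormedAddCommGroup E] [NormedSpace ℝ E]
    (M : Type*) [TopologicalSpace M] [ChartedSpace E M] where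
  /-- The underlying field of alternating bilinear forms. -/
  form : ∀ x : M, TangentSpace 𝓘(ℝ, E) x [⋀^Fin 2]→L[ℝ] ℝ
  smooth : ∀ x₀ : M, ContDiffOn ℝ ∞ (formInChart form x₀) (extChartAt 𝓘(ℝ, E) x₀).target
  closed : ∀ x₀ : M, ∀ y ∈ (extChartAt 𝓘(ℝ, E) x₀).target, extDeriv (formInChart form x₀) y = 0
  nondegenerate : ∀ (x : M) (v : TangentSpace 𝓘(ℝ, E) x),
    (∀ w : TangentSpace 𝓘(ℝ, E) x, form x ![v, w] = 0) → v = 0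

/-- The nondegenerate form identifies tangent vectors with covectors. -/
theorem SymplecticForm.exists_unique_dual {E : Type*} [NormedAddCommGroup E] [NormedSpace ℝ E]
    [FiniteDimensional ℝ E] {M : Type*} [TopologicalSpace M] [ChartedSpace E M]
    (σ : SymplecticForm E M) (x : M) (α : TangentSpace 𝓘(ℝ, E) x →L[ℝ] ℝ) :
    ∃! v : TangentSpace 𝓘(ℝ, E) x,
      ∀ w : TangentSpace 𝓘(ℝ, E) x, σ.form x ![v, w] = α w := by
  let f : E [⋀^Fin 2]→L[ℝ] ℝ := σ.form x
  have hu : ∀ a z : E, Function.update ![a, (0 : E)] 1 z = ![a, z] := fun a z => by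
    ext i; fin_cases i <;> simp
  let B : E →ₗ[ℝ] E →ₗ[ℝ] ℝ := LinearMap.mk₂ ℝ (fun v w : E => f ![v, w])
    (fun a b c => f.toMultilinearMap.cons_add ![c] a b)
    (fun r a c => f.toMultilinearMap.cons_smul ![c] r a)
    (fun a b c => by
      have h := f.map_update_add ![a, (0 : E)] 1 b c
      rwa [hu, hu, hu] at h)
    (fun r a c => by
      have h := f.map_update_smul ![a, (0 : E)] 1 r c
      rwa [hu, hu] at h)
  have hinj : Function.Injective B := by
    rw [injective_iff_map_eq_zero]
    intro v hv
    exact σ.nondegenerate x v fun w => LinearMap.congr_fun hv w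
  have hsurj : Function.Surjective B :=
    (LinearMap.injective_iff_surjective_of_finrank_eq_finrank
      (Subspace.dual_finrank_eq (K := ℝ) (V := E)).symm).1 hinj
  obtain ⟨v, hv⟩ := hsurj (α : E →L[ℝ] ℝ).toLinearMap
  refine ⟨v, fun w => LinearMap.congr_fun hv w, fun v' hv' => hinj ?_⟩
  rw [hv]
  exact LinearMap.ext hv'

/-- The Hamiltonian vector field `X_F` of a function `F`: `σ(X_F, ·) = dF`. -/
noncomputable def SymplecticForm.hamiltonianVectorField {E : Type*} [NormedAddCommGroup E]
    [NormedSpace ℝ E] [FiniteDimensional ℝ E] {M : Type*} [TopologicalSpace M] [ChartedSpace E M]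
    (σ : SymplecticForm E M) (F : M → ℝ) (x : M) : TangentSpace 𝓘(ℝ, E) x :=
  (σ.exists_unique_dual x (mfderiv 𝓘(ℝ, E) 𝓘(ℝ, ℝ) F x)).choose

/-- The Poisson bracket `{F, G} = dG(X_F)`. -/
noncomputable def SymplecticForm.poissonBracket {E : Type*} [NormedAddCommGroup E]
    [NormedSpace ℝ E] [FiniteDimensional ℝ E] {M : Type*} [TopologicalSpace M] [ChartedSpace E M]
    (σ : SymplecticForm E M) (F G : M → ℝ) (x : M) : ℝ :=
  mfderiv 𝓘(ℝ, E) 𝓘(ℝ, ℝ) G x (σ.hamiltonianVectorField F x)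

/-- The supremum norm `‖{F, G}‖`, with values in `[0, ∞]`. -/
noncomputable def SymplecticForm.bracketNorm {E : Type*} [NormedAddCommGroup E]
    [NormedSpace ℝ E] [FiniteDimensional ℝ E] {M : Type*} [TopologicalSpace M] [ChartedSpace E M]
    (σ : SymplecticForm E M) (F G : M → ℝ) : ℝ≥0∞ :=
  ⨆ x : M, ENNReal.ofReal |σ.poissonBracket F G x|

end Symplectic

/-! ## Convex planar domains with marked boundary points -/

section MarkedDomains

/-- `∂Δ` is smooth: it is a smooth regular simple closed curve. -/
def HasSmoothBoundary (Δ : Set (ℝ × ℝ)) : Prop :=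
  ∃ c : ℝ → ℝ × ℝ, ContDiff ℝ ∞ c ∧ Function.Periodic c 1 ∧ Set.InjOn c (Set.Ico 0 1) ∧
    (∀ t, deriv c t ≠ 0) ∧ Set.range c = frontier Δ

/-- A convex polygon: the convex hull of finitely many points. -/
def IsConvexPolygon (Δ : Set (ℝ × ℝ)) : Prop :=
  ∃ S : Finset (ℝ × ℝ), Δ = convexHull ℝ (S : Set (ℝ × ℝ))

/-- `q` lies on the open ray that leaves `c` at the angle `t` (counterclockwise from the first
coordinate axis). -/
def OnRay (c : ℝ × ℝ) (t : ℝ) (q : ℝ × ℝ) : Prop :=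
  ∃ r : ℝ, 0 < r ∧ q = (c.1 + r * Real.cos t, c.2 + r * Real.sin t)

/-- A compact convex planar domain of area one, with smooth or polygonal boundary, and `N` (distinct)
points of its boundary in counterclockwise cyclic order. The order is witnessed by the angles at
which the points are seen from a point `center` of the interior; the last angle belongs to the
first point again, after one full turn. Every such configuration of points has such witnesses,
for every choice of the interior point. -/
structure MarkedDomain (N : ℕ) where
  /-- The domain `Δ`. -/
  carrier : Set (ℝ × ℝ)
  isCompact : IsCompact carrier
  convex : Convex ℝ carrier
  area : MeasureTheory.volume carrier = 1
  boundary : HasSmoothBoundary carrier ∨ IsConvexPolygon carrier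
  /-- The marked points. -/
  point : Fin N → ℝ × ℝ
  point_mem : ∀ i, point i ∈ frontier carrier
  /-- An interior point from which the boundary is seen. -/
  center : ℝ × ℝ
  center_mem : center ∈ interior carrier
  /-- The angles of the marked points as seen from `center`. -/
  angle : Fin (N + 1) → ℝ
  angle_strictMono : StrictMono angle
  angle_last : angle (Fin.last N) = angle 0 + 2 * Real.pi
  point_onRay : ∀ i : Fin N, OnRay center (angle i.castSucc) (point i)

/-- The closed arc `γ_i` of the boundary that goes counterclockwise from the `i`-th marked point to
the next one (cyclically). It does not depend on the interior point `center`. -/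
def MarkedDomain.arc {N : ℕ} (D : MarkedDomain N) (i : Fin N) : Set (ℝ × ℝ) :=
  {q ∈ frontier D.carrier |
    ∃ t ∈ Set.Icc (D.angle i.castSucc) (D.angle i.succ), OnRay D.center t q}

end MarkedDomains

/-! ## The Poisson bracket invariants -/

section Invariants

/-- `X_1, …, X_N` intersect cyclically: two of the sets whose indices are neither equal nor
neighbours modulo `N` are disjoint. -/
def IntersectCyclically {M : Type*} {N : ℕ} (X : Fin N → Set M) : Prop :=
  ∀ i j : Fin N, i ≠ j → (i.val + 1) % N ≠ j.val → (j.val + 1) % N ≠ i.val →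
    Disjoint (X i) (X j)

/-- The maps over which the infimum in the definition of `Pb` is taken: smooth maps `Φ : M → Δ`
such that `Φ - p` has compactly supported components for some `p ∈ Δ`, and such that `Φ` maps a
neighbourhood of each `X_i` into the arc `γ_i`. -/
structure IsAdmissible {E : Type*} [NormedAddCommGroup E] [NormedSpace ℝ E]
    {M : Type*} [TopologicalSpace M] [ChartedSpace E M]
    {N : ℕ} (D : MarkedDomain N) (X : Fin N → Set M) (Φ : M → ℝ × ℝ) : Prop where
  smooth : ContMDiff 𝓘(ℝ, E) 𝓘(ℝ, ℝ × ℝ) ∞ Φ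
  mem_carrier : ∀ x, Φ x ∈ D.carrier
  compactSupport : ∃ p ∈ D.carrier,
    HasCompactSupport (fun x => (Φ x).1 - p.1) ∧ HasCompactSupport (fun x => (Φ x).2 - p.2)
  mapsTo_arc : ∀ i, ∃ U : Set M, IsOpen U ∧ X i ⊆ U ∧ Set.MapsTo Φ U (D.arc i)

/-- The invariant `Pb_N(X_1, …, X_N)`, computed with the marked domain `D`: the infimum of
`‖{Φ₁, Φ₂}‖` over the admissible maps, with values in `[0, ∞]`. -/
noncomputable def Pb {E : Type*} [NormedAddCommGroup E] [NormedSpace ℝ E] [FiniteDimensional ℝ E]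
    {M : Type*} [TopologicalSpace M] [ChartedSpace E M]
    (σ : SymplecticForm E M) {N : ℕ} (D : MarkedDomain N) (X : Fin N → Set M) : ℝ≥0∞ :=
  ⨅ (Φ : M → ℝ × ℝ) (_ : IsAdmissible (E := E) D X Φ),
    σ.bracketNorm (fun x => (Φ x).1) (fun x => (Φ x).2)

/-- The `(N+1)`-tuple `(cl(X_1 ∖ K), X_2, …, X_{N-1}, cl(X_N ∖ K), K)`. -/
def cutTuple {M : Type*} [TopologicalSpace M] {N : ℕ} (X : Fin N → Set M) (K : Set M) :
    Fin (N + 1) → Set M :=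
  Fin.snoc (α := fun _ => Set M)
    (fun i : Fin N => if i.val = 0 ∨ i.val + 1 = N then closure (X i \ K) else X i) K

end Invariants

/-! Both inequalities come from composing admissible maps with planar maps. The bracket of the
components of `T ∘ Φ` is the Jacobian of `T` times the bracket of `Φ` (`poissonBracket_comp`), so a
smooth `T` whose Jacobian is bounded by `1 + ε` costs only that factor, and `ε` is arbitrary.

The carrying fact is `exists_transfer`: since both domains have area one, the plane can be mapped
smoothly into the second domain with Jacobian at most `1 + ε` in absolute value, inducing a
prescribed degree one map between the boundaries. The interior is handled in polar coordinates by
matching angular area densities. The boundary map is then corrected in a thin collar that is sent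
entirely into the boundary curve, where the Jacobian vanishes. Corners of polygons are harmless
because the boundary is parametrized by a smooth map that pauses at each of them
(`exists_smooth_radius`).

Lower bound, for every `K` (`Pb_le_Pb_cutTuple`): let the boundary map collapse the last arc of `D'`
to the marked point where the first and last arcs of `D` meet. Neighbourhoods of the cut sets and of
`K` together cover the original sets, so the composition is admissible for `X`.

Upper bound (`Pb_cutTuple_le`): if `Φ` is admissible for `X`, it is constant on the intersection of
the chosen neighbourhoods of the first and last sets, because their arcs share a single point; this
intersection eventually contains `K n`. Stretch the last arc of `D` over the last two arcs of `D'`,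
then use a cutoff to slide values along the boundary, so that the remainder of the last set returns
to its own arc while `K n` stays in the new one. The sliding takes place where the map takes values
in a curve, so its bracket is zero there before and after.

Finiteness (`Pb_ne_top`) needs one admissible map that is constant outside a compact set. A
partition of unity indexed by the marked points provides it; cyclic intersection and the condition
on triples when `N = 3` ensure that the pieces fit together. -/

/-! ### Smooth degree one maps of the circle with prescribed values -/

section Staircase

/-- A finite sum of smooth steps, which rises from `b i` to `b (i + 1)` between `a i` and
`a (i + 1)`. -/
noncomputable def staircase {n : ℕ} (a b : Fin (n + 1) → ℝ) (x : ℝ) : ℝ :=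
  b 0 + ∑ i : Fin n, (b i.succ - b i.castSucc) *
    Real.smoothTransition (2 * ((x - a i.castSucc) / (a i.succ - a i.castSucc)) - 1 / 2)

theorem sum_ite_lt_sub {n : ℕ} (b : Fin (n + 1) → ℝ) (j : Fin (n + 1)) :
    ∑ i : Fin n, (b i.succ - b i.castSucc) * (if i.val < j.val then 1 else 0) = b j - b 0 := by
  induction j using Fin.induction with
  | zero => simp
  | succ j ih =>
    have h : ∀ i : Fin n, (b i.succ - b i.castSucc) * (if i.val < j.succ.val then (1 : ℝ) else 0) =
        (b i.succ - b i.castSucc) * (if i.val < j.castSucc.val then 1 else 0) +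
        (if i = j then b i.succ - b i.castSucc else 0) := by
      intro i
      rcases lt_trichotomy i.val j.val with h | h | h
      · have h1 : i ≠ j := fun h' => by simp [h'] at h
        have h2 : i.val < j.val + 1 := by omega
        simp [h, h1, h2]
      · have h1 : i = j := Fin.ext h
        simp [h1]
      · have h1 : i ≠ j := fun h' => by simp [h'] at h
        have h2 : ¬ i.val < j.val + 1 := by omega
        have h3 : ¬ i.val < j.val := by omega
        simp [h1, h2, h3]
    rw [Finset.sum_congr rfl fun i _ => h i, Finset.sum_add_distrib, ih]
    simp

theorem staircase_eq {n : ℕ} {a : Fin (n + 1) → ℝ} (ha : StrictMono a) (b : Fin (n + 1) → ℝ)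
    (j : Fin (n + 1)) {x : ℝ}
    (h1 : ∀ i : Fin n, i.val < j.val →
      a i.castSucc + 3 / 4 * (a i.succ - a i.castSucc) ≤ x)
    (h2 : ∀ i : Fin n, j.val ≤ i.val →
      x ≤ a i.castSucc + 1 / 4 * (a i.succ - a i.castSucc)) :
    staircase a b x = b j := by
  have h : ∀ i : Fin n,
      Real.smoothTransition (2 * ((x - a i.castSucc) / (a i.succ - a i.castSucc)) - 1 / 2) =
      if i.val < j.val then 1 else 0 := by
    intro i
    have hpos : 0 < a i.succ - a i.castSucc := sub_pos.2 (ha i.castSucc_lt_succ)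
    split_ifs with hij
    · apply Real.smoothTransition.one_of_one_le
      have : 3 / 4 ≤ (x - a i.castSucc) / (a i.succ - a i.castSucc) := by
        rw [le_div_iff₀ hpos]; linarith [h1 i hij]
      linarith
    · apply Real.smoothTransition.zero_of_nonpos
      have : (x - a i.castSucc) / (a i.succ - a i.castSucc) ≤ 1 / 4 := by
        rw [div_le_iff₀ hpos]; linarith [h2 i (not_lt.1 hij)]
      linarith
  rw [staircase, Finset.sum_congr rfl fun i _ => by rw [h i], sum_ite_lt_sub]
  ring

theorem contDiff_staircase {n : ℕ} (a b : Fin (n + 1) → ℝ) : ContDiff ℝ ∞ (staircase a b) := by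
  unfold staircase
  refine contDiff_const.add (ContDiff.sum fun i _ => contDiff_const.mul ?_)
  exact (Real.smoothTransition.contDiff (n := ⊤)).comp (by fun_prop)

theorem monotone_staircase {n : ℕ} {a b : Fin (n + 1) → ℝ} (ha : StrictMono a) (hb : Monotone b) :
    Monotone (staircase a b) := by
  intro x y hxy
  unfold staircase
  gcongr with i
  · exact sub_nonneg.2 (hb i.castSucc_lt_succ.le)
  · apply Real.smoothTransition.monotone
    have hpos : 0 < a i.succ - a i.castSucc := sub_pos.2 (ha i.castSucc_lt_succ)
    gcongr

theorem eventually_staircase_eq {n : ℕ} {a : Fin (n + 1) → ℝ} (ha : StrictMono a)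
    (b : Fin (n + 1) → ℝ) (j : Fin (n + 1)) : ∀ᶠ x in 𝓝 (a j), staircase a b x = b j := by
  have h1 : ∀ i : Fin n, ∀ᶠ x in 𝓝 (a j), i.val < j.val →
      a i.castSucc + 3 / 4 * (a i.succ - a i.castSucc) ≤ x := by
    intro i
    by_cases hij : i.val < j.val
    · have h1 : a i.castSucc < a i.succ := ha i.castSucc_lt_succ
      have h2 : a i.succ ≤ a j := ha.monotone (Fin.le_def.2 (by simpa using hij))
      filter_upwards [lt_mem_nhds (show a i.castSucc + 3 / 4 * (a i.succ - a i.castSucc) < a j by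
        linarith)] with x hx _ using hx.le
    · exact Filter.Eventually.of_forall fun x h => absurd h hij
  have h2 : ∀ i : Fin n, ∀ᶠ x in 𝓝 (a j), j.val ≤ i.val →
      x ≤ a i.castSucc + 1 / 4 * (a i.succ - a i.castSucc) := by
    intro i
    by_cases hij : j.val ≤ i.val
    · have h1 : a i.castSucc < a i.succ := ha i.castSucc_lt_succ
      have h2 : a j ≤ a i.castSucc := ha.monotone (Fin.le_def.2 (by simpa using hij))
      filter_upwards [gt_mem_nhds (show a j < a i.castSucc + 1 / 4 * (a i.succ - a i.castSucc) by
        linarith)] with x hx _ using hx.le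
    · exact Filter.Eventually.of_forall fun x h => absurd h hij
  filter_upwards [Filter.eventually_all.2 h1, Filter.eventually_all.2 h2] with x hx1 hx2
  exact staircase_eq ha b j hx1 hx2

theorem staircase_of_le {n : ℕ} {a : Fin (n + 1) → ℝ} (ha : StrictMono a)
    (b : Fin (n + 1) → ℝ) {x : ℝ} (hx : x ≤ a 0) : staircase a b x = b 0 := by
  refine staircase_eq ha b 0 (fun i hi => absurd hi (by simp)) fun i _ => ?_
  have h1 : a i.castSucc < a i.succ := ha i.castSucc_lt_succ
  have h2 : a 0 ≤ a i.castSucc := ha.monotone (Fin.zero_le _)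
  linarith

theorem staircase_of_ge {n : ℕ} {a : Fin (n + 1) → ℝ} (ha : StrictMono a)
    (b : Fin (n + 1) → ℝ) {x : ℝ} (hx : a (Fin.last n) ≤ x) :
    staircase a b x = b (Fin.last n) := by
  refine staircase_eq ha b _ (fun i _ => ?_) fun i hi => absurd hi (by simp)
  have h1 : a i.castSucc < a i.succ := ha i.castSucc_lt_succ
  have h2 : a i.succ ≤ a (Fin.last n) := ha.monotone (Fin.le_last _)
  linarith

/-- The lift of a smooth degree one map of the circle `ℝ / 2πℤ`. -/
structure IsCircleLift (β : ℝ → ℝ) : Prop where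
  contDiff : ContDiff ℝ ∞ β
  add_two_pi : ∀ x, β (x + 2 * Real.pi) = β x + 2 * Real.pi

theorem IsCircleLift.add_int_mul {β : ℝ → ℝ} (hβ : IsCircleLift β) (x : ℝ) (k : ℤ) :
    β (x + k * (2 * Real.pi)) = β x + k * (2 * Real.pi) := by
  have h : Function.Periodic (fun x => β x - x) (2 * Real.pi) := fun x => by
    simp only [hβ.add_two_pi]; ring
  have := h.int_mul k x
  linarith

/-- The staircase is constant near its nodes and outside one period, so its translates glue
smoothly. Only weak monotonicity of `b` is asked, so that arcs may be collapsed; local constancy at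
the nodes is what later smooths the corners of polygons. -/
theorem exists_isCircleLift {n : ℕ} {a b : Fin (n + 1) → ℝ} (ha : StrictMono a) (hb : Monotone b)
    (haN : a (Fin.last n) = a 0 + 2 * Real.pi) (hbN : b (Fin.last n) = b 0 + 2 * Real.pi) :
    ∃ β : ℝ → ℝ, IsCircleLift β ∧ Monotone β ∧ ∀ i, ∀ᶠ x in 𝓝 (a i), β x = b i := by
  set p := 2 * Real.pi with hp
  have hp0 : 0 < p := Real.two_pi_pos
  set f := staircase a b with hf
  have hfs : ContDiff ℝ ∞ f := contDiff_staircase a b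
  have hfm : Monotone f := monotone_staircase ha hb
  let β : ℝ → ℝ := fun x => f (x - ⌊(x - a 0) / p⌋ * p) + ⌊(x - a 0) / p⌋ * p
  have hloc : ∀ (m : ℤ) (x : ℝ), a 0 + (m - 1) * p ≤ x → x < a 0 + (m + 1) * p →
      β x = f (x - (m - 1) * p) + f (x - m * p) + ((m - 1) * p - b 0) := by
    intro m x h1 h2
    by_cases h : x < a 0 + m * p
    · have hk : ⌊(x - a 0) / p⌋ = m - 1 := by
        rw [Int.floor_eq_iff, le_div_iff₀ hp0, div_lt_iff₀ hp0]
        push_cast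
        constructor <;> linarith
      simp only [β, hk]
      have : f (x - m * p) = b 0 := staircase_of_le ha b (by linarith)
      rw [this]; push_cast; ring
    · have hk : ⌊(x - a 0) / p⌋ = m := by
        rw [Int.floor_eq_iff, le_div_iff₀ hp0, div_lt_iff₀ hp0]
        constructor <;> linarith
      simp only [β, hk]
      have : f (x - (m - 1) * p) = b (Fin.last n) := staircase_of_ge ha b (by rw [haN]; linarith)
      rw [this, hbN]; ring
  have hnear : ∀ x : ℝ, ∃ m : ℤ, a 0 + (m - 1) * p < x ∧ x < a 0 + (m + 1) * p := by
    intro x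
    refine ⟨⌊(x - a 0) / p⌋, ?_, ?_⟩
    · have := (le_div_iff₀ hp0).1 (Int.floor_le ((x - a 0) / p))
      linarith
    · have := (div_lt_iff₀ hp0).1 (Int.lt_floor_add_one ((x - a 0) / p))
      linarith
  have hev : ∀ x : ℝ, ∃ m : ℤ,
      β =ᶠ[𝓝 x] fun x => f (x - (m - 1) * p) + f (x - m * p) + ((m - 1) * p - b 0) := by
    intro x
    obtain ⟨m, h1, h2⟩ := hnear x
    refine ⟨m, ?_⟩
    filter_upwards [lt_mem_nhds h1, gt_mem_nhds h2] with y hy1 hy2 using hloc m y hy1.le hy2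
  have hs : ∀ m : ℤ, ContDiff ℝ ∞
      (fun x => f (x - (m - 1) * p) + f (x - m * p) + ((m - 1) * p - b 0)) := fun m =>
    ((hfs.comp (contDiff_id.sub contDiff_const)).add
      (hfs.comp (contDiff_id.sub contDiff_const))).add contDiff_const
  have hβs : ContDiff ℝ ∞ β := by
    rw [contDiff_iff_contDiffAt]
    intro x
    obtain ⟨m, hm⟩ := hev x
    exact (hs m).contDiffAt.congr_of_eventuallyEq hm
  refine ⟨β, ⟨hβs, fun x => ?_⟩, ?_, fun i => ?_⟩
  · have hk : ⌊(x + p - a 0) / p⌋ = ⌊(x - a 0) / p⌋ + 1 := by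
      rw [← Int.floor_add_one]; congr 1; field_simp; ring
    simp only [β, ← hp, hk]
    push_cast
    have : x + p - (⌊(x - a 0) / p⌋ + 1) * p = x - ⌊(x - a 0) / p⌋ * p := by ring
    rw [this]; ring
  · refine monotone_of_deriv_nonneg (hβs.differentiable (by simp)) fun x => ?_
    obtain ⟨m, hm⟩ := hev x
    rw [hm.deriv_eq]
    apply Monotone.deriv_nonneg
    intro u v huv
    have h1 := hfm (show u - (m - 1) * p ≤ v - (m - 1) * p by linarith)
    have h2 := hfm (show u - m * p ≤ v - m * p by linarith)
    simp only
    linarith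
  · have h0 : a 0 ≤ a i := ha.monotone (Fin.zero_le _)
    have hN : a i ≤ a (Fin.last n) := ha.monotone (Fin.le_last _)
    rcases eq_or_lt_of_le h0 with h | h
    · have h0i : i = 0 := (ha.injective h).symm
      subst h0i
      have hE := eventually_staircase_eq ha b 0
      filter_upwards [hE, lt_mem_nhds (show a 0 - p < a 0 by linarith),
        gt_mem_nhds (show a 0 < a 0 + p by linarith),
        ((continuous_add_const p).tendsto (a 0)).eventually
          (by rw [← haN]; exact eventually_staircase_eq ha b (Fin.last n))] with x hx h1 h2 h3
      have := hloc 0 x (by push_cast; linarith) (by push_cast; linarith)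
      rw [this]
      push_cast
      have e1 : x - (0 - 1) * p = x + p := by ring
      have e2 : x - 0 * p = x := by ring
      rw [e1, e2, hf, hx, h3, hbN]; ring
    · have hE := eventually_staircase_eq ha b i
      by_cases hi : i = Fin.last n
      · filter_upwards [lt_mem_nhds h, gt_mem_nhds (show a i < a i + p by linarith), hE,
          ((continuous_sub_right p).tendsto (a i)).eventually
          (by rw [hi, haN, add_sub_cancel_right]; exact eventually_staircase_eq ha b 0)]
          with x h1 h2 hx h3
        have := hloc 1 x (by push_cast; linarith)
          (by push_cast; rw [hi, haN] at h2; linarith)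
        rw [this]
        push_cast
        have e1 : x - (1 - 1) * p = x := by ring
        have e2 : x - 1 * p = x - p := by ring
        rw [e1, e2, hf, hx, h3]; ring
      · have hlt : a i < a 0 + p := by
          rw [← haN]; exact ha (lt_of_le_of_ne (Fin.le_last _) hi)
        filter_upwards [lt_mem_nhds h, gt_mem_nhds hlt, hE] with x h1 h2 hx
        have := hloc 1 x (by push_cast; linarith) (by push_cast; linarith)
        rw [this]
        push_cast
        have e1 : x - (1 - 1) * p = x := by ring
        rw [e1, hf, hx, staircase_of_le ha b (x := x - 1 * p) (by linarith)]
        ring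

end Staircase

/-! ### Polar coordinates in the plane -/

section Polar

/-- The unit vector at the angle `t`. -/
noncomputable def unitVec (t : ℝ) : ℝ × ℝ := (Real.cos t, Real.sin t)

/-- The signed area of the parallelogram spanned by two planar vectors. -/
def cross (u v : ℝ × ℝ) : ℝ := u.1 * v.2 - u.2 * v.1

theorem contDiff_unitVec {n : WithTop ℕ∞} : ContDiff ℝ n unitVec :=
  Real.contDiff_cos.prodMk Real.contDiff_sin

theorem unitVec_add_two_pi (t : ℝ) : unitVec (t + 2 * Real.pi) = unitVec t := by
  simp [unitVec]

theorem unitVec_ne_zero (t : ℝ) : unitVec t ≠ 0 := by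
  intro h
  have h1 : Real.cos t = 0 := congrArg Prod.fst h
  have h2 : Real.sin t = 0 := congrArg Prod.snd h
  have := Real.cos_sq_add_sin_sq t
  simp [h1, h2] at this

theorem hasDerivAt_unitVec (t : ℝ) : HasDerivAt unitVec (-Real.sin t, Real.cos t) t :=
  (Real.hasDerivAt_cos t).prodMk (Real.hasDerivAt_sin t)

theorem cross_unitVec_deriv (t : ℝ) : cross (unitVec t) (-Real.sin t, Real.cos t) = 1 := by
  simp only [cross, unitVec]
  nlinarith [Real.cos_sq_add_sin_sq t]

theorem onRay_iff {c q : ℝ × ℝ} {t : ℝ} : OnRay c t q ↔ ∃ r : ℝ, 0 < r ∧ q = c + r • unitVec t :=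
  Iff.rfl

/-- The polar radius of a planar vector. -/
noncomputable def polarRadius (z : ℝ × ℝ) : ℝ := Real.sqrt (z.1 ^ 2 + z.2 ^ 2)

/-- The polar angle of a planar vector, in the interval of length `2π` centred at `m`. -/
noncomputable def polarAngle (m : ℝ) (z : ℝ × ℝ) : ℝ :=
  m + Complex.arg ⟨z.1 * Real.cos m + z.2 * Real.sin m, z.2 * Real.cos m - z.1 * Real.sin m⟩

theorem polarRadius_smul_unitVec {r : ℝ} (hr : 0 ≤ r) (t : ℝ) :
    polarRadius (r • unitVec t) = r := by
  have : (r * Real.cos t) ^ 2 + (r * Real.sin t) ^ 2 = r ^ 2 := by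
    nlinarith [Real.cos_sq_add_sin_sq t]
  simp only [polarRadius, unitVec, Prod.smul_mk, smul_eq_mul, this, Real.sqrt_sq hr]

theorem rotate_smul_unitVec (m r t : ℝ) :
    (⟨(r • unitVec t).1 * Real.cos m + (r • unitVec t).2 * Real.sin m,
      (r • unitVec t).2 * Real.cos m - (r • unitVec t).1 * Real.sin m⟩ : ℂ) =
      r * (Complex.cos ((t - m : ℝ) : ℂ) + Complex.sin ((t - m : ℝ) : ℂ) * Complex.I) := by
  have h1 := Real.cos_sub t m
  have h2 := Real.sin_sub t m
  rw [← Complex.ofReal_cos, ← Complex.ofReal_sin, h1, h2]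
  apply Complex.ext <;>
    simp only [unitVec, Prod.smul_mk, smul_eq_mul, Complex.mul_re, Complex.mul_im, Complex.add_re,
      Complex.add_im, Complex.ofReal_re, Complex.ofReal_im, Complex.I_re, Complex.I_im] <;> ring

theorem polarAngle_smul_unitVec {m r t : ℝ} (hr : 0 < r) (ht : |t - m| < Real.pi) :
    polarAngle m (r • unitVec t) = t := by
  rw [polarAngle, rotate_smul_unitVec, Complex.arg_mul_cos_add_sin_mul_I hr]
  · ring
  · exact ⟨(abs_lt.1 ht).1, (abs_lt.1 ht).2.le⟩

theorem polar_decomp (m : ℝ) (z : ℝ × ℝ) : polarRadius z • unitVec (polarAngle m z) = z := by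
  set w : ℂ := ⟨z.1 * Real.cos m + z.2 * Real.sin m, z.2 * Real.cos m - z.1 * Real.sin m⟩ with hw
  have hn : ‖w‖ = polarRadius z := by
    rw [Complex.norm_eq_sqrt_sq_add_sq, polarRadius]
    congr 1
    simp only [hw]
    nlinarith [Real.cos_sq_add_sin_sq m]
  have h := Complex.norm_mul_cos_add_sin_mul_I w
  have h1 := congrArg Complex.re h
  have h2 := congrArg Complex.im h
  rw [← Complex.ofReal_cos, ← Complex.ofReal_sin] at h1 h2
  simp only [hn, Complex.mul_re, Complex.mul_im, Complex.add_re,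
      Complex.add_im, Complex.ofReal_re, Complex.ofReal_im, Complex.I_re, Complex.I_im, mul_zero,
      zero_mul, mul_one, sub_zero, add_zero, zero_add] at h1 h2
  have e : polarAngle m z = m + Complex.arg w := rfl
  ext
  · simp only [e, unitVec, Prod.smul_mk, smul_eq_mul, Real.cos_add]
    have : polarRadius z * (Real.cos m * Real.cos w.arg - Real.sin m * Real.sin w.arg) =
      Real.cos m * (polarRadius z * Real.cos w.arg) - Real.sin m * (polarRadius z * Real.sin w.arg)
      := by ring
    rw [this, h1, h2]
    simp only [hw]
    linear_combination z.1 * Real.cos_sq_add_sin_sq m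
  · simp only [e, unitVec, Prod.smul_mk, smul_eq_mul, Real.sin_add]
    have : polarRadius z * (Real.sin m * Real.cos w.arg + Real.cos m * Real.sin w.arg) =
      Real.sin m * (polarRadius z * Real.cos w.arg) + Real.cos m * (polarRadius z * Real.sin w.arg)
      := by ring
    rw [this, h1, h2]
    simp only [hw]
    linear_combination z.2 * Real.cos_sq_add_sin_sq m

theorem polarRadius_pos {z : ℝ × ℝ} (hz : z ≠ 0) : 0 < polarRadius z := by
  refine lt_of_le_of_ne (Real.sqrt_nonneg _) fun h => hz ?_
  rw [← polar_decomp 0 z, ← h, zero_smul]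

theorem continuous_polarRadius : Continuous polarRadius := by
  unfold polarRadius; fun_prop

theorem contDiffAt_polarRadius {z : ℝ × ℝ} (hz : z ≠ 0) : ContDiffAt ℝ ∞ polarRadius z := by
  have h := polarRadius_pos hz
  unfold polarRadius at h ⊢
  exact (by fun_prop : ContDiffAt ℝ ∞ (fun z : ℝ × ℝ => z.1 ^ 2 + z.2 ^ 2) z).sqrt
    (Real.sqrt_pos.1 h).ne'

/-- The rotation by `-m` puts the branch cut of `Complex.arg` at the direction opposite to `m`,
which the point avoids; the angle is then the imaginary part of the logarithm. -/
theorem contDiffAt_polarAngle {m r t : ℝ} (hr : 0 < r) (ht : |t - m| < Real.pi) :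
    ContDiffAt ℝ ∞ (polarAngle m) (r • unitVec t) := by
  have hslit : (⟨(r • unitVec t).1 * Real.cos m + (r • unitVec t).2 * Real.sin m,
      (r • unitVec t).2 * Real.cos m - (r • unitVec t).1 * Real.sin m⟩ : ℂ) ∈ Complex.slitPlane := by
    rw [Complex.mem_slitPlane_iff_arg, rotate_smul_unitVec, Complex.arg_mul_cos_add_sin_mul_I hr
      ⟨(abs_lt.1 ht).1, (abs_lt.1 ht).2.le⟩]
    refine ⟨(abs_lt.1 ht).2.ne, ?_⟩
    intro h
    have := congrArg norm h
    rw [norm_mul, Complex.norm_cos_add_sin_mul_I] at this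
    simp [hr.ne'] at this
  have h1 : ContDiffAt ℝ ∞ (fun w : ℂ => (Complex.log w).im)
      (⟨(r • unitVec t).1 * Real.cos m + (r • unitVec t).2 * Real.sin m,
      (r • unitVec t).2 * Real.cos m - (r • unitVec t).1 * Real.sin m⟩ : ℂ) :=
    Complex.imCLM.contDiff.contDiffAt.comp _ ((Complex.contDiffAt_log hslit).restrict_scalars ℝ)
  have h2 : ContDiffAt ℝ ∞ (fun z : ℝ × ℝ => Complex.equivRealProdCLM.symm
      (z.1 * Real.cos m + z.2 * Real.sin m, z.2 * Real.cos m - z.1 * Real.sin m))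
      (r • unitVec t) :=
    Complex.equivRealProdCLM.symm.contDiff.contDiffAt.comp _ (by fun_prop)
  have e : polarAngle m = fun z => m + (Complex.log (Complex.equivRealProdCLM.symm
      (z.1 * Real.cos m + z.2 * Real.sin m, z.2 * Real.cos m - z.1 * Real.sin m))).im := by
    funext z
    rw [Complex.log_im]; rfl
  rw [e]
  exact contDiffAt_const.add (ContDiffAt.comp (g := fun w : ℂ => (Complex.log w).im) (r • unitVec t) h1 h2)

theorem exists_int_of_unitVec_eq {s t : ℝ} (h : unitVec s = unitVec t) :
    ∃ k : ℤ, s = t + k * (2 * Real.pi) := by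
  have h1 : Real.cos s = Real.cos t := congrArg Prod.fst h
  have h2 : Real.sin s = Real.sin t := congrArg Prod.snd h
  have h3 := Real.Angle.cos_sin_inj h1 h2
  obtain ⟨k, hk⟩ := Real.Angle.angle_eq_iff_two_pi_dvd_sub.1 h3
  exact ⟨k, by linarith⟩

theorem smul_unitVec_inj {r r' s t : ℝ} (hr : 0 < r) (hr' : 0 < r')
    (h : r • unitVec s = r' • unitVec t) : r = r' ∧ ∃ k : ℤ, s = t + k * (2 * Real.pi) := by
  have h1 : r = r' := by
    rw [← polarRadius_smul_unitVec hr.le s, h, polarRadius_smul_unitVec hr'.le]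
  subst h1
  exact ⟨rfl, exists_int_of_unitVec_eq (smul_right_injective _ hr.ne' h)⟩

/-- A function of polar coordinates, seen as a function on the plane. -/
noncomputable def ofPolar {F : Type*} (S : ℝ → ℝ → F) (z : ℝ × ℝ) : F :=
  S (polarRadius z) (polarAngle 0 z)

theorem ofPolar_smul_unitVec {F : Type*} {S : ℝ → ℝ → F}
    (hS : ∀ r, Function.Periodic (S r) (2 * Real.pi)) {r : ℝ} (hr : 0 < r) (t : ℝ) :
    ofPolar S (r • unitVec t) = S r t := by
  have hz : r • unitVec t ≠ 0 := smul_ne_zero hr.ne' (unitVec_ne_zero t)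
  obtain ⟨h1, k, hk⟩ := smul_unitVec_inj (polarRadius_pos hz) hr (polar_decomp 0 (r • unitVec t))
  rw [ofPolar, h1, hk]
  exact (hS r).int_mul k t

/-- The angle branch centred at `0` may jump at this point, but by periodicity it can be replaced by
the branch centred at `t`, which is smooth there. -/
theorem contDiffAt_ofPolar {F : Type*} [NormedAddCommGroup F] [NormedSpace ℝ F] {S : ℝ → ℝ → F}
    (hS : ∀ r, Function.Periodic (S r) (2 * Real.pi)) {r t : ℝ} (hr : 0 < r)
    (hsm : ContDiffAt ℝ ∞ (fun p : ℝ × ℝ => S p.1 p.2) (r, t)) :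
    ContDiffAt ℝ ∞ (ofPolar S) (r • unitVec t) := by
  have hz : r • unitVec t ≠ 0 := smul_ne_zero hr.ne' (unitVec_ne_zero t)
  have ht : |t - t| < Real.pi := by simpa using Real.pi_pos
  have h1 : ContDiffAt ℝ ∞ (fun z : ℝ × ℝ => (polarRadius z, polarAngle t z)) (r • unitVec t) :=
    (contDiffAt_polarRadius hz).prodMk (contDiffAt_polarAngle hr ht)
  have h2 : ofPolar S =ᶠ[𝓝 (r • unitVec t)]
      fun z => S (polarRadius z) (polarAngle t z) := by
    filter_upwards [isOpen_ne.mem_nhds hz] with z hz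
    conv_lhs => rw [← polar_decomp t z]
    rw [ofPolar_smul_unitVec hS (polarRadius_pos hz)]
  refine ContDiffAt.congr_of_eventuallyEq ?_ h2
  have h3 : (polarRadius (r • unitVec t), polarAngle t (r • unitVec t)) = (r, t) := by
    rw [polarRadius_smul_unitVec hr.le, polarAngle_smul_unitVec hr ht]
  rw [← h3] at hsm
  exact hsm.comp (r • unitVec t) h1

end Polar

/-! ### The planar cross product -/

section Cross

theorem cross_map (L : ℝ × ℝ →L[ℝ] ℝ × ℝ) (u v : ℝ × ℝ) :
    cross (L u) (L v) = cross (L (1, 0)) (L (0, 1)) * cross u v := by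
  have h : ∀ u : ℝ × ℝ, L u = u.1 • L (1, 0) + u.2 • L (0, 1) := fun u => by
    rw [← map_smul, ← map_smul, ← map_add]; simp
  rw [h u, h v]
  simp only [cross, Prod.fst_add, Prod.snd_add, Prod.smul_fst, Prod.smul_snd, smul_eq_mul]
  ring

theorem cross_smul_smul (a b : ℝ) (u : ℝ × ℝ) : cross (a • u) (b • u) = 0 := by
  simp [cross]; ring

end Cross

/-! ### The radius function of a convex domain -/

namespace MarkedDomain

variable {N : ℕ} (D : MarkedDomain N)

/-- The domain, translated so that its center becomes the origin. -/
def body : Set (ℝ × ℝ) := (fun v => D.center + v) ⁻¹' D.carrier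

/-- The distance from the center to the boundary in the direction of the angle `t`. -/
noncomputable def radius (t : ℝ) : ℝ := (gauge D.body (unitVec t))⁻¹

theorem convex_body : Convex ℝ D.body := D.convex.translate_preimage_right D.center

theorem isCompact_body : IsCompact D.body :=
  (Homeomorph.addLeft D.center).isCompact_preimage.2 D.isCompact

theorem body_mem_nhds : D.body ∈ 𝓝 (0 : ℝ × ℝ) := by
  have h : D.carrier ∈ 𝓝 (D.center + 0) := by
    rw [add_zero]; exact mem_interior_iff_mem_nhds.1 D.center_mem
  exact (continuous_const_add D.center).continuousAt.preimage_mem_nhds h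

theorem gauge_body_pos {v : ℝ × ℝ} (hv : v ≠ 0) : 0 < gauge D.body v :=
  (gauge_pos (absorbent_nhds_zero D.body_mem_nhds)
    (NormedSpace.isVonNBounded_of_isBounded ℝ D.isCompact_body.isBounded)).2 hv

theorem continuous_gauge_body : Continuous (gauge D.body) :=
  continuous_gauge D.convex_body D.body_mem_nhds

theorem add_mem_carrier_iff {v : ℝ × ℝ} : D.center + v ∈ D.carrier ↔ gauge D.body v ≤ 1 := by
  rw [gauge_le_one_iff_mem_closure D.convex_body D.body_mem_nhds,
    D.isCompact_body.isClosed.closure_eq]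
  rfl

theorem add_mem_frontier_iff {v : ℝ × ℝ} :
    D.center + v ∈ frontier D.carrier ↔ gauge D.body v = 1 := by
  rw [gauge_eq_one_iff_mem_frontier D.convex_body D.body_mem_nhds]
  have := (Homeomorph.addLeft D.center).preimage_frontier D.carrier
  change _ ↔ v ∈ frontier ((Homeomorph.addLeft D.center) ⁻¹' D.carrier)
  rw [← this]
  rfl

theorem radius_pos (t : ℝ) : 0 < D.radius t := inv_pos.2 (D.gauge_body_pos (unitVec_ne_zero t))

theorem radius_periodic : Function.Periodic D.radius (2 * Real.pi) := fun t => by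
  simp only [radius, unitVec_add_two_pi]

theorem continuous_radius : Continuous D.radius :=
  (D.continuous_gauge_body.comp (contDiff_unitVec (n := 0)).continuous).inv₀
    fun t => (D.gauge_body_pos (unitVec_ne_zero t)).ne'

theorem gauge_body_smul_unitVec {r : ℝ} (hr : 0 ≤ r) (t : ℝ) :
    gauge D.body (r • unitVec t) = r / D.radius t := by
  rw [gauge_smul_of_nonneg hr, radius, div_inv_eq_mul, smul_eq_mul]

theorem smul_mem_carrier_iff {r : ℝ} (hr : 0 ≤ r) (t : ℝ) :
    D.center + r • unitVec t ∈ D.carrier ↔ r ≤ D.radius t := by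
  rw [add_mem_carrier_iff, gauge_body_smul_unitVec D hr, div_le_one (D.radius_pos t)]

theorem smul_mem_frontier_iff {r : ℝ} (hr : 0 ≤ r) (t : ℝ) :
    D.center + r • unitVec t ∈ frontier D.carrier ↔ r = D.radius t := by
  rw [add_mem_frontier_iff, gauge_body_smul_unitVec D hr, div_eq_one_iff_eq (D.radius_pos t).ne']

theorem eq_of_onRay_of_mem_frontier {t : ℝ} {q : ℝ × ℝ} (hq : q ∈ frontier D.carrier)
    (h : OnRay D.center t q) : q = D.center + D.radius t • unitVec t := by
  obtain ⟨r, hr, rfl⟩ := onRay_iff.1 h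
  rw [(D.smul_mem_frontier_iff hr.le t).1 hq]

theorem onRay_radius (t : ℝ) : OnRay D.center t (D.center + D.radius t • unitVec t) :=
  onRay_iff.2 ⟨_, D.radius_pos t, rfl⟩

theorem radius_smul_mem_frontier (t : ℝ) :
    D.center + D.radius t • unitVec t ∈ frontier D.carrier :=
  (D.smul_mem_frontier_iff (D.radius_pos t).le t).2 rfl

theorem volume_body : MeasureTheory.volume D.body = 1 := by
  rw [← D.area]
  exact MeasureTheory.measure_preimage_add _ _ _

/-- In polar coordinates the area is half of this integral. This is the only form in which the area
normalization enters. -/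
theorem integral_radius_sq : ∫ t in (0 : ℝ)..(2 * Real.pi), D.radius t ^ 2 = 2 := by
  have hmeas : MeasurableSet D.body := D.isCompact_body.isClosed.measurableSet
  have h1 : ∫⁻ p in polarCoord.target,
      ENNReal.ofReal p.1 • D.body.indicator (1 : ℝ × ℝ → ℝ≥0∞) (polarCoord.symm p) = 1 := by
    rw [lintegral_comp_polarCoord_symm, MeasureTheory.lintegral_indicator_one hmeas, volume_body]
  have hm : Measurable (fun p : ℝ × ℝ =>
      ENNReal.ofReal p.1 • D.body.indicator (1 : ℝ × ℝ → ℝ≥0∞) (polarCoord.symm p)) := by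
    refine (ENNReal.measurable_ofReal.comp measurable_fst).mul ?_
    exact (measurable_one.indicator hmeas).comp continuous_polarCoord_symm.measurable
  have h2 : ∀ t : ℝ, ∫⁻ r in Set.Ioi (0 : ℝ),
      ENNReal.ofReal r • D.body.indicator (1 : ℝ × ℝ → ℝ≥0∞) (polarCoord.symm (r, t)) =
      ENNReal.ofReal (D.radius t ^ 2 / 2) := by
    intro t
    have e : ∀ r ∈ Set.Ioi (0 : ℝ),
        ENNReal.ofReal r • D.body.indicator (1 : ℝ × ℝ → ℝ≥0∞) (polarCoord.symm (r, t)) =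
        (Set.Iic (D.radius t)).indicator (fun r => ENNReal.ofReal r) r := by
      intro r hr
      have hr : 0 < r := hr
      have hiff : polarCoord.symm (r, t) ∈ D.body ↔ r ∈ Set.Iic (D.radius t) := by
        rw [Set.mem_Iic, ← D.smul_mem_carrier_iff hr.le t]; rfl
      by_cases h : r ∈ Set.Iic (D.radius t)
      · rw [Set.indicator_of_mem h, Set.indicator_of_mem (hiff.2 h)]; simp
      · rw [Set.indicator_of_notMem h, Set.indicator_of_notMem (mt hiff.1 h)]; simp
    rw [MeasureTheory.setLIntegral_congr_fun measurableSet_Ioi e,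
      MeasureTheory.setLIntegral_indicator measurableSet_Iic, Set.inter_comm, Set.Ioi_inter_Iic,
      ← MeasureTheory.ofReal_integral_eq_lintegral_ofReal]
    · rw [← intervalIntegral.integral_of_le (D.radius_pos t).le, integral_id]; simp
    · exact (continuous_id.integrableOn_Ioc)
    · exact (MeasureTheory.ae_restrict_iff' measurableSet_Ioc).2
        (Filter.Eventually.of_forall fun r hr => hr.1.le)
  have h3 : ∫⁻ t in Set.Ioo (-Real.pi) Real.pi, ENNReal.ofReal (D.radius t ^ 2 / 2) = 1 := by
    rw [← h1, polarCoord_target, MeasureTheory.Measure.volume_eq_prod,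
      ← MeasureTheory.Measure.prod_restrict, MeasureTheory.lintegral_prod_symm _ hm.aemeasurable]
    exact MeasureTheory.lintegral_congr fun t => (h2 t).symm
  have hc : Continuous fun t => D.radius t ^ 2 / 2 := (D.continuous_radius.pow 2).div_const 2
  rw [MeasureTheory.restrict_Ioo_eq_restrict_Ioc,
    ← MeasureTheory.ofReal_integral_eq_lintegral_ofReal hc.integrableOn_Ioc
      (Filter.Eventually.of_forall fun t => by positivity),
    ← intervalIntegral.integral_of_le (by linarith [Real.pi_pos]), ENNReal.ofReal_eq_one,
    intervalIntegral.integral_div] at h3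
  have hper : Function.Periodic (fun t => D.radius t ^ 2) (2 * Real.pi) := fun t => by
    simp only [D.radius_periodic t]
  have h4 := hper.intervalIntegral_add_eq (-Real.pi) 0
  rw [show -Real.pi + 2 * Real.pi = Real.pi by ring, zero_add] at h4
  rw [← h4]
  linarith

/-- Hahn–Banach separates `q` from the interior; since the center is interior, the functional is
positive on `q - D.center` and can be normalized. -/
theorem exists_support {q : ℝ × ℝ} (hq : q ∈ frontier D.carrier) :
    ∃ l : ℝ × ℝ →L[ℝ] ℝ, l (q - D.center) = 1 ∧ ∀ x ∈ D.carrier, l (x - D.center) ≤ 1 := by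
  have hq' : q ∉ interior D.carrier := fun h => (Set.disjoint_left.1 disjoint_interior_frontier h) hq
  obtain ⟨f, hf⟩ := geometric_hahn_banach_open_point D.convex.interior isOpen_interior hq'
  have h0 : 0 < f (q - D.center) := by
    rw [map_sub]; exact sub_pos.2 (hf _ D.center_mem)
  refine ⟨(f (q - D.center))⁻¹ • f, inv_mul_cancel₀ h0.ne', fun x hx => ?_⟩
  have h1 : f x ≤ f q := by
    have hx' : x ∈ closure (interior D.carrier) := by
      rw [D.convex.closure_interior_eq_closure_of_nonempty_interior ⟨_, D.center_mem⟩]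
      exact subset_closure hx
    exact le_on_closure (fun y hy => (hf y hy).le) f.continuous.continuousOn
      continuousOn_const hx'
  have h2 : f (x - D.center) ≤ f (q - D.center) := by
    rw [map_sub, map_sub]; linarith
  simp only [smul_apply, smul_eq_mul]
  rw [inv_mul_le_iff₀ h0, mul_one]
  exact h2

end MarkedDomain

/-! ### Smooth parametrization of the boundary -/

section Parametrization

theorem exists_partition_of_finite {Z : Set ℝ} (hZ : Z.Finite) {p : ℝ} (hp : 0 < p) :
    ∃ (n : ℕ) (z : Fin (n + 1) → ℝ), StrictMono z ∧ z 0 = 0 ∧ z (Fin.last n) = p ∧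
      ∀ i : Fin n, ∀ t ∈ Set.Ioo (z i.castSucc) (z i.succ), t ∉ Z := by
  classical
  set s : Finset ℝ := insert 0 (insert p (hZ.toFinset.filter fun t => t ∈ Set.Ioo 0 p)) with hs
  have hs0 : (0 : ℝ) ∈ s := Finset.mem_insert_self _ _
  have hsp : p ∈ s := Finset.mem_insert_of_mem (Finset.mem_insert_self _ _)
  have hsI : ∀ t ∈ s, 0 ≤ t ∧ t ≤ p := by
    intro t ht
    simp only [hs, Finset.mem_insert, Finset.mem_filter, Set.mem_Ioo] at ht
    rcases ht with rfl | rfl | ⟨_, h1, h2⟩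
    exacts [⟨le_rfl, hp.le⟩, ⟨hp.le, le_rfl⟩, ⟨h1.le, h2.le⟩]
  obtain ⟨n, hn⟩ : ∃ n, s.card = n + 1 :=
    Nat.exists_eq_succ_of_ne_zero (Finset.card_pos.2 ⟨0, hs0⟩).ne'
  let z := s.orderEmbOfFin hn
  have hmem : ∀ i, z i ∈ s := fun i => s.orderEmbOfFin_mem hn i
  have hsurj : ∀ t ∈ s, ∃ i, z i = t := fun t ht => by
    have : t ∈ Set.range z := by rw [Finset.range_orderEmbOfFin]; exact ht
    exact this
  have hz0 : z 0 = 0 := by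
    obtain ⟨i, hi⟩ := hsurj 0 hs0
    exact le_antisymm (hi ▸ z.monotone (Fin.zero_le i)) (hsI _ (hmem 0)).1
  have hzp : z (Fin.last n) = p := by
    obtain ⟨i, hi⟩ := hsurj p hsp
    refine le_antisymm (hsI _ (hmem _)).2 ?_
    conv_lhs => rw [← hi]
    exact z.monotone (Fin.le_last i)
  refine ⟨n, z, z.strictMono, hz0, hzp, fun i t ht htZ => ?_⟩
  have hts : t ∈ s := by
    have h1 := (hsI _ (hmem i.castSucc)).1
    have h2 := (hsI _ (hmem i.succ)).2
    simp only [hs, Finset.mem_insert, Finset.mem_filter, Set.mem_Ioo, Set.Finite.mem_toFinset]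
    exact Or.inr (Or.inr ⟨htZ, by linarith [ht.1], by linarith [ht.2]⟩)
  obtain ⟨j, rfl⟩ := hsurj t hts
  have h1 := z.lt_iff_lt.1 ht.1
  have h2 := z.lt_iff_lt.1 ht.2
  rw [Fin.lt_def] at h1 h2
  simp at h1 h2
  omega

theorem continuous_cross_unitVec (v : ℝ × ℝ) : Continuous fun t => cross v (unitVec t) := by
  unfold cross unitVec; fun_prop

theorem finite_cross_unitVec_eq_zero {v : ℝ × ℝ} (hv : v ≠ 0) :
    {t ∈ Set.Icc 0 (2 * Real.pi) | cross v (unitVec t) = 0}.Finite := by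
  rcases Set.eq_empty_or_nonempty {t ∈ Set.Icc 0 (2 * Real.pi) | cross v (unitVec t) = 0} with
    h | ⟨s, hs, hs0⟩
  · rw [h]; exact Set.finite_empty
  refine Set.Finite.subset ((Set.finite_Icc (-2 : ℤ) 2).image fun k : ℤ => s + (k : ℝ) * Real.pi) ?_
  rintro t ⟨ht, ht0⟩
  have hsin : Real.sin (t - s) = 0 := by
    simp only [cross, unitVec] at hs0 ht0
    rw [Real.sin_sub]
    by_cases h1 : v.1 = 0
    · have h2 : v.2 ≠ 0 := fun h2 => hv (Prod.ext h1 h2)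
      apply mul_left_cancel₀ h2
      linear_combination Real.sin s * ht0 - Real.sin t * hs0
    · apply mul_left_cancel₀ h1
      linear_combination Real.cos s * ht0 - Real.cos t * hs0
  obtain ⟨k, hk⟩ := Real.sin_eq_zero_iff.1 hsin
  have hpi := Real.pi_pos
  refine ⟨k, ⟨?_, ?_⟩, by linarith⟩
  · have : (-3 : ℝ) * Real.pi < k * Real.pi := by rw [hk]; linarith [ht.1, hs.2]
    have := lt_of_mul_lt_mul_right this hpi.le
    have : (-3 : ℤ) < k := by exact_mod_cast this
    omega
  · have : (k : ℝ) * Real.pi < 3 * Real.pi := by rw [hk]; linarith [ht.2, hs.1]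
    have := lt_of_mul_lt_mul_right this hpi.le
    have : k < (3 : ℤ) := by exact_mod_cast this
    omega

theorem pos_of_ne_zero_of_pos {f : ℝ → ℝ} {a b m : ℝ} (hf : Continuous f)
    (h0 : ∀ t ∈ Set.Ioo a b, f t ≠ 0) (hm : m ∈ Set.Ioo a b) (hfm : 0 < f m) :
    ∀ t ∈ Set.Ioo a b, 0 < f t := by
  intro t ht
  by_contra h
  have hsub : Set.uIcc m t ⊆ Set.Ioo a b := Set.OrdConnected.uIcc_subset Set.ordConnected_Ioo hm ht
  obtain ⟨s, hs, hs0⟩ := intermediate_value_uIcc (a := m) (b := t) hf.continuousOn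
    (Set.mem_uIcc.2 (Or.inr ⟨not_lt.1 h, hfm.le⟩))
  exact h0 s (hsub hs) hs0

namespace MarkedDomain

variable {N : ℕ} (D : MarkedDomain N)

/-- In an angular sector free of vertex directions the boundary is part of one line `l = 1`. Take
`l` supporting at the boundary point on the middle ray. Two vertices on that line lie on opposite
sides of the ray, and stay on opposite sides throughout the sector, so every ray of the sector meets
the segment between them. -/
theorem radius_eq_inv_of_polygon {S : Finset (ℝ × ℝ)} (hS : D.carrier = convexHull ℝ (S : Set (ℝ × ℝ)))
    {a b : ℝ} (hab : a < b)
    (h0 : ∀ t ∈ Set.Ioo a b, ∀ s ∈ S, s ≠ D.center → cross (s - D.center) (unitVec t) ≠ 0) :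
    ∃ l : ℝ × ℝ →L[ℝ] ℝ, ∀ t ∈ Set.Icc a b, l (unitVec t) * D.radius t = 1 := by
  set c := D.center with hc
  set m := (a + b) / 2 with hm
  have hmI : m ∈ Set.Ioo a b := ⟨by linarith, by linarith⟩
  set q := c + D.radius m • unitVec m with hq
  have hqf : q ∈ frontier D.carrier := D.radius_smul_mem_frontier m
  obtain ⟨l, hl1, hl⟩ := D.exists_support hqf
  have hqc : q - c = D.radius m • unitVec m := by rw [hq]; abel
  refine ⟨l, ?_⟩
  have hqS : q ∈ convexHull ℝ (S : Set (ℝ × ℝ)) := hS ▸ D.isCompact.isClosed.frontier_subset hqf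
  have hsub : ∀ s ∈ S, s ∈ D.carrier := fun s hs => hS ▸ subset_convexHull ℝ _ hs
  obtain ⟨w, hw0, hw1, hwq⟩ := Finset.mem_convexHull'.1 hqS
  have hwc : ∑ s ∈ S, w s • (s - c) = q - c := by
    simp only [smul_sub, Finset.sum_sub_distrib, ← Finset.sum_smul, hw1, hwq, one_smul]
  -- The weighted mean of values at most `1` equals `1`, so each value of positive weight is `1`.
  have hls : ∀ s ∈ S, w s ≠ 0 → l (s - c) = 1 := by
    have h1 : ∑ s ∈ S, w s * (1 - l (s - c)) = 0 := by
      have : l (q - c) = ∑ s ∈ S, w s * l (s - c) := by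
        rw [← hwc, map_sum]; simp
      simp only [mul_sub, mul_one, Finset.sum_sub_distrib, hw1, ← this]
      rw [hl1]; ring
    have h2 := (Finset.sum_eq_zero_iff_of_nonneg fun s hs =>
      mul_nonneg (hw0 s hs) (sub_nonneg.2 (hl s (hsub s hs)))).1 h1
    intro s hs hws
    have := (mul_eq_zero.1 (h2 s hs)).resolve_left hws
    linarith
  have hsc : ∀ s ∈ S, w s ≠ 0 → s ≠ c := by
    intro s hs hws hsc
    have := hls s hs hws
    rw [hsc, sub_self, map_zero] at this
    exact zero_ne_one this
  have hcross : ∑ s ∈ S, w s * cross (s - c) (unitVec m) = 0 := by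
    have h1 : cross (q - c) (unitVec m) = 0 := by
      rw [hqc]; simp [cross]; ring
    have h2 : ∀ v : ℝ × ℝ, cross v (unitVec m) =
        ((unitVec m).2 • ContinuousLinearMap.fst ℝ ℝ ℝ - (unitVec m).1 • ContinuousLinearMap.snd ℝ ℝ ℝ) v
        := fun v => by simp [cross]; ring
    rw [h2, ← hwc, map_sum] at h1
    rw [← h1]
    exact Finset.sum_congr rfl fun s _ => by rw [map_smul, ← h2, smul_eq_mul]
  -- The signed terms sum to zero but do not all vanish, so both signs occur: this yields the
  -- vertices `s` and `s'` on the two sides of the ray.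
  have hex : ∃ s ∈ S, w s * cross (s - c) (unitVec m) ≠ 0 := by
    obtain ⟨s, hs, hws⟩ := Finset.exists_ne_zero_of_sum_ne_zero (hw1 ▸ one_ne_zero : ∑ s ∈ S, w s ≠ 0)
    exact ⟨s, hs, mul_ne_zero hws (h0 m hmI s hs (hsc s hs hws))⟩
  obtain ⟨s, hs, hspos⟩ := Finset.exists_pos_of_sum_zero_of_exists_nonzero _ hcross hex
  obtain ⟨s', hs', hsneg⟩ := Finset.exists_pos_of_sum_zero_of_exists_nonzero
    (fun s => -(w s * cross (s - c) (unitVec m))) (by rw [Finset.sum_neg_distrib, hcross, neg_zero])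
    (by obtain ⟨s, hs, h⟩ := hex; exact ⟨s, hs, neg_ne_zero.2 h⟩)
  have hws : w s ≠ 0 := fun h => by simp [h] at hspos
  have hws' : w s' ≠ 0 := fun h => by simp [h] at hsneg
  have hp1 : 0 < cross (s - c) (unitVec m) := pos_of_mul_pos_right hspos (hw0 s hs)
  have hp2 : 0 < -cross (s' - c) (unitVec m) :=
    pos_of_mul_pos_right (by linarith) (hw0 s' hs')
  have hP1 := pos_of_ne_zero_of_pos (continuous_cross_unitVec (s - c))
    (fun t ht => h0 t ht s hs (hsc s hs hws)) hmI hp1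
  have hP2 := pos_of_ne_zero_of_pos (continuous_cross_unitVec (s' - c)).neg
    (fun t ht => neg_ne_zero.2 (h0 t ht s' hs' (hsc s' hs' hws'))) hmI hp2
  -- Cramer's rule: the coordinates of the direction in terms of the two vertices, both positive in
  -- the sector.
  have key : ∀ t, cross (s - c) (s' - c) • unitVec t =
      (-cross (s' - c) (unitVec t)) • (s - c) + cross (s - c) (unitVec t) • (s' - c) := by
    intro t
    ext <;> simp [cross] <;> ring
  have hl1s := hls s hs hws
  have hl1s' := hls s' hs' hws'
  have keyl : ∀ t, cross (s - c) (s' - c) * l (unitVec t) =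
      -cross (s' - c) (unitVec t) + cross (s - c) (unitVec t) := by
    intro t
    have := congrArg l (key t)
    simpa only [map_add, map_smul, smul_eq_mul, hl1s, hl1s', mul_one] using this
  have hlm : 0 < l (unitVec m) := by
    have h1 : D.radius m * l (unitVec m) = 1 := by
      rw [← smul_eq_mul, ← map_smul, ← hqc, hl1]
    exact pos_of_mul_pos_right (by rw [h1]; exact one_pos) (D.radius_pos m).le
  have hcr : 0 < cross (s - c) (s' - c) := by
    have h1 : 0 < cross (s - c) (s' - c) * l (unitVec m) := by rw [keyl]; linarith
    exact pos_of_mul_pos_left h1 hlm.le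
  have hIoo : ∀ t ∈ Set.Ioo a b, l (unitVec t) * D.radius t = 1 := by
    intro t ht
    have ha := hP2 t ht
    have hb := hP1 t ht
    set A := -cross (s' - c) (unitVec t) with hA
    set B := cross (s - c) (unitVec t) with hB
    have hle : l (unitVec t) * D.radius t ≤ 1 := by
      have := hl _ (D.isCompact.isClosed.frontier_subset (D.radius_smul_mem_frontier t))
      rw [← hc, add_sub_cancel_left, map_smul, smul_eq_mul] at this
      linarith
    have hAB : 0 < A + B := add_pos ha hb
    have hmem : (A / (A + B)) • s + (B / (A + B)) • s' ∈ D.carrier :=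
      D.convex (hsub s hs) (hsub s' hs') (by positivity) (by positivity) (by field_simp)
    have heq : (A / (A + B)) • s + (B / (A + B)) • s' =
        c + (cross (s - c) (s' - c) / (A + B)) • unitVec t := by
      have h1 : (cross (s - c) (s' - c) / (A + B)) • unitVec t =
          (A + B)⁻¹ • (A • (s - c) + B • (s' - c)) := by
        rw [← key t, smul_smul]; congr 1; ring
      have h2 : A / (A + B) + B / (A + B) = 1 := by field_simp
      rw [h1]
      ext
      · simp only [Prod.fst_add, Prod.smul_fst, Prod.fst_sub, smul_eq_mul]
        linear_combination c.1 * h2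
      · simp only [Prod.snd_add, Prod.smul_snd, Prod.snd_sub, smul_eq_mul]
        linear_combination c.2 * h2
    rw [heq, D.smul_mem_carrier_iff (by positivity)] at hmem
    have hlt := keyl t
    have hlpos : 0 < l (unitVec t) :=
      pos_of_mul_pos_right (by rw [hlt]; exact hAB) hcr.le
    refine le_antisymm hle ?_
    calc (1 : ℝ) = l (unitVec t) * (cross (s - c) (s' - c) / (A + B)) := by
          rw [← hlt]; field_simp
      _ ≤ _ := mul_le_mul_of_nonneg_left hmem hlpos.le
  intro t ht
  have hcl : t ∈ closure (Set.Ioo a b) := by rwa [closure_Ioo hab.ne]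
  have hcont : Continuous fun t => l (unitVec t) * D.radius t :=
    (l.continuous.comp (contDiff_unitVec (n := 0)).continuous).mul D.continuous_radius
  have := (isClosed_eq hcont continuous_const).closure_subset_iff.2
    (show Set.Ioo a b ⊆ {t | l (unitVec t) * D.radius t = 1} from hIoo)
  exact this hcl

/-- `κ` is locally constant near a finite set of angles containing every possible corner direction,
so the composition is locally constant there. Between these angles the radius is the inverse of a
linear functional of the unit vector. -/
theorem exists_smooth_radius_of_polygon (h : IsConvexPolygon D.carrier) :
    ∃ κ, IsCircleLift κ ∧ Monotone κ ∧ ContDiff ℝ ∞ (fun t => D.radius (κ t)) := by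
  obtain ⟨S, hS⟩ := h
  have hZ : {t ∈ Set.Icc 0 (2 * Real.pi) | ∃ s ∈ S, s ≠ D.center ∧
      cross (s - D.center) (unitVec t) = 0}.Finite := by
    refine Set.Finite.subset (S.finite_toSet.biUnion (t := fun s => {t | s ≠ D.center ∧
      t ∈ Set.Icc 0 (2 * Real.pi) ∧ cross (s - D.center) (unitVec t) = 0}) fun s _ => ?_) ?_
    · by_cases hs : s = D.center
      · simp [hs]
      · exact (finite_cross_unitVec_eq_zero (sub_ne_zero.2 hs)).subset fun t ht => ht.2
    · rintro t ⟨ht, s, hs, hsc, h⟩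
      exact Set.mem_biUnion hs ⟨hsc, ht, h⟩
  obtain ⟨n, z, hz, hz0, hzn, hzZ⟩ := exists_partition_of_finite hZ Real.two_pi_pos
  have hn : z (Fin.last n) = z 0 + 2 * Real.pi := by rw [hz0, hzn, zero_add]
  obtain ⟨κ, hκ, hκm, hκz⟩ := exists_isCircleLift hz hz.monotone hn hn
  refine ⟨κ, hκ, hκm, ?_⟩
  have hI : ∀ t ∈ Set.Ico 0 (2 * Real.pi), ContDiffAt ℝ ∞ (fun t => D.radius (κ t)) t := by
    intro t ht
    have hloc : ∀ i, t = z i → ContDiffAt ℝ ∞ (fun t => D.radius (κ t)) t := by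
      rintro i rfl
      refine (contDiffAt_const (c := D.radius (z i))).congr_of_eventuallyEq ?_
      filter_upwards [hκz i] with x hx
      rw [hx]
    by_cases hti : ∃ i, t = z i
    · obtain ⟨i, hi⟩ := hti; exact hloc i hi
    push Not at hti
    obtain ⟨i, hi⟩ : ∃ i : Fin n, t ∈ Set.Ioo (z i.castSucc) (z i.succ) := by
      by_contra hcon
      push Not at hcon
      have : ∀ j : Fin (n + 1), z j < t := by
        intro j
        induction j using Fin.induction with
        | zero => exact lt_of_le_of_ne (hz0 ▸ ht.1) (hti 0).symm
        | succ j ih =>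
          have := hcon j
          rw [Set.mem_Ioo, not_and, not_lt] at this
          exact lt_of_le_of_ne (this ih) (hti _).symm
      have := this (Fin.last n)
      rw [hzn] at this
      exact absurd ht.2 (not_lt.2 this.le)
    obtain ⟨l, hl⟩ := D.radius_eq_inv_of_polygon hS (hi.1.trans hi.2) (fun t' ht' s hs hsc h =>
      hzZ i t' ht' ⟨⟨by
        have := hz.monotone (Fin.zero_le i.castSucc)
        rw [hz0] at this; exact this.trans ht'.1.le, by
        have := hz.monotone (Fin.le_last i.succ)
        rw [hzn] at this; exact ht'.2.le.trans this⟩, s, hs, hsc, h⟩)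
    have hfix : ∀ j, κ (z j) = z j := fun j => (hκz j).self_of_nhds
    have hev : ∀ x ∈ Set.Ioo (z i.castSucc) (z i.succ),
        l (unitVec (κ x)) * D.radius (κ x) = 1 := by
      intro x hx
      refine hl _ ⟨?_, ?_⟩
      · rw [← hfix i.castSucc]; exact hκm hx.1.le
      · rw [← hfix i.succ]; exact hκm hx.2.le
    have hsm : ContDiffAt ℝ ∞ (fun x => (l (unitVec (κ x)))⁻¹) t :=
      ((l.contDiff.comp (contDiff_unitVec.comp hκ.contDiff)).contDiffAt).inv fun h0 => by
        have := hev t hi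
        simp only [Function.comp_apply] at h0
        rw [h0, zero_mul] at this
        exact zero_ne_one this
    refine hsm.congr_of_eventuallyEq ?_
    filter_upwards [isOpen_Ioo.mem_nhds hi] with x hx
    exact (inv_eq_of_mul_eq_one_right (hev x hx)).symm
  rw [contDiff_iff_contDiffAt]
  intro x
  have hper : Function.Periodic (fun t => D.radius (κ t)) (2 * Real.pi) := fun t => by
    simp only [hκ.add_two_pi, D.radius_periodic (κ t)]
  obtain ⟨y, hy, k, hk⟩ : ∃ y ∈ Set.Ico 0 (2 * Real.pi), ∃ k : ℤ, y = x - k * (2 * Real.pi) := by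
    refine ⟨toIcoMod Real.two_pi_pos 0 x, ?_, toIcoDiv Real.two_pi_pos 0 x, ?_⟩
    · simpa using toIcoMod_mem_Ico Real.two_pi_pos 0 x
    · rw [toIcoMod, zsmul_eq_mul]
  have e : (fun t => D.radius (κ t)) = (fun t => D.radius (κ t)) ∘ fun t => t - k * (2 * Real.pi) := by
    funext t
    exact (hper.sub_int_mul_eq k).symm
  rw [e]
  exact ContDiffAt.comp x (hk ▸ hI y hy) (by fun_prop)

/-- The map `(r, t) ↦ r • (γ t - c)` has invertible differential at the boundary point, since a
supporting functional equals `1` on the position vector and, by maximality, `0` on the tangent. By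
homogeneity the gauge is the first component of its local inverse. -/
theorem contDiffAt_gauge_of_smooth (h : HasSmoothBoundary D.carrier) (t₀ : ℝ) :
    ContDiffAt ℝ ∞ (gauge D.body) (D.radius t₀ • unitVec t₀) := by
  obtain ⟨γ, hγ, -, -, hγ0, hγr⟩ := h
  set c := D.center with hc
  have hq := D.radius_smul_mem_frontier t₀
  obtain ⟨l, hl1, hl⟩ := D.exists_support hq
  obtain ⟨s, hs⟩ : ∃ s, γ s = c + D.radius t₀ • unitVec t₀ := by
    rw [← hγr] at hq; exact hq
  rw [← hs] at hl1
  have hd : HasDerivAt γ (deriv γ s) s := (hγ.differentiable (by simp) s).hasDerivAt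
  have hld : l (deriv γ s) = 0 := by
    have h1 : HasDerivAt (fun t => l (γ t - c)) (l (deriv γ s)) s :=
      l.hasFDerivAt.comp_hasDerivAt s (hd.sub_const c)
    have h2 : IsLocalMax (fun t => l (γ t - c)) s := by
      refine Filter.Eventually.of_forall fun t => ?_
      simp only
      rw [hl1]
      exact hl _ (D.isCompact.isClosed.frontier_subset (hγr ▸ Set.mem_range_self t))
    exact h2.hasDerivAt_eq_zero h1
  let P : ℝ × ℝ → ℝ × ℝ := fun p => p.1 • (γ p.2 - c)
  have hP : ContDiff ℝ ∞ P := contDiff_fst.smul ((hγ.comp contDiff_snd).sub contDiff_const)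
  let P' : ℝ × ℝ →L[ℝ] ℝ × ℝ :=
    (ContinuousLinearMap.fst ℝ ℝ ℝ).smulRight (γ s - c) +
      (ContinuousLinearMap.snd ℝ ℝ ℝ).smulRight (deriv γ s)
  have hP' : HasFDerivAt P P' (1, s) := by
    have h1 : HasFDerivAt (fun p : ℝ × ℝ => γ p.2 - c)
        ((ContinuousLinearMap.snd ℝ ℝ ℝ).smulRight (deriv γ s)) ((1 : ℝ), s) := by
      have := HasFDerivAt.comp (g := γ) ((1 : ℝ), s) (f := Prod.snd) hd.hasFDerivAt hasFDerivAt_snd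
      exact (this.sub_const c).congr_fderiv (by ext <;> simp)
    have h2 := (hasFDerivAt_fst (𝕜 := ℝ) (p := ((1 : ℝ), s))).smul h1
    exact h2.congr_fderiv (by ext <;> simp [P'])
  have hinj : Function.Injective P' := by
    rw [injective_iff_map_eq_zero]
    rintro ⟨a, b⟩ hab
    have h1 : a • (γ s - c) + b • deriv γ s = 0 := hab
    have h2 := congrArg l h1
    rw [map_add, map_smul, map_smul, hl1, hld, map_zero] at h2
    have ha : a = 0 := by simpa using h2
    rw [ha, zero_smul, zero_add] at h1
    have hb : b = 0 := (smul_eq_zero.1 h1).resolve_right (hγ0 s)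
    rw [ha, hb]; rfl
  let e : (ℝ × ℝ) ≃L[ℝ] ℝ × ℝ :=
    (LinearEquiv.ofInjectiveEndo P'.toLinearMap hinj).toContinuousLinearEquiv
  have he : HasFDerivAt P (e : ℝ × ℝ →L[ℝ] ℝ × ℝ) (1, s) := hP'.congr_fderiv (by ext <;> rfl)
  have hn : (∞ : WithTop ℕ∞) ≠ 0 := by simp
  let R := hP.contDiffAt.toOpenPartialHomeomorph P he hn
  have hsrc : ((1 : ℝ), s) ∈ R.source := hP.contDiffAt.mem_toOpenPartialHomeomorph_source he hn
  have hR : ∀ p, R p = P p := fun p => rfl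
  have hP1 : P (1, s) = D.radius t₀ • unitVec t₀ := by
    simp only [P, one_smul, hs, add_sub_cancel_left]
  have hinv : ContDiffAt ℝ ∞ R.symm (D.radius t₀ • unitVec t₀) := by
    rw [← hP1]
    exact hP.contDiffAt.to_localInverse he hn
  have htgt : D.radius t₀ • unitVec t₀ ∈ R.target := by
    rw [← hP1, ← hR]; exact R.map_source hsrc
  have hsymm : R.symm (D.radius t₀ • unitVec t₀) = (1, s) := by
    rw [← hP1, ← hR]; exact R.left_inv hsrc
  have hfst : ∀ᶠ v in 𝓝 (D.radius t₀ • unitVec t₀), 0 < (R.symm v).1 := by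
    have h1 : Filter.Tendsto (fun v => (R.symm v).1) (𝓝 (D.radius t₀ • unitVec t₀)) (𝓝 1) := by
      have := (continuous_fst.continuousAt (x := R.symm (D.radius t₀ • unitVec t₀))).comp
        hinv.continuousAt
      rw [ContinuousAt, Function.comp_apply, hsymm] at this
      exact this
    exact h1.eventually (lt_mem_nhds one_pos)
  refine (contDiff_fst.contDiffAt.comp (D.radius t₀ • unitVec t₀) hinv).congr_of_eventuallyEq ?_
  filter_upwards [hfst, R.open_target.mem_nhds htgt] with v hv hvt
  have h1 : v = (R.symm v).1 • (γ (R.symm v).2 - c) := (R.right_inv hvt).symm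
  have h2 : gauge D.body (γ (R.symm v).2 - c) = 1 := by
    rw [← D.add_mem_frontier_iff, ← hc, add_sub_cancel, ← hγr]
    exact Set.mem_range_self _
  conv_lhs => rw [h1]
  rw [gauge_smul_of_nonneg hv.le, h2, smul_eq_mul, mul_one]
  rfl

theorem contDiff_radius_of_smooth (h : HasSmoothBoundary D.carrier) :
    ContDiff ℝ ∞ D.radius := by
  rw [contDiff_iff_contDiffAt]
  intro t₀
  have h1 : ContDiffAt ℝ ∞ (fun t => gauge D.body (D.radius t₀ • unitVec t)) t₀ :=
    ContDiffAt.comp (g := gauge D.body) (f := fun t => D.radius t₀ • unitVec t) t₀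
      (D.contDiffAt_gauge_of_smooth h t₀)
      (contDiff_unitVec.const_smul (D.radius t₀)).contDiffAt
  have h2 : D.radius = fun t => D.radius t₀ * (gauge D.body (D.radius t₀ • unitVec t))⁻¹ := by
    funext t
    rw [D.gauge_body_smul_unitVec (D.radius_pos t₀).le, inv_div,
      mul_div_cancel₀ _ (D.radius_pos t₀).ne']
  rw [h2]
  refine contDiffAt_const.mul (h1.inv ?_)
  exact (D.gauge_body_pos (smul_ne_zero (D.radius_pos t₀).ne' (unitVec_ne_zero t₀))).ne'

/-- The boundary has a smooth monotone parametrization of degree one by the polar angle. -/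
theorem exists_smooth_radius :
    ∃ κ, IsCircleLift κ ∧ Monotone κ ∧ ContDiff ℝ ∞ (fun t => D.radius (κ t)) := by
  rcases D.boundary with h | h
  · exact ⟨id, ⟨contDiff_id, fun _ => rfl⟩, monotone_id, D.contDiff_radius_of_smooth h⟩
  · exact D.exists_smooth_radius_of_polygon h

end MarkedDomain

end Parametrization

/-! ### Periodic functions: smoothing from below and matching densities -/

section PeriodicFunctions

theorem exists_mem_Icc_add_int_mul {p : ℝ} (hp : 0 < p) (x : ℝ) :
    ∃ y ∈ Set.Icc 0 p, ∃ k : ℤ, x = y + k * p := by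
  refine ⟨toIcoMod hp 0 x, ?_, toIcoDiv hp 0 x, ?_⟩
  · have := toIcoMod_mem_Ico hp 0 x
    rw [zero_add] at this
    exact ⟨this.1, this.2.le⟩
  · rw [toIcoMod, zsmul_eq_mul]; ring

theorem Function.Periodic.exists_pos_le {g : ℝ → ℝ} {p : ℝ} (hp : 0 < p) (hper : Function.Periodic g p)
    (hg : Continuous g) (h0 : ∀ x, 0 < g x) : ∃ m, 0 < m ∧ ∀ x, m ≤ g x := by
  obtain ⟨y, -, hy⟩ := (isCompact_Icc (a := (0 : ℝ)) (b := p)).exists_isMinOn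
    (Set.nonempty_Icc.2 hp.le) hg.continuousOn
  refine ⟨g y, h0 y, fun x => ?_⟩
  obtain ⟨x', hx', k, rfl⟩ := exists_mem_Icc_add_int_mul hp x
  rw [hper.int_mul k x']
  exact hy hx'

theorem contDiff_normed_convolution {g : ℝ → ℝ} (hg : Continuous g) (φ : ContDiffBump (0 : ℝ)) :
    ContDiff ℝ ∞ (MeasureTheory.convolution (φ.normed MeasureTheory.volume) g
      (ContinuousLinearMap.lsmul ℝ ℝ) MeasureTheory.volume) :=
  HasCompactSupport.contDiff_convolution_left (n := ⊤) _ φ.hasCompactSupport_normed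
    φ.contDiff_normed hg.locallyIntegrable

theorem periodic_convolution {f g : ℝ → ℝ} {p : ℝ} (hper : Function.Periodic g p) :
    Function.Periodic (MeasureTheory.convolution f g
      (ContinuousLinearMap.lsmul ℝ ℝ) MeasureTheory.volume) p := by
  intro x
  simp only [MeasureTheory.convolution]
  congr 1
  funext t
  rw [show x + p - t = x - t + p by ring, hper]

theorem exists_periodic_contDiff_near {g : ℝ → ℝ} {p : ℝ} (hp : 0 < p)
    (hper : Function.Periodic g p) (hg : Continuous g) {ε : ℝ} (hε : 0 < ε) :
    ∃ h : ℝ → ℝ, ContDiff ℝ ∞ h ∧ Function.Periodic h p ∧ ∀ x, |h x - g x| ≤ ε := by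
  have huc := (isCompact_Icc (a := (-1 : ℝ)) (b := p + 1)).uniformContinuousOn_of_continuous
    hg.continuousOn
  obtain ⟨δ, hδ, hδg⟩ := Metric.uniformContinuousOn_iff.1 huc ε hε
  set r := min δ 1 with hr
  have hr0 : 0 < r := lt_min hδ one_pos
  -- A radius of at most `1` keeps the averaging over points of one period inside the interval of
  -- uniform continuity.
  let φ : ContDiffBump (0 : ℝ) := ⟨r / 2, r, by linarith, by linarith⟩
  refine ⟨_, contDiff_normed_convolution hg φ, periodic_convolution hper, fun x => ?_⟩
  obtain ⟨y, hy, k, rfl⟩ := exists_mem_Icc_add_int_mul hp x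
  rw [(periodic_convolution hper).int_mul k y, hper.int_mul k y, ← Real.dist_eq]
  refine φ.dist_normed_convolution_le hg.aestronglyMeasurable fun x hx => ?_
  have hx' : dist x y < r := hx
  have h1 := abs_lt.1 (Real.dist_eq x y ▸ hx'.trans_le (min_le_right _ _))
  exact (hδg x ⟨by linarith [hy.1], by linarith [hy.2]⟩ y ⟨by linarith [hy.1], by linarith [hy.2]⟩
    (hx'.trans_le (min_le_left _ _))).le

/-- Lowering an `ε`-close mollification by `ε` places it between `g - 2ε` and `g`; its square is
then at least `g² - 4εg`. It serves to replace a merely continuous radius by a smooth one from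
inside, at little cost of area. -/
theorem exists_periodic_contDiff_le {g : ℝ → ℝ} {p : ℝ} (hp : 0 < p)
    (hper : Function.Periodic g p) (hg : Continuous g) (h0 : ∀ x, 0 < g x) {A : ℝ}
    (hA : A < ∫ x in (0 : ℝ)..p, g x ^ 2) :
    ∃ h : ℝ → ℝ, ContDiff ℝ ∞ h ∧ Function.Periodic h p ∧ (∀ x, 0 < h x) ∧ (∀ x, h x ≤ g x) ∧
      A < ∫ x in (0 : ℝ)..p, h x ^ 2 := by
  obtain ⟨m, hm0, hm⟩ := hper.exists_pos_le hp hg h0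
  have hlim : Filter.Tendsto (fun ε : ℝ => ∫ x in (0 : ℝ)..p, (g x ^ 2 - 4 * ε * g x)) (𝓝[>] 0)
      (𝓝 (∫ x in (0 : ℝ)..p, g x ^ 2)) := by
    have e : (fun ε : ℝ => ∫ x in (0 : ℝ)..p, (g x ^ 2 - 4 * ε * g x)) =
        fun ε : ℝ => (∫ x in (0 : ℝ)..p, g x ^ 2) - 4 * ε * ∫ x in (0 : ℝ)..p, g x := by
      funext ε
      have h1 : Continuous fun x => g x ^ 2 := hg.pow 2
      have h2 : Continuous fun x => 4 * ε * g x := continuous_const.mul hg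
      rw [intervalIntegral.integral_sub (h1.intervalIntegrable _ _) (h2.intervalIntegrable _ _),
        intervalIntegral.integral_const_mul]
    rw [e]
    have : Filter.Tendsto (fun ε : ℝ => (∫ x in (0 : ℝ)..p, g x ^ 2) -
        4 * ε * ∫ x in (0 : ℝ)..p, g x) (𝓝 0) (𝓝 ((∫ x in (0 : ℝ)..p, g x ^ 2) -
        4 * 0 * ∫ x in (0 : ℝ)..p, g x)) :=
      (by fun_prop : Continuous fun ε : ℝ => (∫ x in (0 : ℝ)..p, g x ^ 2) -
        4 * ε * ∫ x in (0 : ℝ)..p, g x).tendsto 0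
    rw [mul_zero, zero_mul, sub_zero] at this
    exact this.mono_left nhdsWithin_le_nhds
  -- The bound `ε < m / 2` keeps `g - 2ε` positive, as squaring the lower bound requires.
  obtain ⟨ε, hεA, hε0, hεm⟩ : ∃ ε : ℝ, A < ∫ x in (0 : ℝ)..p, (g x ^ 2 - 4 * ε * g x) ∧
      0 < ε ∧ ε < m / 2 := by
    have h1 := hlim.eventually (lt_mem_nhds hA)
    have h2 : ∀ᶠ ε : ℝ in 𝓝[>] 0, ε ∈ Set.Ioo 0 (m / 2) := Ioo_mem_nhdsGT (by linarith)
    obtain ⟨ε, h1, h2⟩ := (h1.and h2).exists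
    exact ⟨ε, h1, h2.1, h2.2⟩
  obtain ⟨f, hf, hfp, hfg⟩ := exists_periodic_contDiff_near hp hper hg hε0
  have hb : ∀ x, g x - 2 * ε ≤ f x - ε ∧ f x - ε ≤ g x := fun x => by
    have := abs_le.1 (hfg x)
    constructor <;> linarith
  have hpos : ∀ x, 0 < f x - ε := fun x => by linarith [hm x, (hb x).1]
  refine ⟨fun x => f x - ε, hf.sub contDiff_const, fun x => by simp only [hfp x], hpos,
    fun x => (hb x).2, hεA.trans_le ?_⟩
  refine intervalIntegral.integral_mono_on hp.le
    (((hg.pow 2).sub (continuous_const.mul hg)).intervalIntegrable _ _)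
    (((hf.continuous.sub continuous_const).pow 2).intervalIntegrable _ _) fun x _ => ?_
  have h1 := (hb x).1
  have h2 : 0 < g x - 2 * ε := by linarith [hm x]
  nlinarith

theorem hasDerivAt_integral_of_continuous {f : ℝ → ℝ} (hf : Continuous f) (x : ℝ) :
    HasDerivAt (fun x => ∫ t in (0 : ℝ)..x, f t) (f x) x :=
  intervalIntegral.integral_hasDerivAt_right (hf.intervalIntegrable _ _)
    (hf.stronglyMeasurableAtFilter _ _) hf.continuousAt

theorem contDiff_integral {f : ℝ → ℝ} (hf : ContDiff ℝ ∞ f) :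
    ContDiff ℝ ∞ (fun x => ∫ t in (0 : ℝ)..x, f t) := by
  have h := hasDerivAt_integral_of_continuous hf.continuous
  rw [contDiff_infty_iff_deriv]
  refine ⟨fun x => (h x).differentiableAt, ?_⟩
  rwa [show deriv (fun x => ∫ t in (0 : ℝ)..x, f t) = f from funext fun x => (h x).deriv]

theorem integral_add_period {f : ℝ → ℝ} {p : ℝ} (hf : Continuous f) (hper : Function.Periodic f p)
    (x : ℝ) : ∫ t in (0 : ℝ)..(x + p), f t = (∫ t in (0 : ℝ)..x, f t) + ∫ t in (0 : ℝ)..p, f t := by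
  have h1 := hper.intervalIntegral_add_eq x 0
  rw [zero_add] at h1
  rw [← h1, intervalIntegral.integral_add_adjacent_intervals (hf.intervalIntegrable _ _)
    (hf.intervalIntegrable _ _)]

theorem exists_contDiff_inverse_integral {w : ℝ → ℝ} (hw : ContDiff ℝ ∞ w) {η : ℝ} (hη : 0 < η)
    (hle : ∀ x, η ≤ w x) :
    ∃ G : ℝ → ℝ, ContDiff ℝ ∞ G ∧ (∀ y, ∫ t in (0 : ℝ)..(G y), w t = y) ∧
      ∀ x, G (∫ t in (0 : ℝ)..x, w t) = x := by
  set W : ℝ → ℝ := fun x => ∫ t in (0 : ℝ)..x, w t with hW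
  have hd : ∀ x, HasDerivAt W (w x) x := hasDerivAt_integral_of_continuous hw.continuous
  have hpos : ∀ x, 0 < w x := fun x => hη.trans_le (hle x)
  have hmono : StrictMono W := strictMono_of_deriv_pos fun x => by rw [(hd x).deriv]; exact hpos x
  have hmono' : Monotone fun x => W x - η * x := by
    refine monotone_of_deriv_nonneg (fun x => ((hd x).sub
      ((hasDerivAt_id x).const_mul η)).differentiableAt) fun x => ?_
    have := ((hd x).sub ((hasDerivAt_id x).const_mul η)).deriv
    change deriv (W - fun y => η * id y) x ≥ 0
    rw [this]
    linarith [hle x]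
  have hW0 : W 0 = 0 := intervalIntegral.integral_same
  have hsurj : Function.Surjective W := by
    refine Continuous.surjective (contDiff_integral hw).continuous ?_ ?_
    · refine Filter.tendsto_atTop_mono' _ ?_ (Filter.tendsto_id.const_mul_atTop hη)
      filter_upwards [Filter.eventually_ge_atTop 0] with x hx
      have := hmono' hx
      simp only [hW0] at this
      simp only [id]; linarith
    · refine Filter.tendsto_atBot_mono' _ ?_ (Filter.tendsto_id.const_mul_atBot hη)
      filter_upwards [Filter.eventually_le_atBot 0] with x hx
      have := hmono' hx
      simp only [hW0] at this
      simp only [id]; linarith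
  let e := (hmono.orderIsoOfSurjective W hsurj).toHomeomorph
  refine ⟨e.symm, ?_, fun y => e.apply_symm_apply y, fun x => e.symm_apply_apply x⟩
  exact e.contDiff_symm_deriv (fun x => (hpos x).ne') hd (contDiff_integral hw)

/-- A nonnegative periodic density can be pulled back to another, positive one of larger mass. -/
theorem exists_isCircleLift_density_le {w v : ℝ → ℝ} (hw : ContDiff ℝ ∞ w) (hv : ContDiff ℝ ∞ v)
    (hwp : Function.Periodic w (2 * Real.pi)) (hvp : Function.Periodic v (2 * Real.pi))
    (hw0 : ∀ x, 0 ≤ w x) (hv0 : ∀ x, 0 < v x) {μ : ℝ} (hμ0 : 0 < μ)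
    (hμ : ∫ x in (0 : ℝ)..(2 * Real.pi), w x < μ * ∫ x in (0 : ℝ)..(2 * Real.pi), v x) :
    ∃ τ, IsCircleLift τ ∧ ∀ x, 0 ≤ deriv τ x ∧ w (τ x) * deriv τ x ≤ μ * v x := by
  set p := 2 * Real.pi with hp
  have hp0 : 0 < p := Real.two_pi_pos
  -- This constant gives `w + η` and `μ v` the same mass over a period. It also makes the first
  -- density positive where `w` vanishes, so that its primitive can be inverted; `τ` then satisfies
  -- `(w ∘ τ + η) τ' = μ v`.
  set η := (μ * (∫ x in (0 : ℝ)..p, v x) - ∫ x in (0 : ℝ)..p, w x) / p with hη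
  have hη0 : 0 < η := div_pos (by linarith) hp0
  have hwη : ContDiff ℝ ∞ fun x => w x + η := hw.add contDiff_const
  obtain ⟨G, hG, hG1, hG2⟩ := exists_contDiff_inverse_integral hwη hη0
    fun x => by linarith [hw0 x]
  set V : ℝ → ℝ := fun x => ∫ t in (0 : ℝ)..x, v t with hV
  have hVd : ∀ x, HasDerivAt V (v x) x := hasDerivAt_integral_of_continuous hv.continuous
  have hmass : ∫ x in (0 : ℝ)..p, (w x + η) = μ * V p := by
    rw [intervalIntegral.integral_add (hw.continuous.intervalIntegrable _ _)
      (continuous_const.intervalIntegrable _ _), intervalIntegral.integral_const]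
    simp only [hV, hη, sub_zero, smul_eq_mul]
    field_simp
    ring
  have hτ : ContDiff ℝ ∞ fun x => G (μ * V x) := hG.comp (contDiff_const.mul (contDiff_integral hv))
  refine ⟨fun x => G (μ * V x), ⟨hτ, fun x => ?_⟩, fun x => ?_⟩
  · have h1 : V (x + p) = V x + V p := integral_add_period hv.continuous hvp x
    rw [← hp, h1, ← hG2 (G (μ * V x) + p), integral_add_period hwη.continuous
      (fun y => by simp only [hwp y]), hG1, hmass]
    congr 1; ring
  · have h1 : HasDerivAt (fun x => G (μ * V x)) (deriv (fun x => G (μ * V x)) x) x :=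
      (hτ.differentiable (by simp) x).hasDerivAt
    have h2 := (hasDerivAt_integral_of_continuous hwη.continuous (G (μ * V x))).comp x h1
    have h3 : ((fun x => ∫ t in (0 : ℝ)..x, (w t + η)) ∘ fun x => G (μ * V x)) =
        fun x => μ * V x := funext fun x => hG1 _
    rw [h3] at h2
    have h4 := h2.unique ((hVd x).const_mul μ)
    set d := deriv (fun x => G (μ * V x)) x
    have h5 : 0 < w (G (μ * V x)) + η := by linarith [hw0 (G (μ * V x))]
    have h6 : 0 ≤ d := by
      refine (pos_of_mul_pos_right (a := w (G (μ * V x)) + η) ?_ h5.le).le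
      rw [h4]; exact mul_pos hμ0 (hv0 x)
    exact ⟨h6, by nlinarith⟩

end PeriodicFunctions

/-! ### The radial profile -/

section RadialCutoff

/-- A profile close to the identity of `[0, 1]` but constant near both ends: smoothness of the
planar map at the center needs the first, the collar at the boundary the second. The bounds on `ψ'`
and `ψ` make `ψ' ψ` at most `(1 + ε)² x`. It is the normalized primitive of a bump with a long
plateau. -/
theorem exists_radial_cutoff {ε : ℝ} (hε : 0 < ε) :
    ∃ (δ : ℝ) (ψ : ℝ → ℝ), 0 < δ ∧ δ < 1 ∧ ContDiff ℝ ∞ ψ ∧ (∀ x ≤ δ, ψ x = 0) ∧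
      (∀ x, 1 - δ ≤ x → ψ x = 1) ∧ (∀ x, 0 ≤ ψ x ∧ ψ x ≤ 1) ∧
      (∀ x, 0 ≤ deriv ψ x ∧ deriv ψ x ≤ 1 + ε) ∧ ∀ x, 0 ≤ x → ψ x ≤ (1 + ε) * x := by
  obtain ⟨δ, hδ0, hδ1, hδε⟩ : ∃ δ : ℝ, 0 < δ ∧ δ ≤ 1 / 8 ∧ 1 ≤ (1 + ε) * (1 - 4 * δ) := by
    refine ⟨min (1 / 8) (ε / (4 * (1 + ε))), by positivity, min_le_left _ _, ?_⟩
    have h1 : min (1 / 8) (ε / (4 * (1 + ε))) ≤ ε / (4 * (1 + ε)) := min_le_right _ _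
    rw [le_div_iff₀ (by positivity)] at h1
    linarith
  -- The plateau, of length `1 - 4δ`, bounds the integral from below, so normalization raises the
  -- slope to at most `1 + ε`.
  let f : ContDiffBump (1 / 2 : ℝ) := ⟨1 / 2 - 2 * δ, 1 / 2 - δ, by linarith, by linarith⟩
  have hfs : ContDiff ℝ ∞ f := f.contDiff
  have hsupp : Function.support f ⊆ Set.Ioo δ (1 - δ) := by
    rw [f.support_eq, Real.ball_eq_Ioo]
    intro x hx
    simp only [Set.mem_Ioo, f] at hx ⊢
    constructor <;> linarith
  set J := ∫ x, f x with hJ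
  have hJle : 1 - 4 * δ ≤ J := by
    have h := f.measure_closedBall_le_integral MeasureTheory.volume
    rw [Real.closedBall_eq_Icc, Real.volume_real_Icc_of_le (by simp only [f]; linarith)] at h
    refine le_trans ?_ h
    simp only [f]; linarith
  have hJ0 : 0 < J := by linarith
  set P : ℝ → ℝ := fun x => ∫ t in (0 : ℝ)..x, f t with hP
  have hPd : ∀ x, HasDerivAt P (f x) x := hasDerivAt_integral_of_continuous f.continuous
  have hd : ∀ x, HasDerivAt (fun x => P x / J) (f x / J) x := fun x => (hPd x).div_const J
  have hs : ContDiff ℝ ∞ fun x => P x / J := (contDiff_integral hfs).div_const J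
  have hmono : Monotone fun x => P x / J := monotone_of_deriv_nonneg
    (hs.differentiable (by simp)) fun x => by rw [(hd x).deriv]; exact div_nonneg f.nonneg hJ0.le
  have h0 : ∀ x ≤ δ, P x / J = 0 := by
    intro x hx
    have : P x = 0 := by
      refine intervalIntegral.integral_zero_ae (Filter.Eventually.of_forall fun t ht => ?_)
      have ht' : t ≤ δ := by
        rcases Set.mem_uIoc.1 ht with h | h
        · exact h.2.trans hx
        · exact h.2.trans hδ0.le
      by_contra hne
      exact absurd (hsupp hne).1 (not_lt.2 ht')
    rw [this, zero_div]
  have h1 : ∀ x, 1 - δ ≤ x → P x / J = 1 := by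
    intro x hx
    have : P x = J := intervalIntegral.integral_eq_integral_of_support_subset fun t ht =>
      ⟨hδ0.trans (hsupp ht).1, (hsupp ht).2.le.trans hx⟩
    rw [this, div_self hJ0.ne']
  have hderiv : ∀ x, 0 ≤ deriv (fun x => P x / J) x ∧ deriv (fun x => P x / J) x ≤ 1 + ε := by
    intro x
    rw [(hd x).deriv]
    refine ⟨div_nonneg f.nonneg hJ0.le, ?_⟩
    rw [div_le_iff₀ hJ0]
    nlinarith [f.le_one (x := x)]
  refine ⟨δ, fun x => P x / J, hδ0, by linarith, hs, h0, h1, fun x => ⟨?_, ?_⟩, hderiv,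
    fun x hx => ?_⟩
  · rw [← h0 (min x 0) ((min_le_right _ _).trans hδ0.le)]
    exact hmono (min_le_left _ _)
  · rw [← h1 (max x 1) (le_trans (by linarith) (le_max_right _ _))]
    exact hmono (le_max_left _ _)
  · have hm : Monotone fun x => (1 + ε) * x - P x / J := by
      have hd' : ∀ x, HasDerivAt (fun x => (1 + ε) * x - P x / J) ((1 + ε) * 1 - f x / J) x :=
        fun x => ((hasDerivAt_id x).const_mul (1 + ε)).sub (hd x)
      refine monotone_of_deriv_nonneg (fun x => (hd' x).differentiableAt) fun x => ?_
      have h2 := (hderiv x).2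
      rw [(hd x).deriv] at h2
      rw [(hd' x).deriv]
      linarith
    have := hm hx
    simp only [h0 0 hδ0.le] at this
    linarith

end RadialCutoff

/-! ### Almost area-preserving maps between domains -/

section Transfer

/-- The Jacobian determinant of a planar map. -/
noncomputable def jacobian (T : ℝ × ℝ → ℝ × ℝ) (z : ℝ × ℝ) : ℝ :=
  cross (fderiv ℝ T z (1, 0)) (fderiv ℝ T z (0, 1))

/-- The Jacobian in polar coordinates. -/
theorem jacobian_mul_eq_cross {T : ℝ × ℝ → ℝ × ℝ} {c : ℝ × ℝ} {r θ : ℝ} {u v : ℝ × ℝ}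
    (hT : DifferentiableAt ℝ T (c + r • unitVec θ))
    (hu : HasDerivAt (fun s => T (c + s • unitVec θ)) u r)
    (hv : HasDerivAt (fun t => T (c + r • unitVec t)) v θ) :
    jacobian T (c + r • unitVec θ) * r = cross u v := by
  have h1 : HasDerivAt (fun s : ℝ => c + s • unitVec θ) (unitVec θ) r := by
    simpa using ((hasDerivAt_id r).smul_const (unitVec θ)).const_add c
  have h2 : HasDerivAt (fun t : ℝ => c + r • unitVec t) (r • (-Real.sin θ, Real.cos θ)) θ :=
    ((hasDerivAt_unitVec θ).const_smul r).const_add c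
  have e1 := hu.unique (hT.hasFDerivAt.comp_hasDerivAt r h1)
  have e2 := hv.unique (hT.hasFDerivAt.comp_hasDerivAt θ h2)
  rw [e1, e2, cross_map, jacobian]
  congr 1
  have := cross_unitVec_deriv θ
  simp only [cross, Prod.smul_mk, smul_eq_mul] at this ⊢
  linear_combination (-r) * this

/-- A smooth closed curve around the origin, in polar coordinates. -/
theorem hasDerivAt_smul_unitVec {G κ : ℝ → ℝ} {G' κ' t : ℝ} (hG : HasDerivAt G G' t)
    (hκ : HasDerivAt κ κ' t) : HasDerivAt (fun t => G t • unitVec (κ t))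
      (G t • κ' • (-Real.sin (κ t), Real.cos (κ t)) + G' • unitVec (κ t)) t :=
  hG.smul ((hasDerivAt_unitVec (κ t)).scomp t hκ)

namespace MarkedDomain

variable {N : ℕ} (D : MarkedDomain N)

/-- The point of the boundary seen from the center at the angle `t`. -/
noncomputable def boundaryPoint (t : ℝ) : ℝ × ℝ := D.center + D.radius t • unitVec t

theorem boundaryPoint_periodic : Function.Periodic D.boundaryPoint (2 * Real.pi) := fun t => by
  simp only [boundaryPoint, D.radius_periodic t, unitVec_add_two_pi]

variable {D}

/-- There are smooth, almost area-preserving maps between any two domains which restrict to a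
prescribed map of degree one between the boundaries. -/
theorem exists_transfer {N' : ℕ} (D : MarkedDomain N) (D' : MarkedDomain N') {κ β : ℝ → ℝ}
    (hκ : IsCircleLift κ) (hκm : Monotone κ) (hκs : ContDiff ℝ ∞ fun t => D'.radius (κ t))
    (hβ : IsCircleLift β) {ε : ℝ} (hε : 0 < ε) :
    ∃ T : ℝ × ℝ → ℝ × ℝ, ContDiff ℝ ∞ T ∧ (∀ z, T z ∈ D'.carrier) ∧
      (∀ z, |jacobian T z| ≤ 1 + ε) ∧
      ∀ t, T (D.boundaryPoint t) = D'.boundaryPoint (κ (β t)) := by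
  have hp0 : 0 < 2 * Real.pi := Real.two_pi_pos
  -- One factor each will be lost for `ψ'`, for `ψ` and for the angular density.
  obtain ⟨ε₁, hε₁, hε₁'⟩ : ∃ ε₁ : ℝ, 0 < ε₁ ∧ (1 + ε₁) ^ 3 ≤ 1 + ε := by
    have h1 : Filter.Tendsto (fun x : ℝ => (1 + x) ^ 3) (𝓝[>] 0) (𝓝 1) := by
      have : Filter.Tendsto (fun x : ℝ => (1 + x) ^ 3) (𝓝 0) (𝓝 ((1 + 0) ^ 3)) :=
        (by fun_prop : Continuous fun x : ℝ => (1 + x) ^ 3).tendsto 0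
      simpa using this.mono_left nhdsWithin_le_nhds
    obtain ⟨x, hx, hx0⟩ := ((h1.eventually (gt_mem_nhds (show (1 : ℝ) < 1 + ε by linarith))).and
      self_mem_nhdsWithin).exists
    exact ⟨x, hx0, hx.le⟩
  obtain ⟨h, hh, hhp, hh0, hhle, hhI⟩ := exists_periodic_contDiff_le hp0 D.radius_periodic
    D.continuous_radius D.radius_pos (A := 2 / (1 + ε₁)) (by
      rw [D.integral_radius_sq, div_lt_iff₀ (by linarith)]; linarith)
  obtain ⟨m, hm0, hm⟩ := hhp.exists_pos_le hp0 hh.continuous hh0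
  -- the boundary of the target, relative to its center, and its area density
  set G : ℝ → ℝ := fun t => D'.radius (κ t) with hG
  set b : ℝ → ℝ × ℝ := fun t => G t • unitVec (κ t) with hb
  have hbs : ContDiff ℝ ∞ b := hκs.smul (contDiff_unitVec.comp hκ.contDiff)
  have hκd : ∀ t, HasDerivAt κ (deriv κ t) t := fun t =>
    (hκ.contDiff.differentiable (by simp) t).hasDerivAt
  have hGd : ∀ t, HasDerivAt G (deriv G t) t := fun t =>
    (hκs.differentiable (by simp) t).hasDerivAt
  set b' : ℝ → ℝ × ℝ := fun t =>
    G t • deriv κ t • (-Real.sin (κ t), Real.cos (κ t)) + deriv G t • unitVec (κ t) with hb'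
  have hbd : ∀ t, HasDerivAt b (b' t) t := fun t => hasDerivAt_smul_unitVec (hGd t) (hκd t)
  have hbp : Function.Periodic b (2 * Real.pi) := fun t => by
    simp only [hb, hG, hκ.add_two_pi, D'.radius_periodic (κ t), unitVec_add_two_pi]
  set w : ℝ → ℝ := fun t => G t ^ 2 * deriv κ t with hw
  have hcross : ∀ t, cross (b t) (b' t) = w t := fun t => by
    have := cross_unitVec_deriv (κ t)
    simp only [hb, hb', hw, cross, Prod.smul_fst, Prod.smul_snd, Prod.fst_add, Prod.snd_add,
      smul_eq_mul] at this ⊢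
    linear_combination (G t ^ 2 * deriv κ t) * this
  have hκ's : ContDiff ℝ ∞ (deriv κ) := (contDiff_infty_iff_deriv.1 hκ.contDiff).2
  have hws : ContDiff ℝ ∞ w := (hκs.pow 2).mul hκ's
  have hwp : Function.Periodic w (2 * Real.pi) := fun t => by
    have h1 : deriv κ (t + 2 * Real.pi) = deriv κ t := by
      rw [← deriv_comp_add_const, show (fun x => κ (x + 2 * Real.pi)) = fun x => κ x + 2 * Real.pi
        from funext hκ.add_two_pi, deriv_add_const]
    simp only [hw, hG, hκ.add_two_pi, D'.radius_periodic (κ t), h1]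
  have hw0 : ∀ t, 0 ≤ w t := fun t => mul_nonneg (sq_nonneg _) hκm.deriv_nonneg
  have hwI : ∫ t in (0 : ℝ)..(2 * Real.pi), w t = 2 := by
    have h1 := intervalIntegral.integral_comp_mul_deriv (a := 0) (b := 2 * Real.pi)
      (g := fun s => D'.radius s ^ 2) (f := κ) (f' := deriv κ) (fun t _ => hκd t)
      hκ's.continuous.continuousOn (D'.continuous_radius.pow 2)
    have h2 : κ (2 * Real.pi) = κ 0 + 2 * Real.pi := by
      rw [← hκ.add_two_pi, zero_add]
    have hper : Function.Periodic (fun s => D'.radius s ^ 2) (2 * Real.pi) := fun s => by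
      simp only [D'.radius_periodic s]
    have h3 := hper.intervalIntegral_add_eq (κ 0) 0
    rw [zero_add, D'.integral_radius_sq] at h3
    rw [h2, h3] at h1
    exact h1
  -- The total density of the target is `2` and that of `h²` exceeds `2 / (1 + ε₁)`, both because
  -- the areas are one. So `τ` can transport angles without multiplying the sector area element by
  -- more than `1 + ε₁`.
  obtain ⟨τ, hτ, hτd⟩ := exists_isCircleLift_density_le hws (hh.pow 2) hwp
    (fun t => by simp only [hhp t]) hw0 (fun t => pow_pos (hh0 t) 2) (μ := 1 + ε₁) (by linarith)
    (by
      rw [hwI]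
      rw [div_lt_iff₀ (by linarith)] at hhI
      linarith)
  obtain ⟨δ, ψ, hδ0, hδ1, hψ, hψ0, hψ1, hψI, hψd, hψle⟩ := exists_radial_cutoff hε₁
  set χ : ℝ → ℝ := fun ρ => Real.smoothTransition ((ρ - (1 - δ / 2)) / (δ / 2)) with hχ
  have hχs : ContDiff ℝ ∞ χ := (Real.smoothTransition.contDiff (n := ⊤)).comp (by fun_prop)
  have hχ0 : ∀ ρ ≤ 1 - δ / 2, χ ρ = 0 := fun ρ hρ =>
    Real.smoothTransition.zero_of_nonpos (div_nonpos_of_nonpos_of_nonneg (by linarith) (by linarith))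
  have hχ1 : ∀ ρ, 1 ≤ ρ → χ ρ = 1 := fun ρ hρ =>
    Real.smoothTransition.one_of_one_le (by rw [le_div_iff₀ (by linarith)]; linarith)
  -- The boundary parameter is `τ t` inside, to control area, and `β t` from the curve `r = h t`
  -- outwards, as prescribed. The change happens for `r / h t` between `1 - δ / 2` and `1`, where
  -- `ψ` is already `1`.
  let H : ℝ → ℝ → ℝ := fun r t => τ t + χ (r / h t) * (β t - τ t)
  let S : ℝ → ℝ → ℝ × ℝ := fun r t => D'.center + ψ (r / h t) • b (H r t)
  have hρs : ContDiff ℝ ∞ fun q : ℝ × ℝ => q.1 / h q.2 :=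
    contDiff_fst.div (hh.comp contDiff_snd) fun q => (hh0 q.2).ne'
  have hHs : ContDiff ℝ ∞ fun q : ℝ × ℝ => H q.1 q.2 :=
    (hτ.contDiff.comp contDiff_snd).add
      ((hχs.comp hρs).mul ((hβ.contDiff.comp contDiff_snd).sub (hτ.contDiff.comp contDiff_snd)))
  have hSs : ContDiff ℝ ∞ fun q : ℝ × ℝ => S q.1 q.2 :=
    contDiff_const.add ((hψ.comp hρs).smul (hbs.comp hHs))
  have hSp : ∀ r, Function.Periodic (S r) (2 * Real.pi) := fun r t => by
    have : H r (t + 2 * Real.pi) = H r t + 2 * Real.pi := by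
      simp only [H, hhp t, hτ.add_two_pi, hβ.add_two_pi]; ring
    simp only [S, this, hhp t, hbp (H r t)]
  have hSc : ∀ r t, S r t ∈ D'.carrier := fun r t => by
    have h1 := hψI (r / h t)
    have h2 : 0 < G (H r t) := D'.radius_pos _
    simp only [S, hb, smul_smul]
    rw [D'.smul_mem_carrier_iff (mul_nonneg h1.1 h2.le)]
    exact mul_le_of_le_one_left h2.le h1.2
  let T : ℝ × ℝ → ℝ × ℝ := fun z => ofPolar S (z - D.center)
  have hTS : ∀ {r : ℝ}, 0 < r → ∀ t, T (D.center + r • unitVec t) = S r t := fun hr t => by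
    simp only [T, add_sub_cancel_left]
    exact ofPolar_smul_unitVec hSp hr t
  have hT0 : ∀ᶠ z in 𝓝 D.center, T z = D'.center := by
    have hlim : Filter.Tendsto (fun z => polarRadius (z - D.center)) (𝓝 D.center) (𝓝 0) := by
      have h1 : polarRadius (D.center - D.center) = 0 := by simp [polarRadius]
      have h2 : Continuous fun z => polarRadius (z - D.center) :=
        continuous_polarRadius.comp (continuous_id.sub continuous_const)
      simpa only [h1] using h2.tendsto D.center
    filter_upwards [hlim.eventually (gt_mem_nhds (mul_pos hδ0 hm0))] with z hz
    have h1 : ψ (polarRadius (z - D.center) / h (polarAngle 0 (z - D.center))) = 0 := by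
      refine hψ0 _ ?_
      rw [div_le_iff₀ (hh0 _)]
      exact hz.le.trans (mul_le_mul_of_nonneg_left (hm _) hδ0.le)
    simp only [T, ofPolar, S, h1, zero_smul, add_zero]
  have hcov : ∀ z, z ≠ D.center → ∃ r t : ℝ, 0 < r ∧ z = D.center + r • unitVec t := fun z hz =>
    ⟨_, polarAngle 0 (z - D.center), polarRadius_pos (sub_ne_zero.2 hz), by
      rw [polar_decomp, add_sub_cancel]⟩
  have hTs : ContDiff ℝ ∞ T := by
    rw [contDiff_iff_contDiffAt]
    intro z
    by_cases hz : z = D.center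
    · rw [hz]
      exact contDiffAt_const.congr_of_eventuallyEq hT0
    · obtain ⟨r, t, hr, rfl⟩ := hcov z hz
      refine ContDiffAt.comp (g := ofPolar S) (f := fun z => z - D.center) _ ?_ (by fun_prop)
      rw [add_sub_cancel_left]
      exact contDiffAt_ofPolar hSp hr hSs.contDiffAt
  refine ⟨T, hTs, fun z => hSc _ _, fun z => ?_, fun t => ?_⟩
  · by_cases hz : z = D.center
    · have h1 : fderiv ℝ T z = 0 := by
        rw [hz, Filter.EventuallyEq.fderiv_eq (f := fun _ => D'.center) hT0]
        simp
      simp only [jacobian, h1]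
      simp [cross]; linarith
    obtain ⟨r, t, hr, rfl⟩ := hcov z hz
    have hT : DifferentiableAt ℝ T (D.center + r • unitVec t) := hTs.differentiable (by simp) _
    have hr' : ∀ᶠ s in 𝓝 r, 0 < s := lt_mem_nhds hr
    have hρc : Continuous fun s => s / h t := continuous_id.div_const _
    have hρc' : Continuous fun t' => r / h t' :=
      continuous_const.div hh.continuous fun t' => (hh0 t').ne'
    have hρd : HasDerivAt (fun s => s / h t) (1 / h t) r := (hasDerivAt_id r).div_const _
    -- Below this threshold only `τ` acts; otherwise `ψ` is locally `1` and the map takes values in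
    -- the boundary curve. Both descriptions hold on open sets, so derivatives may be computed from
    -- them.
    by_cases hρ : r / h t < 1 - δ / 2
    · obtain ⟨y, hy⟩ : ∃ y, HasDerivAt (fun t' => r / h t') y t :=
        ⟨_, ((differentiableAt_const r).div (hh.differentiable (by simp) t)
          (hh0 t).ne').hasDerivAt⟩
      have hψρ := (hψ.differentiable (by simp) (r / h t)).hasDerivAt
      have hτt : HasDerivAt τ (deriv τ t) t := (hτ.contDiff.differentiable (by simp) t).hasDerivAt
      have hu : HasDerivAt (fun s => T (D.center + s • unitVec t))
          ((deriv ψ (r / h t) * (1 / h t)) • b (τ t)) r := by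
        refine HasDerivAt.congr_of_eventuallyEq
          (((hψρ.comp r hρd).smul_const (b (τ t))).const_add D'.center) ?_
        filter_upwards [hr', hρc.continuousAt.eventually (gt_mem_nhds hρ)] with s hs hs'
        rw [hTS hs]
        simp only [S, H, hχ0 _ hs'.le, zero_mul, add_zero, Function.comp_apply]
      have hv : HasDerivAt (fun t' => T (D.center + r • unitVec t'))
          (ψ (r / h t) • deriv τ t • b' (τ t) + (deriv ψ (r / h t) * y) • b (τ t)) t := by
        refine HasDerivAt.congr_of_eventuallyEq
          (((hψρ.comp t hy).smul ((hbd (τ t)).scomp t hτt)).const_add D'.center) ?_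
        filter_upwards [hρc'.continuousAt.eventually (gt_mem_nhds hρ)] with t' ht'
        rw [hTS hr]
        simp only [S, H, hχ0 _ ht'.le, zero_mul, add_zero]
        rfl
      have key := jacobian_mul_eq_cross hT hu hv
      set J := jacobian T (D.center + r • unitVec t) with hJ
      set ρ := r / h t with hρdef
      have hrρ : r = ρ * h t := by rw [hρdef, div_mul_cancel₀ _ (hh0 t).ne']
      have hρ0 : 0 < ρ := div_pos hr (hh0 t)
      -- The dependence of `r / h t` on the angle only adds a multiple of the radial derivative,
      -- which the cross product kills.
      have hkey : J * r = deriv ψ ρ * ψ ρ * (w (τ t) * deriv τ t) / h t := by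
        rw [key, ← hcross (τ t)]
        simp only [cross, Prod.smul_fst, Prod.smul_snd, Prod.fst_add, Prod.snd_add, smul_eq_mul]
        ring
      have hW0 : 0 ≤ w (τ t) * deriv τ t := mul_nonneg (hw0 _) (hτd t).1
      have h1 : 0 ≤ J * r := by
        rw [hkey]
        exact div_nonneg (mul_nonneg (mul_nonneg (hψd _).1 (hψI _).1) hW0) (hh0 t).le
      have h2 : J * r ≤ (1 + ε₁) ^ 3 * r := by
        rw [hkey, div_le_iff₀ (hh0 t)]
        calc deriv ψ ρ * ψ ρ * (w (τ t) * deriv τ t)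
            ≤ ((1 + ε₁) * ((1 + ε₁) * ρ)) * ((1 + ε₁) * h t ^ 2) := by
              refine mul_le_mul (mul_le_mul (hψd _).2 (hψle ρ hρ0.le) (hψI _).1 (by linarith))
                (hτd t).2 hW0 (by positivity)
          _ = (1 + ε₁) ^ 3 * r * h t := by rw [hrρ]; ring
      have h3 : 0 ≤ J := nonneg_of_mul_nonneg_left h1 hr
      rw [abs_of_nonneg h3]
      exact (le_of_mul_le_mul_right h2 hr).trans hε₁'
    · have hρ' : 1 - δ < r / h t := by linarith
      have hH1 : HasDerivAt (fun s => H s t) (deriv (fun s => H s t) r) r :=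
        ((hHs.comp (contDiff_id.prodMk contDiff_const)).differentiable
          (by simp) r : DifferentiableAt ℝ (fun s => H s t) r).hasDerivAt
      have hH2 : HasDerivAt (fun t' => H r t') (deriv (fun t' => H r t') t) t :=
        ((hHs.comp (contDiff_const.prodMk contDiff_id)).differentiable
          (by simp) t : DifferentiableAt ℝ (fun t' => H r t') t).hasDerivAt
      have hu : HasDerivAt (fun s => T (D.center + s • unitVec t))
          (deriv (fun s => H s t) r • b' (H r t)) r := by
        refine HasDerivAt.congr_of_eventuallyEq
          (((hbd (H r t)).scomp r hH1).const_add D'.center) ?_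
        filter_upwards [hr', hρc.continuousAt.eventually (lt_mem_nhds hρ')] with s hs hs'
        rw [hTS hs]
        simp only [S, hψ1 _ hs'.le, one_smul, Function.comp_apply]
      have hv : HasDerivAt (fun t' => T (D.center + r • unitVec t'))
          (deriv (fun t' => H r t') t • b' (H r t)) t := by
        refine HasDerivAt.congr_of_eventuallyEq
          (((hbd (H r t)).scomp t hH2).const_add D'.center) ?_
        filter_upwards [hρc'.continuousAt.eventually (lt_mem_nhds hρ')] with t' ht'
        rw [hTS hr]
        simp only [S, hψ1 _ ht'.le, one_smul, Function.comp_apply]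
      have key := jacobian_mul_eq_cross hT hu hv
      -- Both partial derivatives are multiples of the tangent of one curve.
      rw [cross_smul_smul] at key
      rw [(mul_eq_zero.1 key).resolve_right hr.ne', abs_zero]
      linarith
  -- As `h` is at most the radius, the boundary lies in the region where `ψ = 1` and the parameter
  -- is exactly `β`.
  · have h1 : 1 ≤ D.radius t / h t := (one_le_div (hh0 t)).2 (hhle t)
    rw [boundaryPoint, hTS (D.radius_pos t)]
    simp only [S, H, hψ1 _ (show 1 - δ ≤ D.radius t / h t by linarith), hχ1 _ h1, one_smul, one_mul,
      add_sub_cancel]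
    rfl

end MarkedDomain

end Transfer

/-! ### The Poisson bracket under planar maps -/

section Bracket

variable {E : Type*} [NormedAddCommGroup E] [NormedSpace ℝ E] {M : Type*} [TopologicalSpace M]
  [ChartedSpace E M]

theorem SymplecticForm.form_add_smul (σ : SymplecticForm E M) (x : M)
    (a b : ℝ) (u v w : TangentSpace 𝓘(ℝ, E) x) :
    σ.form x ![a • u + b • v, w] = a * σ.form x ![u, w] + b * σ.form x ![v, w] := by
  have h1 := (σ.form x).toMultilinearMap.cons_add ![w] (a • u) (b • v)
  have h2 := (σ.form x).toMultilinearMap.cons_smul ![w] a u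
  have h3 := (σ.form x).toMultilinearMap.cons_smul ![w] b v
  exact h1.trans (congrArg₂ (· + ·) h2 h3)

theorem SymplecticForm.form_self (σ : SymplecticForm E M) (x : M)
    (u : TangentSpace 𝓘(ℝ, E) x) : σ.form x ![u, u] = 0 :=
  (σ.form x).map_eq_zero_of_eq ![u, u] (i := 0) (j := 1) rfl (by decide)

theorem SymplecticForm.form_swap (σ : SymplecticForm E M) (x : M)
    (u v : TangentSpace 𝓘(ℝ, E) x) : σ.form x ![u, v] = -σ.form x ![v, u] := by
  have := (σ.form x).toAlternatingMap.map_swap ![v, u] (i := 0) (j := 1) (by decide)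
  have e : ![v, u] ∘ Equiv.swap (0 : Fin 2) 1 = ![u, v] := by
    funext i; fin_cases i <;> rfl
  rw [e] at this
  exact this

/-- The differential of a real function, as a linear form on the tangent space. -/
noncomputable def realDifferential (F : M → ℝ) (x : M) : TangentSpace 𝓘(ℝ, E) x →L[ℝ] ℝ :=
  mfderiv 𝓘(ℝ, E) 𝓘(ℝ, ℝ) F x

theorem realDifferential_fst {Φ : M → ℝ × ℝ} {x : M} (h : MDifferentiableAt 𝓘(ℝ, E) 𝓘(ℝ, ℝ × ℝ) Φ x)
    (w : TangentSpace 𝓘(ℝ, E) x) :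
    realDifferential (E := E) (fun x => (Φ x).1) x w =
      (mfderiv 𝓘(ℝ, E) 𝓘(ℝ, ℝ × ℝ) Φ x w : ℝ × ℝ).1 := by
  have := ((ContinuousLinearMap.fst ℝ ℝ ℝ).hasMFDerivAt (x := Φ x)).comp x h.hasMFDerivAt
  change (mfderiv 𝓘(ℝ, E) 𝓘(ℝ, ℝ) ((ContinuousLinearMap.fst ℝ ℝ ℝ) ∘ Φ) x w : ℝ) = _
  rw [this.mfderiv]
  rfl

theorem realDifferential_snd {Φ : M → ℝ × ℝ} {x : M} (h : MDifferentiableAt 𝓘(ℝ, E) 𝓘(ℝ, ℝ × ℝ) Φ x)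
    (w : TangentSpace 𝓘(ℝ, E) x) :
    realDifferential (E := E) (fun x => (Φ x).2) x w =
      (mfderiv 𝓘(ℝ, E) 𝓘(ℝ, ℝ × ℝ) Φ x w : ℝ × ℝ).2 := by
  have := ((ContinuousLinearMap.snd ℝ ℝ ℝ).hasMFDerivAt (x := Φ x)).comp x h.hasMFDerivAt
  change (mfderiv 𝓘(ℝ, E) 𝓘(ℝ, ℝ) ((ContinuousLinearMap.snd ℝ ℝ ℝ) ∘ Φ) x w : ℝ) = _
  rw [this.mfderiv]
  rfl

theorem mfderiv_comp_apply_of_fderiv {F F' : Type*} [NormedAddCommGroup F] [NormedSpace ℝ F]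
    [NormedAddCommGroup F'] [NormedSpace ℝ F'] {Φ : M → F} {T : F → F'} {x : M}
    (hT : DifferentiableAt ℝ T (Φ x)) (h : MDifferentiableAt 𝓘(ℝ, E) 𝓘(ℝ, F) Φ x)
    (w : TangentSpace 𝓘(ℝ, E) x) :
    (mfderiv 𝓘(ℝ, E) 𝓘(ℝ, F') (fun x => T (Φ x)) x w : F') =
      fderiv ℝ T (Φ x) (mfderiv 𝓘(ℝ, E) 𝓘(ℝ, F) Φ x w : F) := by
  have := (hT.hasFDerivAt.hasMFDerivAt).comp x h.hasMFDerivAt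
  change (mfderiv 𝓘(ℝ, E) 𝓘(ℝ, F') (T ∘ Φ) x w : F') = _
  rw [this.mfderiv]
  rfl

variable [FiniteDimensional ℝ E]

theorem SymplecticForm.form_hamiltonianVectorField (σ : SymplecticForm E M) (F : M → ℝ) (x : M)
    (w : TangentSpace 𝓘(ℝ, E) x) :
    σ.form x ![σ.hamiltonianVectorField F x, w] = realDifferential (E := E) F x w :=
  (σ.exists_unique_dual x (mfderiv 𝓘(ℝ, E) 𝓘(ℝ, ℝ) F x)).choose_spec.1 w

theorem SymplecticForm.eq_hamiltonianVectorField (σ : SymplecticForm E M) (F : M → ℝ) (x : M)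
    {v : TangentSpace 𝓘(ℝ, E) x}
    (hv : ∀ w : TangentSpace 𝓘(ℝ, E) x, σ.form x ![v, w] = realDifferential (E := E) F x w) :
    σ.hamiltonianVectorField F x = v :=
  (σ.exists_unique_dual x _).unique (σ.form_hamiltonianVectorField F x) hv

theorem SymplecticForm.poissonBracket_eq_form (σ : SymplecticForm E M) (F G : M → ℝ) (x : M) :
    σ.poissonBracket F G x =
      σ.form x ![σ.hamiltonianVectorField G x, σ.hamiltonianVectorField F x] :=
  (σ.form_hamiltonianVectorField G x _).symm

/-- If the differentials of `F', G'` are combinations of those of `F, G`, their Poisson bracket is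
multiplied by the determinant. -/
theorem SymplecticForm.poissonBracket_of_mfderiv_eq (σ : SymplecticForm E M) {F G F' G' : M → ℝ}
    {x : M} {a b c d : ℝ}
    (hF : ∀ w : TangentSpace 𝓘(ℝ, E) x, realDifferential (E := E) F' x w =
      a * realDifferential (E := E) F x w + b * realDifferential (E := E) G x w)
    (hG : ∀ w : TangentSpace 𝓘(ℝ, E) x, realDifferential (E := E) G' x w =
      c * realDifferential (E := E) F x w + d * realDifferential (E := E) G x w) :
    σ.poissonBracket F' G' x = (a * d - b * c) * σ.poissonBracket F G x := by
  have hF' : σ.hamiltonianVectorField F' x =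
      a • σ.hamiltonianVectorField F x + b • σ.hamiltonianVectorField G x := by
    refine σ.eq_hamiltonianVectorField F' x fun w => ?_
    rw [form_add_smul, form_hamiltonianVectorField, form_hamiltonianVectorField, hF]
  have hG' : σ.hamiltonianVectorField G' x =
      c • σ.hamiltonianVectorField F x + d • σ.hamiltonianVectorField G x := by
    refine σ.eq_hamiltonianVectorField G' x fun w => ?_
    rw [form_add_smul, form_hamiltonianVectorField, form_hamiltonianVectorField, hG]
  rw [poissonBracket_eq_form, poissonBracket_eq_form, hF', hG', form_add_smul,
    form_swap _ _ _ (a • _ + b • _), form_swap _ _ (σ.hamiltonianVectorField G x) (a • _ + b • _),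
    form_add_smul, form_add_smul, form_self, form_self,
    form_swap _ _ (σ.hamiltonianVectorField F x) (σ.hamiltonianVectorField G x)]
  ring

/-- Composition with a planar map multiplies the Poisson bracket by the Jacobian. -/
theorem SymplecticForm.poissonBracket_comp (σ : SymplecticForm E M) {Φ : M → ℝ × ℝ}
    {T : ℝ × ℝ → ℝ × ℝ} {x : M} (hT : DifferentiableAt ℝ T (Φ x))
    (h : MDifferentiableAt 𝓘(ℝ, E) 𝓘(ℝ, ℝ × ℝ) Φ x) :
    σ.poissonBracket (fun x => (T (Φ x)).1) (fun x => (T (Φ x)).2) x =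
      jacobian T (Φ x) * σ.poissonBracket (fun x => (Φ x).1) (fun x => (Φ x).2) x := by
  have h' : MDifferentiableAt 𝓘(ℝ, E) 𝓘(ℝ, ℝ × ℝ) (fun x => T (Φ x)) x :=
    hT.mdifferentiableAt.comp x h
  have hL : ∀ u : ℝ × ℝ, fderiv ℝ T (Φ x) u =
      u.1 • fderiv ℝ T (Φ x) (1, 0) + u.2 • fderiv ℝ T (Φ x) (0, 1) := fun u => by
    rw [← map_smul, ← map_smul, ← map_add]; simp
  rw [σ.poissonBracket_of_mfderiv_eq (F := fun x => (Φ x).1) (G := fun x => (Φ x).2)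
    (a := (fderiv ℝ T (Φ x) (1, 0)).1) (b := (fderiv ℝ T (Φ x) (0, 1)).1)
    (c := (fderiv ℝ T (Φ x) (1, 0)).2) (d := (fderiv ℝ T (Φ x) (0, 1)).2)]
  · simp only [jacobian, cross]; ring
  · intro w
    rw [realDifferential_fst h', realDifferential_fst h, realDifferential_snd h,
      mfderiv_comp_apply_of_fderiv hT h]
    exact (congrArg Prod.fst (hL _)).trans (congrArg₂ (· + ·) (mul_comm _ _) (mul_comm _ _))
  · intro w
    rw [realDifferential_snd h', realDifferential_fst h, realDifferential_snd h,
      mfderiv_comp_apply_of_fderiv hT h]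
    exact (congrArg Prod.snd (hL _)).trans (congrArg₂ (· + ·) (mul_comm _ _) (mul_comm _ _))

theorem SymplecticForm.poissonBracket_congr (σ : SymplecticForm E M) {Φ Ψ : M → ℝ × ℝ} {x : M}
    (h : Φ =ᶠ[𝓝 x] Ψ) : σ.poissonBracket (fun x => (Φ x).1) (fun x => (Φ x).2) x =
      σ.poissonBracket (fun x => (Ψ x).1) (fun x => (Ψ x).2) x := by
  have h1 : realDifferential (E := E) (fun x => (Φ x).1) x =
      realDifferential (fun x => (Ψ x).1) x :=
    Filter.EventuallyEq.mfderiv_eq (h.fun_comp Prod.fst)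
  have h2 : realDifferential (E := E) (fun x => (Φ x).2) x =
      realDifferential (fun x => (Ψ x).2) x :=
    Filter.EventuallyEq.mfderiv_eq (h.fun_comp Prod.snd)
  rw [σ.poissonBracket_of_mfderiv_eq (F := fun x => (Ψ x).1) (G := fun x => (Ψ x).2)
    (a := 1) (b := 0) (c := 0) (d := 1)]
  · ring
  · intro w; rw [h1]; ring
  · intro w; rw [h2]; ring

/-- The components of a map into a curve Poisson commute. -/
theorem SymplecticForm.poissonBracket_curve (σ : SymplecticForm E M) {b : ℝ → ℝ × ℝ} {u : M → ℝ}
    {x : M} (hb : DifferentiableAt ℝ b (u x)) (hu : MDifferentiableAt 𝓘(ℝ, E) 𝓘(ℝ, ℝ) u x) :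
    σ.poissonBracket (fun x => (b (u x)).1) (fun x => (b (u x)).2) x = 0 := by
  have h' : MDifferentiableAt 𝓘(ℝ, E) 𝓘(ℝ, ℝ × ℝ) (fun x => b (u x)) x :=
    hb.mdifferentiableAt.comp x hu
  have hL : ∀ r : ℝ, fderiv ℝ b (u x) r = r • fderiv ℝ b (u x) 1 := fun r => by
    rw [← map_smul]; simp
  rw [σ.poissonBracket_of_mfderiv_eq (F := u) (G := u) (a := (fderiv ℝ b (u x) 1).1) (b := 0)
    (c := (fderiv ℝ b (u x) 1).2) (d := 0)]
  · ring
  · intro w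
    rw [realDifferential_fst h', mfderiv_comp_apply_of_fderiv hb hu, zero_mul, add_zero]
    exact (congrArg Prod.fst (hL _)).trans (mul_comm _ _)
  · intro w
    rw [realDifferential_snd h', mfderiv_comp_apply_of_fderiv hb hu, zero_mul, add_zero]
    exact (congrArg Prod.snd (hL _)).trans (mul_comm _ _)

end Bracket

/-! ### Local boundedness of the bracket -/

section BracketBound

/-- Nondegeneracy makes the curried form injective, hence bounded below in finite dimension, and
this persists under small perturbations. It controls the Hamiltonian vector field, which is chosen
point by point, uniformly near a point. -/
theorem exists_lower_bound_of_nondegenerate {E : Type*} [NormedAddCommGroup E] [NormedSpace ℝ E]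
    [FiniteDimensional ℝ E] {Ω : E → E [⋀^Fin 2]→L[ℝ] ℝ} {y₀ : E} (hΩ : ContinuousAt Ω y₀)
    (h0 : ∀ v, (∀ w, Ω y₀ ![v, w] = 0) → v = 0) :
    ∃ c : ℝ, 0 < c ∧ ∀ᶠ y in 𝓝 y₀, ∀ (v : E) (K : ℝ), 0 ≤ K →
      (∀ w, |Ω y ![v, w]| ≤ K * ‖w‖) → c * ‖v‖ ≤ K := by
  let J : (E [⋀^Fin 2]→L[ℝ] ℝ) →ₗᵢ[ℝ] ContinuousMultilinearMap ℝ (fun _ : Fin 2 => E) ℝ :=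
    ContinuousAlternatingMap.toContinuousMultilinearMapLI
  let B : E → (E →L[ℝ] ContinuousMultilinearMap ℝ (fun _ : Fin 1 => E) ℝ) := fun y =>
    continuousMultilinearCurryLeftEquiv ℝ (fun _ : Fin 2 => E) ℝ
      (J (Ω y))
  have hB : Filter.Tendsto B (𝓝 y₀) (𝓝 (B y₀)) :=
    (continuousMultilinearCurryLeftEquiv ℝ (fun _ : Fin 2 => E) ℝ).continuous.continuousAt.comp
      (J.continuous.continuousAt.comp hΩ)
  have hBapp : ∀ y v (m : Fin 1 → E), B y v m = Ω y ![v, m 0] := by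
    intro y v m
    change Ω y (Fin.cons v m) = _
    congr 1
    funext i
    fin_cases i <;> rfl
  have hker : LinearMap.ker (B y₀ : E →ₗ[ℝ] ContinuousMultilinearMap ℝ (fun _ : Fin 1 => E) ℝ) = ⊥ := by
    rw [LinearMap.ker_eq_bot']
    intro v hv
    refine h0 v fun w => ?_
    have h1 : B y₀ v = 0 := hv
    have h2 := hBapp y₀ v fun _ => w
    rw [h1] at h2
    exact h2.symm
  obtain ⟨C, hC0, hC⟩ := LinearMap.exists_antilipschitzWith _ hker
  have hC' : ∀ v, ‖v‖ ≤ C * ‖B y₀ v‖ := fun v => hC.le_mul_norm (map_zero _) v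
  have hCpos : (0 : ℝ) < C := hC0
  -- At `y₀` the lower bound is `1 / C`; a perturbation of norm below half of it leaves the other
  -- half.
  refine ⟨1 / (2 * C), by positivity, ?_⟩
  have hnear : ∀ᶠ y in 𝓝 y₀, ‖B y - B y₀‖ < 1 / (2 * C) := by
    have := ((tendsto_iff_norm_sub_tendsto_zero (f := B) (b := B y₀)).1 hB).eventually
      (gt_mem_nhds (show (0 : ℝ) < 1 / (2 * C) by positivity))
    exact this
  filter_upwards [hnear] with y hy v K hK hw
  have h1 : ‖B y v‖ ≤ K := by
    refine ContinuousMultilinearMap.opNorm_le_bound hK fun m => ?_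
    rw [hBapp, Real.norm_eq_abs, Fin.prod_univ_one]
    exact hw (m 0)
  have h2 : ‖(B y - B y₀) v‖ ≤ 1 / (2 * C) * ‖v‖ :=
    ((B y - B y₀).le_opNorm v).trans (mul_le_mul_of_nonneg_right hy.le (norm_nonneg v))
  have h3 : ‖B y₀ v‖ ≤ ‖B y v‖ + ‖(B y - B y₀) v‖ := by
    have e : B y₀ v = B y v - (B y - B y₀) v := by simp
    calc ‖B y₀ v‖ = ‖B y v - (B y - B y₀) v‖ := congrArg norm e
      _ ≤ _ := norm_sub_le _ _
  have h4 := hC' v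
  have h5 : 1 / C * ‖v‖ ≤ ‖B y₀ v‖ := by
    rw [div_mul_eq_mul_div, one_mul, div_le_iff₀ hCpos]; linarith
  have h6 : 1 / C * ‖v‖ = 2 * (1 / (2 * C) * ‖v‖) := by field_simp
  linarith

variable {E : Type*} [NormedAddCommGroup E] [NormedSpace ℝ E]
  {M : Type*} [TopologicalSpace M] [ChartedSpace E M] [IsManifold 𝓘(ℝ, E) ∞ M]

theorem isInvertible_mfderiv_symm {x₀ : M} {y : E} (hy : y ∈ (extChartAt 𝓘(ℝ, E) x₀).target) :
    (mfderiv 𝓘(ℝ, E) 𝓘(ℝ, E) (extChartAt 𝓘(ℝ, E) x₀).symm y).IsInvertible := by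
  have : IsManifold 𝓘(ℝ, E) 1 M := IsManifold.of_le (n := ∞) (by simp)
  have := isInvertible_mfderivWithin_extChartAt_symm hy
  rwa [modelWithCornersSelf_coe, Set.range_id, mfderivWithin_univ] at this

theorem contDiffOn_comp_extChartAt_symm {F : M → ℝ} (hF : ContMDiff 𝓘(ℝ, E) 𝓘(ℝ, ℝ) ∞ F) (x₀ : M) :
    ContDiffOn ℝ ∞ (fun y => F ((extChartAt 𝓘(ℝ, E) x₀).symm y)) (extChartAt 𝓘(ℝ, E) x₀).target := by
  rw [← contMDiffOn_iff_contDiffOn]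
  exact hF.comp_contMDiffOn (contMDiffOn_extChartAt_symm x₀)

theorem fderiv_comp_extChartAt_symm {F : M → ℝ} (hF : ContMDiff 𝓘(ℝ, E) 𝓘(ℝ, ℝ) ∞ F) {x₀ : M} {y : E}
    (hy : y ∈ (extChartAt 𝓘(ℝ, E) x₀).target) (v : E) :
    fderiv ℝ (fun y => F ((extChartAt 𝓘(ℝ, E) x₀).symm y)) y v =
      realDifferential (E := E) F ((extChartAt 𝓘(ℝ, E) x₀).symm y)
        (mfderiv 𝓘(ℝ, E) 𝓘(ℝ, E) (extChartAt 𝓘(ℝ, E) x₀).symm y v) := by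
  have h1 : MDifferentiableAt 𝓘(ℝ, E) 𝓘(ℝ, E) (extChartAt 𝓘(ℝ, E) x₀).symm y :=
    ((contMDiffOn_extChartAt_symm (n := ∞) x₀).contMDiffAt
      ((isOpen_extChartAt_target x₀).mem_nhds hy)).mdifferentiableAt (by simp)
  have h2 : MDifferentiableAt 𝓘(ℝ, E) 𝓘(ℝ, ℝ) F ((extChartAt 𝓘(ℝ, E) x₀).symm y) :=
    (hF _).mdifferentiableAt (by simp)
  have h3 := h2.hasMFDerivAt.comp y h1.hasMFDerivAt
  rw [← mfderiv_eq_fderiv]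
  exact congrArg (fun L : E →L[ℝ] ℝ => L v) h3.mfderiv

variable [FiniteDimensional ℝ E]

/-- In a chart `X_F` solves a linear system with uniformly invertible matrix and bounded right-hand
side `dF`; it is therefore bounded, and so is `dG (X_F)`. -/
theorem SymplecticForm.exists_bracket_bound_nhds (σ : SymplecticForm E M) {F G : M → ℝ}
    (hF : ContMDiff 𝓘(ℝ, E) 𝓘(ℝ, ℝ) ∞ F) (hG : ContMDiff 𝓘(ℝ, E) 𝓘(ℝ, ℝ) ∞ G) (x₀ : M) :
    ∃ C : ℝ, ∀ᶠ x in 𝓝 x₀, |σ.poissonBracket F G x| ≤ C := by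
  set φ := extChartAt 𝓘(ℝ, E) x₀ with hφ
  set y₀ := φ x₀ with hy₀
  have hy₀t : y₀ ∈ φ.target := mem_extChartAt_target x₀
  have htn : φ.target ∈ 𝓝 y₀ := (isOpen_extChartAt_target x₀).mem_nhds hy₀t
  have hform : ∀ y ∈ φ.target, ∀ v w : E, formInChart σ.form x₀ y ![v, w] =
      σ.form (φ.symm y) ![mfderiv 𝓘(ℝ, E) 𝓘(ℝ, E) φ.symm y v,
        mfderiv 𝓘(ℝ, E) 𝓘(ℝ, E) φ.symm y w] := by
    intro y hy v w
    change σ.form (φ.symm y) _ = _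
    congr 1
    funext i
    fin_cases i <;> rfl
  have hcont : ContinuousAt (formInChart σ.form x₀) y₀ :=
    (σ.smooth x₀).continuousOn.continuousAt htn
  obtain ⟨c, hc, hlow⟩ := exists_lower_bound_of_nondegenerate hcont (fun v hv => by
    have hinv := isInvertible_mfderiv_symm hy₀t
    have : mfderiv 𝓘(ℝ, E) 𝓘(ℝ, E) φ.symm y₀ v = 0 := by
      refine σ.nondegenerate _ _ fun w => ?_
      obtain ⟨w', rfl⟩ := hinv.surjective w
      exact (hform y₀ hy₀t v w').symm.trans (hv w')
    exact hinv.injective (this.trans (map_zero _).symm))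
  have hFd : ContinuousAt (fderiv ℝ fun y => F (φ.symm y)) y₀ :=
    ((contDiffOn_comp_extChartAt_symm hF x₀).contDiffAt htn).fderiv_right (m := 0) (by simp)
      |>.continuousAt
  have hGd : ContinuousAt (fderiv ℝ fun y => G (φ.symm y)) y₀ :=
    ((contDiffOn_comp_extChartAt_symm hG x₀).contDiffAt htn).fderiv_right (m := 0) (by simp)
      |>.continuousAt
  set A := ‖fderiv ℝ (fun y => F (φ.symm y)) y₀‖ + 1 with hA
  set B := ‖fderiv ℝ (fun y => G (φ.symm y)) y₀‖ + 1 with hB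
  have hA0 : 0 < A := by positivity
  have hB0 : 0 < B := by positivity
  have hFb : ∀ᶠ y in 𝓝 y₀, ‖fderiv ℝ (fun y => F (φ.symm y)) y‖ < A :=
    hFd.norm.eventually (gt_mem_nhds (lt_add_one _))
  have hGb : ∀ᶠ y in 𝓝 y₀, ‖fderiv ℝ (fun y => G (φ.symm y)) y‖ < B :=
    hGd.norm.eventually (gt_mem_nhds (lt_add_one _))
  refine ⟨B * (A / c), ?_⟩
  have hφc : Filter.Tendsto φ (𝓝 x₀) (𝓝 y₀) := continuousAt_extChartAt x₀
  filter_upwards [hφc.eventually hlow, hφc.eventually hFb, hφc.eventually hGb,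
    extChartAt_source_mem_nhds (I := 𝓘(ℝ, E)) x₀] with x h1 h2 h3 hx
  have hyt : φ x ∈ φ.target := φ.map_source hx
  have hxy : φ.symm (φ x) = x := φ.left_inv hx
  rw [← hxy]
  generalize φ x = y at h1 h2 h3 hyt
  obtain ⟨ξ, hξ⟩ : ∃ ξ : E, mfderiv 𝓘(ℝ, E) 𝓘(ℝ, E) φ.symm y ξ =
      σ.hamiltonianVectorField F (φ.symm y) := (isInvertible_mfderiv_symm hyt).surjective _
  have hK : ∀ w, |formInChart σ.form x₀ y ![ξ, w]| ≤ A * ‖w‖ := by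
    intro w
    have e : formInChart σ.form x₀ y ![ξ, w] = fderiv ℝ (fun y => F (φ.symm y)) y w := by
      rw [hform y hyt, hξ, σ.form_hamiltonianVectorField]
      exact (fderiv_comp_extChartAt_symm hF hyt w).symm
    rw [e, ← Real.norm_eq_abs]
    exact (ContinuousLinearMap.le_opNorm _ w).trans
      (mul_le_mul_of_nonneg_right h2.le (norm_nonneg w))
  have hξn := h1 ξ A hA0.le hK
  have e : σ.poissonBracket F G (φ.symm y) = fderiv ℝ (fun y => G (φ.symm y)) y ξ := by
    refine Eq.trans ?_ (fderiv_comp_extChartAt_symm hG hyt ξ).symm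
    rw [hξ]; rfl
  rw [e, ← Real.norm_eq_abs]
  refine (ContinuousLinearMap.le_opNorm _ ξ).trans
    (mul_le_mul h3.le ?_ (norm_nonneg ξ) hB0.le)
  rw [le_div_iff₀ hc]; linarith

theorem SymplecticForm.bracketNorm_ne_top (σ : SymplecticForm E M) {F G : M → ℝ}
    (hF : ContMDiff 𝓘(ℝ, E) 𝓘(ℝ, ℝ) ∞ F) (hG : ContMDiff 𝓘(ℝ, E) 𝓘(ℝ, ℝ) ∞ G) {s : Set M}
    (hs : IsCompact s) (h0 : ∀ x ∉ s, σ.poissonBracket F G x = 0) : σ.bracketNorm F G ≠ ⊤ := by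
  obtain ⟨C, hC⟩ : ∃ C : ℝ, ∀ x ∈ s, |σ.poissonBracket F G x| ≤ C := by
    refine hs.induction_on (p := fun s => ∃ C : ℝ, ∀ x ∈ s, |σ.poissonBracket F G x| ≤ C)
      ⟨0, by simp⟩ ?_ ?_ ?_
    · rintro s t hst ⟨C, hC⟩
      exact ⟨C, fun x hx => hC x (hst hx)⟩
    · rintro s t ⟨C, hC⟩ ⟨C', hC'⟩
      refine ⟨max C C', fun x hx => ?_⟩
      rcases hx with hx | hx
      · exact (hC x hx).trans (le_max_left _ _)
      · exact (hC' x hx).trans (le_max_right _ _)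
    · intro x _
      obtain ⟨C, hC⟩ := σ.exists_bracket_bound_nhds hF hG x
      exact ⟨_, mem_nhdsWithin_of_mem_nhds hC, C, fun y hy => hy⟩
  refine ne_top_of_le_ne_top (ENNReal.ofReal_ne_top (r := max C 0)) (iSup_le fun x => ?_)
  apply ENNReal.ofReal_le_ofReal
  by_cases hx : x ∈ s
  · exact (hC x hx).trans (le_max_left _ _)
  · rw [h0 x hx, abs_zero]; exact le_max_right _ _

end BracketBound

/-! ### Boundary curves with marked parameters -/

section BoundaryCurve

theorem IsCircleLift.surjective {β : ℝ → ℝ} (hβ : IsCircleLift β) : Function.Surjective β := by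
  intro y
  have hp : 0 < 2 * Real.pi := Real.two_pi_pos
  set k := ⌊(y - β 0) / (2 * Real.pi)⌋ with hk
  have h1 : k * (2 * Real.pi) ≤ y - β 0 := (le_div_iff₀ hp).1 (Int.floor_le _)
  have h2 : y - β 0 < (k + 1) * (2 * Real.pi) := (div_lt_iff₀ hp).1 (Int.lt_floor_add_one _)
  have e1 := hβ.add_int_mul 0 k
  have e2 := hβ.add_int_mul 0 (k + 1)
  push_cast at e2
  obtain ⟨x, -, hx⟩ := intermediate_value_Icc (a := 0 + k * (2 * Real.pi))
    (b := 0 + (k + 1) * (2 * Real.pi)) (by linarith) hβ.contDiff.continuous.continuousOn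
    (show y ∈ Set.Icc _ _ from ⟨by linarith, by linarith⟩)
  exact ⟨x, hx⟩

/-- Preimages under `κ` may be chosen arbitrarily, since a monotone map forces those of an
increasing sequence to increase. Only the last one is tied to the first, by one full turn. -/
theorem IsCircleLift.exists_preimage {κ : ℝ → ℝ} (hκ : IsCircleLift κ) (hκm : Monotone κ) {n : ℕ}
    (hn : n ≠ 0) {a : Fin (n + 1) → ℝ} (ha : StrictMono a)
    (haN : a (Fin.last n) = a 0 + 2 * Real.pi) :
    ∃ b : Fin (n + 1) → ℝ, StrictMono b ∧ b (Fin.last n) = b 0 + 2 * Real.pi ∧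
      ∀ i, κ (b i) = a i := by
  choose f hf using hκ.surjective
  have h0 : (0 : Fin (n + 1)) ≠ Fin.last n := fun h => hn (by
    have := congrArg Fin.val h; simpa using this.symm)
  let b : Fin (n + 1) → ℝ := fun i => if i = Fin.last n then f (a 0) + 2 * Real.pi else f (a i)
  have hb0 : b 0 = f (a 0) := if_neg h0
  have hbN : b (Fin.last n) = f (a 0) + 2 * Real.pi := if_pos rfl
  have hb : ∀ i, κ (b i) = a i := by
    intro i
    by_cases hi : i = Fin.last n
    · rw [hi, hbN, hκ.add_two_pi, hf, haN]
    · simp only [b, if_neg hi, hf]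
  refine ⟨b, fun i j hij => ?_, by rw [hb0, hbN], hb⟩
  by_contra h
  have := hκm (not_lt.1 h)
  rw [hb, hb] at this
  exact absurd (ha hij) (not_lt.2 this)

namespace MarkedDomain

variable {N : ℕ}

theorem mem_arc_iff (D : MarkedDomain N) {i : Fin N} {q : ℝ × ℝ} :
    q ∈ D.arc i ↔ ∃ t ∈ Set.Icc (D.angle i.castSucc) (D.angle i.succ), q = D.boundaryPoint t := by
  constructor
  · rintro ⟨hq, t, ht, hr⟩
    exact ⟨t, ht, D.eq_of_onRay_of_mem_frontier hq hr⟩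
  · rintro ⟨t, ht, rfl⟩
    exact ⟨D.radius_smul_mem_frontier t, t, ht, D.onRay_radius t⟩

theorem exists_int_of_boundaryPoint_eq (D : MarkedDomain N) {s t : ℝ}
    (h : D.boundaryPoint s = D.boundaryPoint t) : ∃ k : ℤ, s = t + k * (2 * Real.pi) :=
  (smul_unitVec_inj (D.radius_pos s) (D.radius_pos t) (add_left_cancel h)).2

theorem center_mem_carrier (D : MarkedDomain N) : D.center ∈ D.carrier :=
  interior_subset D.center_mem

/-- A smooth parametrization of the boundary of a marked domain, with parameters of the marked
points, onto which every marked domain can be mapped in an almost area-preserving way. -/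
structure BoundaryCurve (D : MarkedDomain N) where
  /-- The parametrization. -/
  toFun : ℝ → ℝ × ℝ
  /-- The parameters of the marked points. -/
  mark : Fin (N + 1) → ℝ
  contDiff : ContDiff ℝ ∞ toFun
  mem_carrier : ∀ t, toFun t ∈ D.carrier
  periodic : Function.Periodic toFun (2 * Real.pi)
  strictMono : StrictMono mark
  mark_last : mark (Fin.last N) = mark 0 + 2 * Real.pi
  mem_arc : ∀ i, ∀ t ∈ Set.Icc (mark i.castSucc) (mark i.succ), toFun t ∈ D.arc i
  exists_transfer : ∀ {n : ℕ} (D₀ : MarkedDomain n) {β : ℝ → ℝ}, IsCircleLift β → ∀ {ε : ℝ}, 0 < ε →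
    ∃ T : ℝ × ℝ → ℝ × ℝ, ContDiff ℝ ∞ T ∧ (∀ z, T z ∈ D.carrier) ∧
      (∀ z, |jacobian T z| ≤ 1 + ε) ∧ ∀ t, T (D₀.boundaryPoint t) = toFun (β t)

theorem nonempty_boundaryCurve (hN : N ≠ 0) (D : MarkedDomain N) : Nonempty D.BoundaryCurve := by
  obtain ⟨κ, hκ, hκm, hκs⟩ := D.exists_smooth_radius
  obtain ⟨b, hb, hbN, hκb⟩ := hκ.exists_preimage hκm hN D.angle_strictMono D.angle_last
  refine ⟨⟨fun t => D.boundaryPoint (κ t), b, ?_, fun t => ?_, fun t => ?_, hb, hbN, fun i t ht => ?_,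
    fun D₀ _ hβ _ hε => exists_transfer D₀ D hκ hκm hκs hβ hε⟩⟩
  · exact contDiff_const.add (hκs.smul (contDiff_unitVec.comp hκ.contDiff))
  · exact D.isCompact.isClosed.frontier_subset (D.radius_smul_mem_frontier _)
  · simp only [hκ.add_two_pi, D.boundaryPoint_periodic (κ t)]
  · exact D.mem_arc_iff.2 ⟨κ t, ⟨hκb i.castSucc ▸ hκm ht.1, hκb i.succ ▸ hκm ht.2⟩, rfl⟩

end MarkedDomain

end BoundaryCurve

/-! ### Lower bound: collapsing the last arc -/

section Admissible

variable {E : Type*} [NormedAddCommGroup E] [NormedSpace ℝ E]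
  {M : Type*} [TopologicalSpace M] [ChartedSpace E M]

theorem IsAdmissible.exists_isCompact {N : ℕ} {D : MarkedDomain N} {X : Fin N → Set M}
    {Φ : M → ℝ × ℝ} (h : IsAdmissible (E := E) D X Φ) :
    ∃ p, ∃ s : Set M, IsCompact s ∧ ∀ x ∉ s, Φ x = p := by
  obtain ⟨p, -, h1, h2⟩ := h.compactSupport
  refine ⟨p, _, h1.isCompact.union h2.isCompact, fun x hx => ?_⟩
  rw [Set.mem_union, not_or] at hx
  exact Prod.ext (sub_eq_zero.1 (image_eq_zero_of_notMem_tsupport (f := fun x => (Φ x).1 - p.1) hx.1))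
    (sub_eq_zero.1 (image_eq_zero_of_notMem_tsupport (f := fun x => (Φ x).2 - p.2) hx.2))

theorem hasCompactSupport_sub_const [T2Space M] {Φ : M → ℝ × ℝ} {p : ℝ × ℝ} {s : Set M}
    (hs : IsCompact s) (h : ∀ x ∉ s, Φ x = p) :
    HasCompactSupport (fun x => (Φ x).1 - p.1) ∧ HasCompactSupport (fun x => (Φ x).2 - p.2) :=
  ⟨HasCompactSupport.intro hs fun x hx => by rw [h x hx, sub_self],
    HasCompactSupport.intro hs fun x hx => by rw [h x hx, sub_self]⟩

theorem ENNReal.le_of_forall_le_one_add_mul {a b : ℝ≥0∞}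
    (h : ∀ ε : ℝ, 0 < ε → a ≤ ENNReal.ofReal (1 + ε) * b) : a ≤ b := by
  by_cases hb : b = ⊤
  · rw [hb]; exact le_top
  have h1 : Filter.Tendsto (fun ε : ℝ => ENNReal.ofReal (1 + ε) * b) (𝓝[>] 0) (𝓝 b) := by
    have h2 : Filter.Tendsto (fun ε : ℝ => ENNReal.ofReal (1 + ε)) (𝓝 0)
        (𝓝 (ENNReal.ofReal (1 + 0))) :=
      (ENNReal.continuous_ofReal.comp (continuous_const.add continuous_id)).tendsto 0
    rw [add_zero, ENNReal.ofReal_one] at h2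
    have h3 := ENNReal.Tendsto.mul_const h2 (Or.inr hb)
    rw [one_mul] at h3
    exact h3.mono_left nhdsWithin_le_nhds
  exact ge_of_tendsto h1 (Filter.eventually_of_mem self_mem_nhdsWithin fun ε hε => h ε hε)

variable [FiniteDimensional ℝ E]

theorem SymplecticForm.ofReal_abs_poissonBracket_comp_le (σ : SymplecticForm E M) {Φ : M → ℝ × ℝ}
    {T : ℝ × ℝ → ℝ × ℝ} (hT : ContDiff ℝ ∞ T) (hΦ : ContMDiff 𝓘(ℝ, E) 𝓘(ℝ, ℝ × ℝ) ∞ Φ)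
    {ε : ℝ} (hJ : ∀ z, |jacobian T z| ≤ 1 + ε) (x : M) :
    ENNReal.ofReal |σ.poissonBracket (fun x => (T (Φ x)).1) (fun x => (T (Φ x)).2) x| ≤
      ENNReal.ofReal (1 + ε) * σ.bracketNorm (fun x => (Φ x).1) (fun x => (Φ x).2) := by
  rw [σ.poissonBracket_comp (hT.differentiable (by simp) _) ((hΦ x).mdifferentiableAt (by simp)),
    abs_mul, ENNReal.ofReal_mul (abs_nonneg _)]
  exact mul_le_mul' (ENNReal.ofReal_le_ofReal (hJ _))
    (le_iSup (fun x => ENNReal.ofReal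
      |σ.poissonBracket (fun x => (Φ x).1) (fun x => (Φ x).2) x|) x)

theorem cutTuple_castSucc {N : ℕ} (X : Fin N → Set M) (K : Set M) (i : Fin N) :
    cutTuple X K i.castSucc = if i.val = 0 ∨ i.val + 1 = N then closure (X i \ K) else X i :=
  Fin.snoc_castSucc (α := fun _ => Set M) _ _ _

theorem cutTuple_last {N : ℕ} (X : Fin N → Set M) (K : Set M) : cutTuple X K (Fin.last N) = K :=
  Fin.snoc_last (α := fun _ => Set M) _ _

/-- Collapsing the last arc does not increase the invariant. -/
theorem Pb_le_Pb_cutTuple [T2Space M] (σ : SymplecticForm E M) {N : ℕ} (hN : N ≠ 0)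
    (X : Fin N → Set M) (K : Set M) (D : MarkedDomain N) (D' : MarkedDomain (N + 1)) :
    Pb σ D X ≤ Pb σ D' (cutTuple X K) := by
  refine le_iInf₂ fun Φ hΦ => ENNReal.le_of_forall_le_one_add_mul fun ε hε => ?_
  obtain ⟨B⟩ := D.nonempty_boundaryCurve hN
  -- The truncation repeats the last parameter, so the last arc of `D'` goes to one point: the first
  -- marked point of `D` after a full turn, hence an endpoint of both the first and the last arc.
  let c : Fin (N + 1 + 1) → ℝ := fun i => B.mark ⟨min i.val N, by omega⟩
  have hc : Monotone c := fun i j hij => B.strictMono.monotone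
    (Fin.le_def.2 (min_le_min_right N (Fin.le_def.1 hij)))
  have hc1 : ∀ i : Fin (N + 1), c i.castSucc = B.mark i := fun i => by
    simp only [c]; congr 1; ext; simp; omega
  have hc2 : c (Fin.last (N + 1)) = B.mark (Fin.last N) := by
    simp only [c]; congr 1; ext; simp
  have hc0 : c 0 = B.mark 0 := hc1 0
  obtain ⟨β, hβ, hβm, hβc⟩ := exists_isCircleLift D'.angle_strictMono hc D'.angle_last
    (by rw [hc2, hc0, B.mark_last])
  obtain ⟨T, hT, hTD, hTJ, hTB⟩ := B.exists_transfer D' hβ hε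
  have hβ' : ∀ i, β (D'.angle i) = c i := fun i => (hβc i).self_of_nhds
  have harc : ∀ i, ∀ q ∈ D'.arc i, ∃ s ∈ Set.Icc (c i.castSucc) (c i.succ), T q = B.toFun s := by
    intro i q hq
    obtain ⟨t, ht, rfl⟩ := D'.mem_arc_iff.1 hq
    exact ⟨β t, ⟨hβ' i.castSucc ▸ hβm ht.1, hβ' i.succ ▸ hβm ht.2⟩, hTB t⟩
  have harc1 : ∀ i : Fin N, ∀ q ∈ D'.arc i.castSucc, T q ∈ D.arc i := by
    intro i q hq
    obtain ⟨s, hs, hsq⟩ := harc _ q hq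
    rw [hsq]
    refine B.mem_arc i s ?_
    rw [hc1, Fin.succ_castSucc, hc1] at hs
    exact hs
  have harc2 : ∀ q ∈ D'.arc (Fin.last N), T q = B.toFun (B.mark (Fin.last N)) := by
    intro q hq
    obtain ⟨s, hs, hsq⟩ := harc _ q hq
    rw [hc1, Fin.succ_last, hc2, Set.Icc_self] at hs
    rw [hsq, hs]
  have hend : ∀ i : Fin N, i.val = 0 ∨ i.val + 1 = N →
      B.toFun (B.mark (Fin.last N)) ∈ D.arc i := by
    rintro i (hi | hi)
    · rw [B.mark_last, B.periodic]
      refine B.mem_arc i _ ⟨le_of_eq ?_, B.strictMono.monotone (Fin.zero_le _)⟩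
      congr 1; ext; simp [hi]
    · refine B.mem_arc i _ ⟨B.strictMono.monotone (Fin.le_last _), le_of_eq ?_⟩
      congr 1; ext; simp [hi]
  refine (iInf₂_le (fun x => T (Φ x)) ⟨?_, fun x => hTD _, ?_, fun i => ?_⟩).trans
    (iSup_le (σ.ofReal_abs_poissonBracket_comp_le hT hΦ.smooth hTJ))
  · exact hT.contMDiff.comp hΦ.smooth
  · obtain ⟨p, s, hs, hp⟩ := hΦ.exists_isCompact
    exact ⟨T p, hTD _, hasCompactSupport_sub_const hs fun x hx => by rw [hp x hx]⟩
  · obtain ⟨V, hV, hXV, hVD⟩ := hΦ.mapsTo_arc i.castSucc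
    obtain ⟨W, hW, hXW, hWD⟩ := hΦ.mapsTo_arc (Fin.last N)
    rw [cutTuple_castSucc] at hXV
    rw [cutTuple_last] at hXW
    by_cases hi : i.val = 0 ∨ i.val + 1 = N
    · rw [if_pos hi] at hXV
      -- A point of a cut set lies in `K` or in the closure of the rest; both neighbourhoods are now
      -- sent into the same arc.
      refine ⟨V ∪ W, hV.union hW, fun x hx => ?_, fun x hx => ?_⟩
      · by_cases hxK : x ∈ K
        · exact Or.inr (hXW hxK)
        · exact Or.inl (hXV (subset_closure ⟨hx, hxK⟩))
      · rcases hx with hx | hx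
        · exact harc1 i _ (hVD hx)
        · simp only
          rw [harc2 _ (hWD hx)]; exact hend i hi
    · rw [if_neg hi] at hXV
      exact ⟨V, hV, hXV, fun x hx => harc1 i _ (hVD hx)⟩

end Admissible

/-! ### Upper bound: opening a new arc -/

section Cutting

variable {E : Type*} [NormedAddCommGroup E] [NormedSpace ℝ E] [FiniteDimensional ℝ E]
  {M : Type*} [TopologicalSpace M] [ChartedSpace E M] [IsManifold 𝓘(ℝ, E) ∞ M]
  [T2Space M] [SigmaCompactSpace M]

theorem exists_compactlySupported_bump {C O : Set M} (hC : IsCompact C) (hO : IsOpen O)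
    (hCO : C ⊆ O) : ∃ χ : M → ℝ, ContMDiff 𝓘(ℝ, E) 𝓘(ℝ, ℝ) ∞ χ ∧ (∀ᶠ x in 𝓝ˢ C, χ x = 1) ∧
      IsCompact (tsupport χ) ∧ tsupport χ ⊆ O ∧ ∀ x, χ x ∈ Set.Icc (0 : ℝ) 1 := by
  have : LocallyCompactSpace M := ChartedSpace.locallyCompactSpace E M
  obtain ⟨L, hL, hCL, hLO⟩ := exists_compact_between hC hO hCO
  obtain ⟨χ, h1, h0, hI⟩ := exists_contMDiffMap_one_nhds_of_subset_interior (n := ⊤) 𝓘(ℝ, E)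
    hC.isClosed hCL
  have hsupp : tsupport χ ⊆ L := closure_minimal (fun x hx => by
    by_contra h; exact hx (h0 x h)) hL.isClosed
  exact ⟨χ, χ.contMDiff, h1, hL.of_isClosed_subset (isClosed_tsupport _) hsupp, hsupp.trans hLO, hI⟩

theorem MarkedDomain.polarAngle_sub_center {N : ℕ} (D : MarkedDomain N) {m t : ℝ}
    (ht : |t - m| < Real.pi) : polarAngle m (D.boundaryPoint t - D.center) = t := by
  rw [boundaryPoint, add_sub_cancel_left, polarAngle_smul_unitVec (D.radius_pos t) ht]

theorem MarkedDomain.contDiffAt_polarAngle_sub_center {N : ℕ} (D : MarkedDomain N) {m t : ℝ}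
    (ht : |t - m| < Real.pi) :
    ContDiffAt ℝ ∞ (fun z => polarAngle m (z - D.center)) (D.boundaryPoint t) := by
  refine ContDiffAt.comp (g := polarAngle m) (f := fun z => z - D.center) _ ?_ (by fun_prop)
  rw [boundaryPoint, add_sub_cancel_left]
  exact contDiffAt_polarAngle (D.radius_pos t) ht

/-- If `K` lies where an admissible map takes the first and the last set, the map can be
modified so that the intersection is cut out and takes an arc of its own. -/
theorem Pb_cutTuple_le (σ : SymplecticForm E M) {N : ℕ} (hN : 3 ≤ N)
    {X : Fin N → Set M} (hX : ∀ i, IsCompact (X i)) {K : Set M}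
    {f l : Fin N} (hf : f.val = 0) (hl : l.val + 1 = N)
    (hK : K ∈ 𝓝ˢ (X f ∩ X l)) (D : MarkedDomain N) (D' : MarkedDomain (N + 1))
    {Φ : M → ℝ × ℝ} (hΦ : IsAdmissible (E := E) D X Φ) {U : Fin N → Set M}
    (hU : ∀ i, IsOpen (U i)) (hXU : ∀ i, X i ⊆ U i) (hUD : ∀ i, Set.MapsTo Φ (U i) (D.arc i))
    (hKU : K ⊆ U f ∩ U l) :
    Pb σ D' (cutTuple X K) ≤ σ.bracketNorm (fun x => (Φ x).1) (fun x => (Φ x).2) := by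
  refine ENNReal.le_of_forall_le_one_add_mul fun ε hε => ?_
  -- A common point would lie in `X f ∩ X l`, of which `K` is a neighbourhood; but points of `X f \
  -- K` accumulate there. This makes room for the cutoff `χ`, equal to `1` near the rest of the last
  -- set and supported in `U l` away from the rest of the first.
  have hfl : ∀ x, x ∈ closure (X f \ K) → x ∉ closure (X l \ K) := by
    intro x hxf hxl
    have h1 : x ∈ X f := closure_minimal Set.sdiff_subset (hX f).isClosed hxf
    have h2 : x ∈ X l := closure_minimal Set.sdiff_subset (hX l).isClosed hxl
    have h3 : K ∈ 𝓝 x := mem_nhdsSet_iff_forall.1 hK x ⟨h1, h2⟩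
    obtain ⟨y, hyK, hy⟩ := mem_closure_iff_nhds.1 hxf K h3
    exact hy.2 hyK
  have hCl : closure (X l \ K) ⊆ X l := closure_minimal Set.sdiff_subset (hX l).isClosed
  have hCf : closure (X f \ K) ⊆ X f := closure_minimal Set.sdiff_subset (hX f).isClosed
  obtain ⟨χ, hχs, hχ1, hχc, hχO, hχI⟩ := exists_compactlySupported_bump (E := E)
    ((hX l).of_isClosed_subset isClosed_closure hCl)
    ((hU l).inter (isClosed_closure (s := X f \ K)).isOpen_compl)
    (fun x hx => ⟨hXU l (hCl hx), fun h => hfl x h hx⟩)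
  obtain ⟨B⟩ := D'.nonempty_boundaryCurve (by omega)
  -- the parameters of the marked points of `D`
  let c : Fin (N + 1) → ℝ := fun i => if i = Fin.last N then B.mark (Fin.last (N + 1))
    else B.mark i.castSucc
  have hcl : c (Fin.last N) = B.mark (Fin.last (N + 1)) := if_pos rfl
  have hc : ∀ i : Fin (N + 1), i ≠ Fin.last N → c i = B.mark i.castSucc := fun i hi => if_neg hi
  have hcm : Monotone c := by
    intro i j hij
    by_cases hj : j = Fin.last N
    · by_cases hi : i = Fin.last N
      · rw [hi, hj]
      · rw [hc i hi, hj, hcl]; exact B.strictMono.monotone (Fin.le_last _)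
    · have hi : i ≠ Fin.last N := fun hi => hj (le_antisymm (Fin.le_last _) (hi ▸ hij))
      rw [hc i hi, hc j hj]
      exact B.strictMono.monotone (Fin.castSucc_le_castSucc_iff.2 hij)
  have hc0 : c 0 = B.mark 0 := hc 0 fun h => by
    have := congrArg Fin.val h; simp at this; omega
  -- The parameter at the start of the new arc is omitted from `c`, so `β` spreads the last arc of
  -- `D` over the last two arcs of `D'`, from `p` through `q` to `r`.
  obtain ⟨β, hβ, hβm, hβc⟩ := exists_isCircleLift D.angle_strictMono hcm D.angle_last
    (by rw [hcl, hc0, B.mark_last])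
  obtain ⟨T, hT, hTD, hTJ, hTB⟩ := B.exists_transfer D hβ hε
  have hβ' : ∀ i, β (D.angle i) = c i := fun i => (hβc i).self_of_nhds
  have hlN : l.succ = Fin.last N := by ext; simp [hl]
  have hlne : l.castSucc ≠ Fin.last N := fun h => by
    have := congrArg Fin.val h; simp at this; omega
  set a₀ := D.angle l.castSucc with ha₀
  set a₁ := D.angle (Fin.last N) with ha₁
  have ha01 : a₀ < a₁ := D.angle_strictMono (lt_of_le_of_ne (Fin.le_last _) hlne)
  have ha02 : a₁ < a₀ + 2 * Real.pi := by
    rw [ha₁, D.angle_last]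
    have : D.angle 0 < a₀ := D.angle_strictMono (Fin.lt_def.2 (by simp; omega))
    linarith
  -- The last arc subtends less than a full turn, so the angle branch centred at its middle is
  -- smooth along it.
  set m := (a₀ + a₁) / 2 with hm
  have hmt : ∀ t ∈ Set.Icc a₀ a₁, |t - m| < Real.pi := fun t ht => by
    rw [abs_lt]; constructor <;> linarith [ht.1, ht.2]
  set p := B.mark l.castSucc.castSucc with hp
  set q := B.mark (Fin.last N).castSucc with hq
  set r := B.mark (Fin.last (N + 1)) with hr
  have hpq : p < q := B.strictMono (Fin.castSucc_lt_castSucc_iff.2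
    (lt_of_le_of_ne (Fin.le_last _) hlne))
  have hqr : q < r := B.strictMono (Fin.castSucc_lt_last _)
  have hβ0 : β a₀ = p := by rw [ha₀, hβ', hc _ hlne]
  have hβ1 : β a₁ = r := by rw [ha₁, hβ', hcl]
  have harcl : ∀ s ∈ Set.Icc p q, B.toFun s ∈ D'.arc l.castSucc := fun s hs => by
    refine B.mem_arc l.castSucc s ?_
    rw [Fin.succ_castSucc, hlN]; exact hs
  have harcN : ∀ s ∈ Set.Icc q r, B.toFun s ∈ D'.arc (Fin.last N) := fun s hs => by
    refine B.mem_arc (Fin.last N) s ?_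
    rw [Fin.succ_last]; exact hs
  have harc : ∀ i : Fin N, i ≠ l → ∀ t ∈ Set.Icc (D.angle i.castSucc) (D.angle i.succ),
      B.toFun (β t) ∈ D'.arc i.castSucc := by
    intro i hil t ht
    have hi1 : i.castSucc ≠ Fin.last N := (Fin.castSucc_lt_last i).ne
    have hi2 : i.succ ≠ Fin.last N := fun h => hil (Fin.succ_injective _ (h.trans hlN.symm))
    refine B.mem_arc i.castSucc _ ⟨?_, ?_⟩
    · rw [← hc _ hi1, ← hβ']; exact hβm ht.1
    · rw [Fin.succ_castSucc, ← hc _ hi2, ← hβ']; exact hβm ht.2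
  -- the modified map
  let θ : M → ℝ := fun x => polarAngle m (Φ x - D.center)
  have hθ : ∀ x ∈ U l, θ x ∈ Set.Icc a₀ a₁ ∧ Φ x = D.boundaryPoint (θ x) := by
    intro x hx
    obtain ⟨t, ht, hxt⟩ := D.mem_arc_iff.1 (hUD l hx)
    rw [hlN] at ht
    have : θ x = t := by simp only [θ, hxt, D.polarAngle_sub_center (hmt t ht)]
    rw [this]; exact ⟨ht, hxt⟩
  have hθs : ∀ x ∈ U l, ContMDiffAt 𝓘(ℝ, E) 𝓘(ℝ, ℝ) ∞ θ x := by
    intro x hx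
    obtain ⟨h1, h2⟩ := hθ x hx
    have h3 := D.contDiffAt_polarAngle_sub_center (hmt _ h1)
    rw [← h2] at h3
    exact h3.contMDiffAt.comp x (hΦ.smooth x)
  -- Scaling about `p` by `1 - k` takes `[p, r]` onto `[p, q]`.
  set k := (r - q) / (r - p) with hk
  have hk0 : 0 ≤ k := div_nonneg (by linarith) (by linarith)
  have hk1 : (r - p) * (1 - k) = q - p := by
    rw [hk]; field_simp [(by linarith : r - p ≠ 0)]; ring
  have hk1' : 0 ≤ 1 - k := by
    have h : 0 < (r - p) * (1 - k) := by rw [hk1]; linarith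
    exact (pos_of_mul_pos_right h (by linarith)).le
  -- Where `χ = 0` this is the parameter of `T ∘ Φ`; where `χ = 1` it is compressed into the old
  -- last arc. If `β (θ x) = r`, as on `K`, it lies in `[q, r]` whatever `χ` is.
  let u : M → ℝ := fun x => p + (β (θ x) - p) * (1 - k * χ x)
  have hus : ∀ x ∈ U l, ContMDiffAt 𝓘(ℝ, E) 𝓘(ℝ, ℝ) ∞ u x := by
    intro x hx
    have h1 : ContMDiffAt 𝓘(ℝ, E) 𝓘(ℝ, ℝ × ℝ) ∞ (fun x => (θ x, χ x)) x :=
      (hθs x hx).prodMk_space (hχs x)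
    have h2 : ContDiff ℝ ∞ fun z : ℝ × ℝ => p + (β z.1 - p) * (1 - k * z.2) :=
      contDiff_const.add (((hβ.contDiff.comp contDiff_fst).sub contDiff_const).mul
        (contDiff_const.sub (contDiff_const.mul contDiff_snd)))
    exact h2.contMDiff.contMDiffAt.comp x h1
  have hβI : ∀ x ∈ U l, β (θ x) ∈ Set.Icc p r := fun x hx => by
    obtain ⟨h1, -⟩ := hθ x hx
    exact ⟨hβ0 ▸ hβm h1.1, hβ1 ▸ hβm h1.2⟩
  classical
  let Ψ : M → ℝ × ℝ := fun x => if x ∈ U l then B.toFun (u x) else T (Φ x)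
  have hΨ1 : ∀ x ∈ U l, Ψ x = B.toFun (u x) := fun x hx => if_pos hx
  have hΨ2 : ∀ x, χ x = 0 → Ψ x = T (Φ x) := by
    intro x hx
    by_cases hxU : x ∈ U l
    · have h1 : T (Φ x) = B.toFun (β (θ x)) := by
        conv_lhs => rw [(hθ x hxU).2]
        exact hTB _
      rw [hΨ1 x hxU, h1]
      simp only [u, hx]
      congr 1; ring
    · exact if_neg hxU
  have hΨ2' : ∀ x, x ∉ tsupport χ → Ψ x = T (Φ x) := fun x hx =>
    hΨ2 x (image_eq_zero_of_notMem_tsupport hx)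
  have hev1 : ∀ x ∈ U l, Ψ =ᶠ[𝓝 x] fun x => B.toFun (u x) := fun x hx => by
    filter_upwards [(hU l).mem_nhds hx] with y hy using hΨ1 y hy
  have hev2 : ∀ x, x ∉ tsupport χ → Ψ =ᶠ[𝓝 x] fun x => T (Φ x) := fun x hx => by
    filter_upwards [(isClosed_tsupport χ).isOpen_compl.mem_nhds hx] with y hy using hΨ2' y hy
  have hcov : ∀ x, x ∉ U l → x ∉ tsupport χ := fun x hx h => hx (hχO h).1
  have hΨ : IsAdmissible (E := E) D' (cutTuple X K) Ψ := by
    refine ⟨fun x => ?_, fun x => ?_, ?_, fun i => ?_⟩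
    · by_cases hx : x ∈ U l
      · exact (B.contDiff.contMDiff.contMDiffAt.comp x (hus x hx)).congr_of_eventuallyEq (hev1 x hx)
      · exact (hT.contMDiff.contMDiffAt.comp x (hΦ.smooth x)).congr_of_eventuallyEq
          (hev2 x (hcov x hx))
    · by_cases hx : x ∈ U l
      · rw [hΨ1 x hx]; exact B.mem_carrier _
      · rw [hΨ2' x (hcov x hx)]; exact hTD _
    · obtain ⟨p₀, s, hs, hp₀⟩ := hΦ.exists_isCompact
      refine ⟨T p₀, hTD _, hasCompactSupport_sub_const (hs.union hχc) fun x hx => ?_⟩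
      rw [Set.mem_union, not_or] at hx
      rw [hΨ2' x hx.2, hp₀ x hx.1]
    · induction i using Fin.lastCases with
      | last =>
        rw [cutTuple_last]
        refine ⟨U f ∩ U l, (hU f).inter (hU l), hKU, fun x hx => ?_⟩
        obtain ⟨h1, h2⟩ := hθ x hx.2
        obtain ⟨t, ht, hxt⟩ := D.mem_arc_iff.1 (hUD f hx.1)
        rw [h2] at hxt
        obtain ⟨j, hj⟩ := D.exists_int_of_boundaryPoint_eq hxt
        have hf0 : f.castSucc = 0 := by ext; simp [hf]
        have hta : D.angle f.succ < a₀ := D.angle_strictMono (Fin.lt_def.2 (by simp; omega))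
        have hθa : θ x = a₁ := by
          refine le_antisymm h1.2 ?_
          -- The angles of the first arc end before `a₀`, so `θ x` differs from such an angle by at
          -- least one positive turn. Then `θ x` is at least `D.angle 0` plus a turn, which is `a₁`.
          have hj0 : 0 < j := by
            by_contra hj0
            have : (j : ℝ) * (2 * Real.pi) ≤ 0 :=
              mul_nonpos_of_nonpos_of_nonneg (by exact_mod_cast not_lt.1 hj0) Real.two_pi_pos.le
            linarith [ht.2, h1.1]
          have hj1 : (1 : ℝ) ≤ j := by exact_mod_cast hj0
          have : 1 * (2 * Real.pi) ≤ j * (2 * Real.pi) :=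
            mul_le_mul_of_nonneg_right hj1 Real.two_pi_pos.le
          rw [hf0] at ht
          rw [ha₁, D.angle_last, hj]
          linarith [ht.1]
        rw [hΨ1 x hx.2]
        refine harcN _ ?_
        have hu : u x = p + (r - p) * (1 - k * χ x) := by simp only [u, hθa, hβ1]
        have hχx := hχI x
        have h3 : k * χ x ≤ k := mul_le_of_le_one_right hk0 hχx.2
        have h4 : 0 ≤ k * χ x := mul_nonneg hk0 hχx.1
        have h5 : 0 < r - p := by linarith
        rw [hu]
        constructor
        · have := mul_le_mul_of_nonneg_left (show 1 - k ≤ 1 - k * χ x by linarith) h5.le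
          rw [hk1] at this; linarith
        · have := mul_le_of_le_one_right h5.le (show 1 - k * χ x ≤ 1 by linarith)
          linarith
      | cast i =>
        rw [cutTuple_castSucc]
        by_cases hil : i = l
        · rw [hil, if_pos (Or.inr hl)]
          obtain ⟨W, hW, hCW, hW1⟩ := eventually_nhdsSet_iff_exists.1 hχ1
          refine ⟨W ∩ U l, hW.inter (hU l), fun x hx => ⟨hCW hx, hXU l (hCl hx)⟩, fun x hx => ?_⟩
          rw [hΨ1 x hx.2]
          refine harcl _ ?_
          have hb := hβI x hx.2
          have hu : u x = p + (β (θ x) - p) * (1 - k) := by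
            simp only [u, hW1 x hx.1, mul_one]
          rw [hu]
          constructor
          · have := mul_nonneg (sub_nonneg.2 hb.1) hk1'
            linarith
          · have := mul_le_mul_of_nonneg_right (sub_le_sub_right hb.2 p) hk1'
            rw [hk1] at this; linarith
        have hoff : ∀ x ∈ U i, x ∉ tsupport χ → Ψ x ∈ D'.arc i.castSucc := by
          intro x hx hxχ
          obtain ⟨t, ht, hxt⟩ := D.mem_arc_iff.1 (hUD i hx)
          rw [hΨ2' x hxχ, hxt, hTB]
          exact harc i hil t ht
        by_cases hif : i = f
        · rw [hif, if_pos (Or.inl hf)]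
          refine ⟨U f ∩ (tsupport χ)ᶜ, (hU f).inter (isClosed_tsupport χ).isOpen_compl,
            fun x hx => ⟨hXU f (hCf hx), fun h => (hχO h).2 hx⟩, fun x hx => ?_⟩
          rw [← hif]
          exact hoff x (hif ▸ hx.1) hx.2
        · have hi0 : i.val ≠ 0 := fun h => hif (Fin.ext (h.trans hf.symm))
          have hiN : i.val + 1 ≠ N := fun h => hil (Fin.ext (by omega))
          rw [if_neg (by tauto)]
          refine ⟨U i, hU i, hXU i, fun x hx => ?_⟩
          -- The arc of a middle index can meet the last arc only at its starting point `a₀`, where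
          -- the parameter is `p`, the fixed point of the scaling; so the modification does nothing
          -- there.
          by_cases hxU : x ∈ U l
          · obtain ⟨h1, h2⟩ := hθ x hxU
            obtain ⟨t, ht, hxt⟩ := D.mem_arc_iff.1 (hUD i hx)
            have hxt' := h2.symm.trans hxt
            obtain ⟨j, hj⟩ := D.exists_int_of_boundaryPoint_eq hxt'
            have hia : D.angle i.succ ≤ a₀ := D.angle_strictMono.monotone
              (Fin.le_def.2 (by simp; omega))
            have hi1 : D.angle 0 < D.angle i.castSucc := D.angle_strictMono
              (Fin.lt_def.2 (by simp; omega))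
            have hj0 : j ≤ 0 := by
              by_contra hj0
              have hj1 : (1 : ℝ) ≤ j := by exact_mod_cast not_le.1 hj0
              have : 1 * (2 * Real.pi) ≤ j * (2 * Real.pi) :=
                mul_le_mul_of_nonneg_right hj1 Real.two_pi_pos.le
              have h3 := h1.2
              rw [ha₁, D.angle_last] at h3
              linarith [ht.1]
            have hj0' : (j : ℝ) * (2 * Real.pi) ≤ 0 :=
              mul_nonpos_of_nonpos_of_nonneg (by exact_mod_cast hj0) Real.two_pi_pos.le
            have hθ0 : θ x = a₀ := le_antisymm (by linarith [ht.2]) h1.1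
            have hβθ : β (θ x) = p := by rw [hθ0, hβ0]
            have hΨx : Ψ x = B.toFun (β (θ x)) := by
              rw [hΨ1 x hxU, hβθ]
              simp only [u, hβθ, sub_self, zero_mul, add_zero]
            rw [hΨx, ← hTB, hxt', hTB]
            exact harc i hil t ht
          · exact hoff x hx (hcov x hxU)
  refine (iInf₂_le Ψ hΨ).trans (iSup_le fun x => ?_)
  -- On `U l` the new map factors through one real function and its bracket is zero; elsewhere it
  -- agrees locally with `T ∘ Φ`.
  by_cases hx : x ∈ U l
  · rw [σ.poissonBracket_congr (hev1 x hx), σ.poissonBracket_curve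
      (B.contDiff.differentiable (by simp) _) ((hus x hx).mdifferentiableAt (by simp))]
    simp
  · rw [σ.poissonBracket_congr (hev2 x (hcov x hx))]
    exact σ.ofReal_abs_poissonBracket_comp_le hT hΦ.smooth hTJ x

end Cutting

/-! ### Finiteness: existence of an admissible map -/

section Finiteness

/-- The cyclic successor. -/
def cyclicSucc {N : ℕ} (i : Fin N) : Fin N :=
  ⟨if i.val + 1 = N then 0 else i.val + 1, by split_ifs <;> omega⟩

theorem val_cyclicSucc {N : ℕ} (i : Fin N) :
    (cyclicSucc i).val = if i.val + 1 = N then 0 else i.val + 1 := rfl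

theorem add_one_mod_eq_cyclicSucc {N : ℕ} (i : Fin N) : (i.val + 1) % N = (cyclicSucc i).val := by
  rw [val_cyclicSucc]
  split_ifs with h
  · rw [h, Nat.mod_self]
  · exact Nat.mod_eq_of_lt (by omega)

/-- The marked point `j` is common to all arcs whose sets contain `x`. Those sets have pairwise
neighbouring indices, and three distinct indices of a cycle are pairwise neighbours only for `N =
3`, which the condition on the triple intersection excludes. -/
theorem exists_forall_mem_imp_eq_or_cyclicSucc_eq {M : Type*} {N : ℕ} (hN : 3 ≤ N)
    {X : Fin N → Set M} (hcyc : IntersectCyclically X) (hthree : N = 3 → ⋂ i, X i = ∅) (x : M) :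
    ∃ j, ∀ i, x ∈ X i → j = i ∨ j = cyclicSucc i := by
  have hadj : ∀ i k, x ∈ X i → x ∈ X k → i = k ∨ cyclicSucc i = k ∨ cyclicSucc k = i := by
    intro i k hi hk
    by_contra! h
    refine Set.disjoint_left.1 (hcyc i k h.1 ?_ ?_) hi hk <;> rw [add_one_mod_eq_cyclicSucc]
    · exact fun e => h.2.1 (Fin.ext e)
    · exact fun e => h.2.2 (Fin.ext e)
  by_cases h1 : ∃ i, x ∈ X i ∧ x ∈ X (cyclicSucc i)
  · obtain ⟨i, hi, hi'⟩ := h1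
    refine ⟨cyclicSucc i, fun k hk => ?_⟩
    by_contra! h
    have hki : k ≠ i := fun e => h.2 (by rw [e])
    obtain e1 : cyclicSucc k = i := by
      rcases hadj i k hi hk with e | e | e
      · exact absurd e.symm hki
      · exact absurd e h.1
      · exact e
    obtain e2 : cyclicSucc (cyclicSucc i) = k := by
      rcases hadj _ k hi' hk with e | e | e
      · exact absurd e h.1
      · exact e
      · exact absurd e.symm h.2
    have v1 := congrArg Fin.val e1
    have v2 := congrArg Fin.val e2
    have hki' : k.val ≠ i.val := fun e => hki (Fin.ext e)
    have hsk : (cyclicSucc i).val ≠ k.val := fun e => h.1 (Fin.ext e)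
    have hsi := val_cyclicSucc i
    rw [val_cyclicSucc] at v1 v2
    have h3 : N = 3 := by split_ifs at * <;> omega
    have hmem : x ∈ ⋂ i, X i := Set.mem_iInter.2 fun j => by
      have : j = i ∨ j = cyclicSucc i ∨ j = k := by
        simp only [Fin.ext_iff]
        split_ifs at * <;> omega
      rcases this with rfl | rfl | rfl <;> assumption
    rw [hthree h3] at hmem
    exact hmem
  · by_cases h2 : ∃ i, x ∈ X i
    · obtain ⟨i, hi⟩ := h2
      refine ⟨i, fun k hk => ?_⟩
      rcases hadj i k hi hk with e | e | e
      · exact Or.inl e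
      · exact absurd ⟨i, hi, e ▸ hk⟩ h1
      · exact Or.inr e.symm
    · exact ⟨⟨0, by omega⟩, fun i hi => absurd ⟨i, hi⟩ h2⟩

variable {E : Type*} [NormedAddCommGroup E] [NormedSpace ℝ E] [FiniteDimensional ℝ E]
  {M : Type*} [TopologicalSpace M] [ChartedSpace E M] [IsManifold 𝓘(ℝ, E) ∞ M]
  [T2Space M] [SigmaCompactSpace M]

/-- There is an admissible map that is constant outside a compact set. -/
theorem Pb_ne_top (σ : SymplecticForm E M) {N : ℕ} (hN : 3 ≤ N) {X : Fin N → Set M}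
    (hX : ∀ i, IsCompact (X i)) (hcyc : IntersectCyclically X)
    (hthree : N = 3 → ⋂ i, X i = ∅) (D : MarkedDomain N) : Pb σ D X ≠ ⊤ := by
  obtain ⟨B⟩ := D.nonempty_boundaryCurve (by omega)
  -- `O j` avoids every `X i` whose arc does not end or start at the marked point `j`. On the
  -- neighbourhood `V i` of `X i` defined below, only the weights of the two endpoints of arc `i`
  -- can be nonzero, and the weight of the second endpoint serves as a coordinate along that arc.
  let O : Fin N → Set M := fun j => ⋂ i : {i : Fin N // ¬(j = i ∨ j = cyclicSucc i)}, (X i)ᶜ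
  obtain ⟨lam, hlam⟩ := SmoothPartitionOfUnity.exists_isSubordinate 𝓘(ℝ, E)
    (isClosed_univ (X := M)) O
    (fun j => isOpen_iInter_of_finite fun i => (hX i).isClosed.isOpen_compl)
    (fun x _ => by
      obtain ⟨j, hj⟩ := exists_forall_mem_imp_eq_or_cyclicSucc_eq hN hcyc hthree x
      exact Set.mem_iUnion.2 ⟨j, Set.mem_iInter.2 fun i hi => i.2 (hj i hi)⟩)
  let V : Fin N → Set M := fun i =>
    ⋂ k : {k : Fin N // ¬(k = i ∨ k = cyclicSucc i)}, (tsupport (lam k))ᶜ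
  have hV : ∀ i, IsOpen (V i) := fun i =>
    isOpen_iInter_of_finite fun k => (isClosed_tsupport _).isOpen_compl
  have hXV : ∀ i, X i ⊆ V i := fun i x hx => Set.mem_iInter.2 fun k hk =>
    Set.mem_iInter.1 (hlam k.1 hk) ⟨i, k.2⟩ hx
  have hV0 : ∀ i, ∀ x ∈ V i, ∀ k, lam k x ≠ 0 → k = i ∨ k = cyclicSucc i := by
    intro i x hx k hk
    by_contra h
    exact Set.mem_iInter.1 hx ⟨k, h⟩ (subset_tsupport _ hk)
  let u : Fin N → M → ℝ := fun i x =>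
    B.mark i.castSucc + (B.mark i.succ - B.mark i.castSucc) * lam (cyclicSucc i) x
  have hus : ∀ i, ContMDiff 𝓘(ℝ, E) 𝓘(ℝ, ℝ) ∞ (u i) := fun i =>
    (show ContDiff ℝ ∞ fun r : ℝ => B.mark i.castSucc + (B.mark i.succ - B.mark i.castSucc) * r by
      fun_prop).contMDiff.comp (lam (cyclicSucc i)).contMDiff
  have huB : ∀ i x, B.toFun (u i x) ∈ D.arc i := by
    intro i x
    have h0 := lam.nonneg (cyclicSucc i) x
    have h1 := lam.le_one (cyclicSucc i) x
    have h2 : 0 < B.mark i.succ - B.mark i.castSucc :=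
      sub_pos.2 (B.strictMono i.castSucc_lt_succ)
    refine B.mem_arc i _ ⟨?_, ?_⟩
    · have := mul_nonneg h2.le h0
      linarith
    · have := mul_le_of_le_one_right h2.le h1
      simp only [u]; linarith
  have hB1 : ∀ i, B.toFun (B.mark i.succ) = B.toFun (B.mark (cyclicSucc i).castSucc) := by
    intro i
    by_cases hi : i.val + 1 = N
    · have e1 : i.succ = Fin.last N := by ext; simp [hi]
      have e2 : (cyclicSucc i).castSucc = ⟨0, by omega⟩ := by ext; simp [val_cyclicSucc, hi]
      rw [e1, e2, B.mark_last, B.periodic]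
      rfl
    · congr 2; ext; simp [val_cyclicSucc, hi]
  have hu1 : ∀ i, ∀ x ∈ V i, ∀ j, lam j x ≠ 0 → (∀ k, k ≠ j → lam k x = 0) →
      B.toFun (u i x) = B.toFun (B.mark j.castSucc) := by
    intro i x hx j hj hjk
    have hsum : lam j x = 1 := by
      rw [← lam.sum_eq_one (Set.mem_univ x), finsum_eq_single _ j hjk]
    have hii : cyclicSucc i ≠ i := fun h => by
      have := congrArg Fin.val h
      rw [val_cyclicSucc] at this
      split_ifs at this <;> omega
    rcases hV0 i x hx j hj with rfl | rfl
    · simp only [u, hjk _ hii, mul_zero, add_zero]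
    · simp only [u, hsum, mul_one, add_sub_cancel, hB1]
  have huu : ∀ i k, ∀ x ∈ V i, x ∈ V k → B.toFun (u i x) = B.toFun (u k x) := by
    intro i k x hi hk
    by_cases hik : i = k
    · rw [hik]
    obtain ⟨j, hj⟩ : ∃ j, lam j x ≠ 0 := by
      by_contra! h
      have := lam.sum_eq_one (Set.mem_univ x)
      simp [h] at this
    -- Two different arcs have at most one endpoint index in common when `N ≥ 3`; so on an overlap a
    -- single weight is nonzero and both formulas give that marked point.
    have hjk : ∀ l, l ≠ j → lam l x = 0 := by
      intro l hl
      by_contra hl0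
      have a1 := hV0 i x hi j hj
      have a2 := hV0 k x hk j hj
      have a3 := hV0 i x hi l hl0
      have a4 := hV0 k x hk l hl0
      simp only [Fin.ext_iff, val_cyclicSucc, ne_eq] at a1 a2 a3 a4 hl hik
      split_ifs at * <;> omega
    rw [hu1 i x hi j hj hjk, hu1 k x hk j hj hjk]
  obtain ⟨χ, hχs, hχ1, hχc, hχO, hχI⟩ := exists_compactlySupported_bump (E := E)
    (isCompact_iUnion hX) (isOpen_iUnion hV) (Set.iUnion_mono hXV)
  classical
  let ζ : M → ℝ × ℝ := fun x => if h : ∃ i, x ∈ V i then B.toFun (u h.choose x) else D.center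
  have hζ : ∀ i, ∀ x ∈ V i, ζ x = B.toFun (u i x) := by
    intro i x hx
    have h : ∃ i, x ∈ V i := ⟨i, hx⟩
    simp only [ζ, dif_pos h]
    exact huu _ _ x h.choose_spec hx
  have hζD : ∀ x, ζ x ∈ D.carrier := by
    intro x
    by_cases h : ∃ i, x ∈ V i
    · obtain ⟨i, hi⟩ := h
      rw [hζ i x hi]; exact B.mem_carrier _
    · simp only [ζ, dif_neg h]; exact D.center_mem_carrier
  -- The cutoff shrinks the values towards the center by convexity. This gives compact support and
  -- makes the arbitrary value of `ζ` outside the union of the `V i` irrelevant.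
  let Φ : M → ℝ × ℝ := fun x => D.center + χ x • (ζ x - D.center)
  have hΦ0 : ∀ x, x ∉ tsupport χ → Φ x = D.center := fun x hx => by
    simp only [Φ, image_eq_zero_of_notMem_tsupport hx, zero_smul, add_zero]
  have hev : ∀ x, x ∉ tsupport χ → Φ =ᶠ[𝓝 x] fun _ => D.center := fun x hx => by
    filter_upwards [(isClosed_tsupport χ).isOpen_compl.mem_nhds hx] with y hy using hΦ0 y hy
  have hΦ : IsAdmissible (E := E) D X Φ := by
    refine ⟨fun x => ?_, fun x => ?_, ?_, fun i => ?_⟩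
    · by_cases hx : x ∈ tsupport χ
      · obtain ⟨i, hi⟩ := Set.mem_iUnion.1 (hχO hx)
        have h1 : ContMDiffAt 𝓘(ℝ, E) 𝓘(ℝ, ℝ × ℝ) ∞ (fun x => (u i x, χ x)) x :=
          ((hus i) x).prodMk_space (hχs x)
        have h2 : ContDiff ℝ ∞ fun z : ℝ × ℝ => D.center + z.2 • (B.toFun z.1 - D.center) :=
          contDiff_const.add (contDiff_snd.smul ((B.contDiff.comp contDiff_fst).sub contDiff_const))
        refine (h2.contMDiff.contMDiffAt.comp x h1).congr_of_eventuallyEq ?_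
        filter_upwards [(hV i).mem_nhds hi] with y hy
        simp only [Φ, hζ i y hy, Function.comp]
      · exact contMDiffAt_const.congr_of_eventuallyEq (hev x hx)
    · have := D.convex.add_smul_sub_mem D.center_mem_carrier (hζD x) (hχI x)
      exact this
    · exact ⟨D.center, D.center_mem_carrier, hasCompactSupport_sub_const hχc hΦ0⟩
    · obtain ⟨W, hW, hXW, hW1⟩ := eventually_nhdsSet_iff_exists.1 hχ1
      refine ⟨W ∩ V i, hW.inter (hV i), fun x hx => ⟨hXW (Set.mem_iUnion.2 ⟨i, hx⟩), hXV i hx⟩,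
        fun x hx => ?_⟩
      have : Φ x = B.toFun (u i x) := by
        simp only [Φ, hW1 x hx.1, hζ i x hx.2, one_smul, add_sub_cancel]
      rw [this]
      exact huB i x
  refine ne_top_of_le_ne_top (σ.bracketNorm_ne_top (contDiff_fst.contMDiff.comp hΦ.smooth)
    (contDiff_snd.contMDiff.comp hΦ.smooth) hχc fun x hx => ?_) (iInf₂_le Φ hΦ)
  refine (σ.poissonBracket_congr (hev x hx)).trans ?_
  exact σ.poissonBracket_curve (b := fun _ => D.center) (u := fun _ => (0 : ℝ))
    (differentiableAt_const _) mdifferentiableAt_const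

end Finiteness

/-! ### Convergence of the neighbourhoods and the limit -/

/-- A compact set has a uniform thickening inside `W`. For empty `A` the extended distance to `A` is
`⊤`, so the hypothesis forces `K n` to be empty eventually, in accordance with the convention of the
theorem. -/
theorem eventually_subset_of_tendsto_hausdorffEDist {M : Type*} [PseudoEMetricSpace M]
    {K : ℕ → Set M} {A W : Set M} (hA : IsCompact A) (hW : IsOpen W) (hAW : A ⊆ W)
    (hK : Filter.Tendsto (fun n => Metric.hausdorffEDist (K n) A) Filter.atTop (𝓝 0)) :
    ∀ᶠ n in Filter.atTop, K n ⊆ W := by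
  obtain ⟨δ, hδ, hδW⟩ := hA.exists_thickening_subset_open hW hAW
  filter_upwards [hK.eventually (gt_mem_nhds (ENNReal.ofReal_pos.2 hδ))] with n hn x hx
  exact hδW ((Metric.infEDist_le_hausdorffEDist_of_mem hx).trans_lt hn)

theorem mainTheorem5
    {E : Type*} [NormedAddCommGroup E] [NormedSpace ℝ E] [FiniteDimensional ℝ E]
    {M : Type*} [MetricSpace M] [SecondCountableTopology M] [ChartedSpace E M]
    [IsManifold 𝓘(ℝ, E) ∞ M] (σ : SymplecticForm E M)
    {N : ℕ} (hN : 3 ≤ N) (X : Fin N → Set M)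
    (hX : ∀ i, IsCompact (X i)) (hcyc : IntersectCyclically X)
    (hthree : N = 3 → ⋂ i, X i = ∅)
    (K : ℕ → Set M) (hK : ∀ n, IsCompact (K n)) (hKanti : Antitone K)
    (hKnhds : ∀ n, K n ∈ 𝓝ˢ (X ⟨0, by omega⟩ ∩ X ⟨N - 1, by omega⟩))
    (hKlim : Filter.Tendsto
      (fun n => Metric.hausdorffEDist (K n) (X ⟨0, by omega⟩ ∩ X ⟨N - 1, by omega⟩))
      Filter.atTop (𝓝 0))
    (hKdisj : ∀ j : Fin N, 0 < j.val → j.val < N - 1 → Disjoint (K 0) (X j))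
    (D : MarkedDomain N) (D' : MarkedDomain (N + 1)) :
    Pb σ D X ≠ ⊤ ∧
      Filter.Tendsto (fun n => Pb σ D' (cutTuple X (K n))) Filter.atTop (𝓝 (Pb σ D X)) := by
  have : LocallyCompactSpace M := ChartedSpace.locallyCompactSpace E M
  have : SigmaCompactSpace M := sigmaCompactSpace_of_locallyCompact_secondCountable
  refine ⟨Pb_ne_top σ hN hX hcyc hthree D, tendsto_order.2 ⟨fun y hy => ?_, fun y hy => ?_⟩⟩
  · exact .of_forall fun n => hy.trans_le (Pb_le_Pb_cutTuple σ (by omega) X (K n) D D')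
  · simp only [Pb, iInf_lt_iff] at hy
    obtain ⟨Φ, hΦ, hΦy⟩ := hy
    -- The neighbourhoods of a single almost optimal map determine how small `K n` has to be.
    choose U hU hXU hUD using hΦ.mapsTo_arc
    filter_upwards [eventually_subset_of_tendsto_hausdorffEDist
      ((hX ⟨0, by omega⟩).inter (hX ⟨N - 1, by omega⟩))
      ((hU ⟨0, by omega⟩).inter (hU ⟨N - 1, by omega⟩))
      (Set.inter_subset_inter (hXU _) (hXU _)) hKlim] with n hn
    refine (Pb_cutTuple_le σ hN hX rfl ?_ (hKnhds n) D D' hΦ hU hXU hUD hn).trans_lt hΦy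
    simp only; omega
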